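/- Let $(\mathcal{C},\otimes,\mathbb{1})$ be a monoidal bicategory (associativity and unit constraints, here $a$, $l$, $r$, are pseudonatural adjoint equivalences; a superscript $\circ$ denotes the chosen pseudo-inverse). A \emph{biexact pairing} $x\dashv y$ consists of $1$-morphisms $\mathrm{ev}\colon x\otimes y\to\mathbb{1}$ (the evaluation) and $\mathrm{coev}\colon\mathbb{1}\to y\otimes x$ together with invertible $2$-morphisms $$r\circ(y\otimes\mathrm{ev})\circ a\circ(\mathrm{coev}\otimes y)\circ l^{\circ}\;\cong\;\mathrm{id}_y,\qquad \mathrm{id}_x\;\cong\;l\circ(\mathrm{ev}\otimes x)\circ a^{\circ}\circ(x\otimes\mathrm{coev})\circ r^{\circ},$$ on which no further condition is imposed. A \emph{pseudomonoid} is an object $A$ with $1$-morphisms $\mu\colon A\otimes A\to A$, $\eta\colon\mathbb{1}\to A$ and invertible $2$-morphisms expressing associativity and left and right unitality, subject to the pentagon and triangle axioms; a \emph{pseudocomonoid} is a pseudomonoid in the monoidal bicategory obtained by reversing $1$-morphisms. Let $(A,\mu,\eta)$ be a pseudomonoid in $\mathcal{C}$. The following are equivalent: 1. There exists a $1$-morphism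 $\varepsilon\colon A\to\mathbb{1}$ such that $\varepsilon\circ\mu\colon A\otimes A\to\mathbb{1}$ is the evaluation of a biexact pairing $A\dashv A$. 2. There exists a $1$-morphism $\sigma\colon A\otimes A\to\mathbb{1}$ that is the evaluation of a biexact pairing $A\dashv A$, together with an invertible $2$-morphism $\sigma\circ(\mu\otimes A)\cong\sigma\circ(A\otimes\mu)\circ a$. 3. There exist a pseudocomonoid structure on $A$, with comultiplication $\delta\colon A\to A\otimes A$ and counit $\varepsilon\colon A\to\mathbb{1}$, and invertible $2$-morphisms $$(\mu\otimes A)\circ a^{\circ}\circ(A\otimes\delta)\;\cong\;\delta\circ\mu\;\cong\;(A\otimes\mu)\circ a\circ(\delta\otimes A).$$ -/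

import Mathlib

open CategoryTheory Bicategory
open scoped CategoryTheory.Prod CategoryTheory.Pseudofunctor.StrongTrans

universe w v u

namespace MonBicat

/-! ### Pseudofunctors between products -/

section Products

variable {B : Type u} [Bicategory.{w, v} B] {B' : Type u} [Bicategory.{w, v} B']
  {C : Type u} [Bicategory.{w, v} C] {C' : Type u} [Bicategory.{w, v} C']

/-- The product `F × G` of two pseudofunctors. -/
def prodMap (F : B ⥤ᵖ B') (G : C ⥤ᵖ C') : (B × C) ⥤ᵖ (B' × C') where
  obj X := (F.obj X.1, G.obj X.2)
  map f := F.map f.1 ×ₘ G.map f.2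
  map₂ η := F.map₂ η.1 ×ₘ G.map₂ η.2
  mapId X := Iso.prod (F.mapId X.1) (G.mapId X.2)
  mapComp f g := Iso.prod (F.mapComp f.1 g.1) (G.mapComp f.2 g.2)

/-- The rebracketing pseudofunctor `(B × B') × C ⥤ᵖ B × (B' × C)`. -/
def prodAssoc (B B' C : Type u) [Bicategory.{w, v} B] [Bicategory.{w, v} B']
    [Bicategory.{w, v} C] : ((B × B') × C) ⥤ᵖ (B × (B' × C)) where
  obj X := (X.1.1, (X.1.2, X.2))
  map f := f.1.1 ×ₘ (f.1.2 ×ₘ f.2)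
  map₂ η := η.1.1 ×ₘ (η.1.2 ×ₘ η.2)
  mapId _ := Iso.refl _
  mapComp _ _ := Iso.refl _

end Products

/-- An invertible 2-cell filling the square with sides `f`, `g` and top and bottom `p`, `q`. -/
abbrev Sq {B : Type u} [Bicategory.{w, v} B] {a a' b b' : B}
    (f : a ⟶ a') (g : b ⟶ b') (p : a ⟶ b) (q : a' ⟶ b') :=
  f ≫ q ≅ p ≫ g

namespace Sq

variable {B : Type u} [Bicategory.{w, v} B]

/-- The canonical square `f ≫ 𝟙 ≅ 𝟙 ≫ f`. -/
def idSq {a a' : B} (f : a ⟶ a') : Sq f f (𝟙 a) (𝟙 a') :=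
  ρ_ f ≪≫ (λ_ f).symm

/-- Pasting of two adjacent squares. -/
def paste {a a' b b' c c' : B} {f : a ⟶ a'} {g : b ⟶ b'} {h : c ⟶ c'}
    {p : a ⟶ b} {q : a' ⟶ b'} {r : b ⟶ c} {s : b' ⟶ c'}
    (θ : Sq f g p q) (θ' : Sq g h r s) : Sq f h (p ≫ r) (q ≫ s) :=
  (α_ f q s).symm ≪≫ whiskerRightIso θ s ≪≫ α_ p g s ≪≫ whiskerLeftIso p θ' ≪≫ (α_ p r h).symm

end Sq

/-! ### Monoidal bicategories -/

/-- `(X, Y, Z) ↦ (X ⊗ Y) ⊗ Z` for a pseudofunctor `T = ⊗`. -/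
def tripleL {B : Type u} [Bicategory.{w, v} B] (T : (B × B) ⥤ᵖ B) : ((B × B) × B) ⥤ᵖ B :=
  (prodMap T (Pseudofunctor.id B)).comp T

/-- `(X, Y, Z) ↦ X ⊗ (Y ⊗ Z)` for a pseudofunctor `T = ⊗`. -/
def tripleR {B : Type u} [Bicategory.{w, v} B] (T : (B × B) ⥤ᵖ B) : ((B × B) × B) ⥤ᵖ B :=
  (prodAssoc B B B).comp ((prodMap (Pseudofunctor.id B) T).comp T)

/-- The tensor product, the unit object, and the associativity and unit pseudonatural adjoint
equivalences of a monoidal bicategory. The equivalences `≌` are those of the bicategory of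
pseudofunctors, strong (pseudonatural) transformations and modifications. -/
class MonoidalData (B : Type u) [Bicategory.{w, v} B] where
  /-- The tensor product. -/
  tensor : (B × B) ⥤ᵖ B
  /-- The unit object. -/
  one : B
  /-- `(X ⊗ Y) ⊗ Z ≌ X ⊗ (Y ⊗ Z)`. -/
  assoc : tripleL tensor ≌ tripleR tensor
  /-- `𝟙 ⊗ X ≌ X`. -/
  lUnit : (Bicategory.Prod.sectR one B).toPseudofunctor.comp tensor ≌ Pseudofunctor.id B
  /-- `X ⊗ 𝟙 ≌ X`. -/
  rUnit : (Bicategory.Prod.sectL B one).toPseudofunctor.comp tensor ≌ Pseudofunctor.id B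

section Data

variable {B : Type u} [Bicategory.{w, v} B] [MonoidalData B]

/-- Tensor product of objects. -/
abbrev tObj (X Y : B) : B := (MonoidalData.tensor (B := B)).obj (X, Y)

infixr:83 " ⊠ " => tObj

/-- Tensor product of 1-cells. -/
abbrev tHom {X X' Y Y' : B} (f : X ⟶ X') (g : Y ⟶ Y') : X ⊠ Y ⟶ X' ⊠ Y' :=
  (MonoidalData.tensor (B := B)).map (f ×ₘ g)

infixr:83 " ⊠₁ " => tHom

/-- `X ⊠ₗ f` is the 1-cell `id_X ⊗ f`. -/
abbrev tLeft (X : B) {Y Y' : B} (f : Y ⟶ Y') : X ⊠ Y ⟶ X ⊠ Y' := 𝟙 X ⊠₁ f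

infixr:83 " ⊠ₗ " => tLeft

/-- `f ⊠ᵣ Y` is the 1-cell `f ⊗ id_Y`. -/
abbrev tRight {X X' : B} (f : X ⟶ X') (Y : B) : X ⊠ Y ⟶ X' ⊠ Y := f ⊠₁ 𝟙 Y

infixl:83 " ⊠ᵣ " => tRight

/-- Tensor product of invertible 2-cells. -/
def tIso {X X' Y Y' : B} {f f' : X ⟶ X'} {g g' : Y ⟶ Y'} (θ : f ≅ f') (ψ : g ≅ g') :
    f ⊠₁ g ≅ f' ⊠₁ g' :=
  (MonoidalData.tensor (B := B)).map₂Iso (Iso.prod θ ψ)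

/-- The composition constraint of the tensor product. -/
def tComp {X X' X'' Y Y' Y'' : B} (f : X ⟶ X') (f' : X' ⟶ X'') (g : Y ⟶ Y') (g' : Y' ⟶ Y'') :
    (f ≫ f') ⊠₁ (g ≫ g') ≅ f ⊠₁ g ≫ f' ⊠₁ g' :=
  (MonoidalData.tensor (B := B)).mapComp (f ×ₘ g) (f' ×ₘ g')

/-- The unit constraint of the tensor product. -/
def tId (X Y : B) : 𝟙 X ⊠₁ 𝟙 Y ≅ 𝟙 (X ⊠ Y) :=
  (MonoidalData.tensor (B := B)).mapId (X, Y)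

/-- Tensor product of squares. -/
def tSq {a a' b b' c c' d d' : B} {f : a ⟶ a'} {g : b ⟶ b'} {p : a ⟶ b} {q : a' ⟶ b'}
    {h : c ⟶ c'} {k : d ⟶ d'} {r : c ⟶ d} {s : c' ⟶ d'}
    (θ : Sq f g p q) (ψ : Sq h k r s) : Sq (f ⊠₁ h) (g ⊠₁ k) (p ⊠₁ r) (q ⊠₁ s) :=
  (tComp f q h s).symm ≪≫ tIso θ ψ ≪≫ tComp p g r k

/-- The interchange 2-cell `(id ⊗ g) ∘ (f ⊗ id) ≅ (f ⊗ id) ∘ (id ⊗ g)`. -/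
def interchange {X X' Y Y' : B} (f : X ⟶ X') (g : Y ⟶ Y') :
    (f ⊠ᵣ Y) ≫ (X' ⊠ₗ g) ≅ (X ⊠ₗ g) ≫ (f ⊠ᵣ Y') :=
  tSq (Sq.idSq f) (Sq.idSq g).symm

/-- `X ⊗ -` preserves composition. -/
def lComp (X : B) {Y Y' Y'' : B} (f : Y ⟶ Y') (g : Y' ⟶ Y'') :
    X ⊠ₗ (f ≫ g) ≅ (X ⊠ₗ f) ≫ (X ⊠ₗ g) :=
  tIso (λ_ (𝟙 X)).symm (Iso.refl _) ≪≫ tComp _ _ _ _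

/-- `- ⊗ Y` preserves composition. -/
def rComp {X X' X'' : B} (f : X ⟶ X') (g : X' ⟶ X'') (Y : B) :
    (f ≫ g) ⊠ᵣ Y ≅ (f ⊠ᵣ Y) ≫ (g ⊠ᵣ Y) :=
  tIso (Iso.refl _) (λ_ (𝟙 Y)).symm ≪≫ tComp _ _ _ _

/-- `X ⊗ -` preserves threefold composition. -/
def lComp₃ (X : B) {Y₀ Y₁ Y₂ Y₃ : B} (f : Y₀ ⟶ Y₁) (g : Y₁ ⟶ Y₂) (h : Y₂ ⟶ Y₃) :
    X ⊠ₗ (f ≫ g ≫ h) ≅ (X ⊠ₗ f) ≫ (X ⊠ₗ g) ≫ (X ⊠ₗ h) :=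
  lComp X f (g ≫ h) ≪≫ whiskerLeftIso _ (lComp X g h)

/-- `- ⊗ Y` preserves threefold composition. -/
def rComp₃ {X₀ X₁ X₂ X₃ : B} (f : X₀ ⟶ X₁) (g : X₁ ⟶ X₂) (h : X₂ ⟶ X₃) (Y : B) :
    (f ≫ g ≫ h) ⊠ᵣ Y ≅ (f ⊠ᵣ Y) ≫ (g ⊠ᵣ Y) ≫ (h ⊠ᵣ Y) :=
  rComp f (g ≫ h) Y ≪≫ whiskerLeftIso _ (rComp g h Y)

/-- `X ⊗ θ` for an invertible 2-cell `θ`. -/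
def lIso (X : B) {Y Y' : B} {f g : Y ⟶ Y'} (θ : f ≅ g) : X ⊠ₗ f ≅ X ⊠ₗ g :=
  tIso (Iso.refl _) θ

/-- `θ ⊗ Y` for an invertible 2-cell `θ`. -/
def rIso {X X' : B} {f g : X ⟶ X'} (θ : f ≅ g) (Y : B) : f ⊠ᵣ Y ≅ g ⊠ᵣ Y :=
  tIso θ (Iso.refl _)

/-- The associativity 1-cell `(X ⊗ Y) ⊗ Z ⟶ X ⊗ (Y ⊗ Z)`. -/
abbrev ass (X Y Z : B) : (X ⊠ Y) ⊠ Z ⟶ X ⊠ (Y ⊠ Z) :=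
  (MonoidalData.assoc (B := B)).hom.app ((X, Y), Z)

/-- The pseudo-inverse `X ⊗ (Y ⊗ Z) ⟶ (X ⊗ Y) ⊗ Z` of the associativity 1-cell. -/
abbrev assInv (X Y Z : B) : X ⊠ (Y ⊠ Z) ⟶ (X ⊠ Y) ⊠ Z :=
  (MonoidalData.assoc (B := B)).inv.app ((X, Y), Z)

/-- The pseudonaturality of the associativity 1-cells. -/
def assNat {X X' Y Y' Z Z' : B} (f : X ⟶ X') (g : Y ⟶ Y') (h : Z ⟶ Z') :
    Sq ((f ⊠₁ g) ⊠₁ h) (f ⊠₁ (g ⊠₁ h)) (ass X Y Z) (ass X' Y' Z') :=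
  (MonoidalData.assoc (B := B)).hom.naturality ((f ×ₘ g) ×ₘ h)

/-- Pseudonaturality of associativity in the first variable alone. -/
def assNat₁ {X X' : B} (f : X ⟶ X') (Y Z : B) :
    ((f ⊠ᵣ Y) ⊠ᵣ Z) ≫ ass X' Y Z ≅ ass X Y Z ≫ (f ⊠ᵣ (Y ⊠ Z)) :=
  assNat f (𝟙 Y) (𝟙 Z) ≪≫ whiskerLeftIso _ (tIso (Iso.refl f) (tId Y Z))

/-- Pseudonaturality of associativity in the second variable alone. -/
def assNat₂ (X : B) {Y Y' : B} (g : Y ⟶ Y') (Z : B) :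
    ((X ⊠ₗ g) ⊠ᵣ Z) ≫ ass X Y' Z ≅ ass X Y Z ≫ (X ⊠ₗ (g ⊠ᵣ Z)) :=
  assNat (𝟙 X) g (𝟙 Z)

/-- Pseudonaturality of associativity in the third variable alone. -/
def assNat₃ (X Y : B) {Z Z' : B} (h : Z ⟶ Z') :
    ((X ⊠ Y) ⊠ₗ h) ≫ ass X Y Z' ≅ ass X Y Z ≫ (X ⊠ₗ (Y ⊠ₗ h)) :=
  whiskerRightIso (tIso (tId X Y).symm (Iso.refl h)) _ ≪≫ assNat (𝟙 X) (𝟙 Y) h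

/-- The unit object. -/
abbrev unit (B : Type u) [Bicategory.{w, v} B] [MonoidalData B] : B := MonoidalData.one

/-- The left unit 1-cell `𝟙 ⊗ X ⟶ X`. -/
abbrev lun (X : B) : unit B ⊠ X ⟶ X := (MonoidalData.lUnit (B := B)).hom.app X

/-- The pseudo-inverse `X ⟶ 𝟙 ⊗ X` of the left unit 1-cell. -/
abbrev lunInv (X : B) : X ⟶ unit B ⊠ X := (MonoidalData.lUnit (B := B)).inv.app X

/-- The right unit 1-cell `X ⊗ 𝟙 ⟶ X`. -/
abbrev run (X : B) : X ⊠ unit B ⟶ X := (MonoidalData.rUnit (B := B)).hom.app X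

/-- The pseudo-inverse `X ⟶ X ⊗ 𝟙` of the right unit 1-cell. -/
abbrev runInv (X : B) : X ⟶ X ⊠ unit B := (MonoidalData.rUnit (B := B)).inv.app X

/-- The pseudonaturality of the left unit 1-cells. -/
def lunNat {X X' : B} (f : X ⟶ X') : Sq (unit B ⊠ₗ f) f (lun X) (lun X') :=
  (MonoidalData.lUnit (B := B)).hom.naturality f

/-- The pseudonaturality of the right unit 1-cells. -/
def runNat {X X' : B} (f : X ⟶ X') : Sq (f ⊠ᵣ unit B) f (run X) (run X') :=
  (MonoidalData.rUnit (B := B)).hom.naturality f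

end Data

/-- A monoidal bicategory (a tricategory with one object): the pseudonatural equivalences of
`MonoidalData` together with four invertible modifications, subject to the nonabelian 4-cocycle
condition and the two normalization conditions. -/
class MonoidalBicategory (B : Type u) [Bicategory.{w, v} B] extends MonoidalData B where
  /-- The pentagonator. -/
  pent (W X Y Z : B) :
    (ass W X Y ⊠ᵣ Z) ≫ ass W (X ⊠ Y) Z ≫ (W ⊠ₗ ass X Y Z) ≅
      ass (W ⊠ X) Y Z ≫ ass W X (Y ⊠ Z)
  /-- The middle 2-unitor. -/
  midUnit (X Y : B) : ass X (unit B) Y ≫ (X ⊠ₗ lun Y) ≅ run X ⊠ᵣ Y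
  /-- The left 2-unitor. -/
  leftUnit (X Y : B) : ass (unit B) X Y ≫ lun (X ⊠ Y) ≅ lun X ⊠ᵣ Y
  /-- The right 2-unitor. -/
  rightUnit (X Y : B) : ass X Y (unit B) ≫ (X ⊠ₗ run Y) ≅ run (X ⊠ Y)
  /-- The pentagonator is a modification. -/
  pent_naturality {W W' X X' Y Y' Z Z' : B}
      (f : W ⟶ W') (g : X ⟶ X') (h : Y ⟶ Y') (k : Z ⟶ Z') :
    (((f ⊠₁ g) ⊠₁ h) ⊠₁ k) ◁ (pent W' X' Y' Z').hom ≫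
        ((assNat (f ⊠₁ g) h k).paste (assNat f g (h ⊠₁ k))).hom =
      ((tSq (assNat f g h) (Sq.idSq k)).paste
          ((assNat f (g ⊠₁ h) k).paste (tSq (Sq.idSq f) (assNat g h k)))).hom ≫
        (pent W X Y Z).hom ▷ (f ⊠₁ (g ⊠₁ (h ⊠₁ k)))
  /-- The middle 2-unitor is a modification. -/
  midUnit_naturality {X X' Y Y' : B} (f : X ⟶ X') (g : Y ⟶ Y') :
    ((f ⊠ᵣ unit B) ⊠₁ g) ◁ (midUnit X' Y').hom ≫ (tSq (runNat f) (Sq.idSq g)).hom =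
      ((assNat f (𝟙 (unit B)) g).paste (tSq (Sq.idSq f) (lunNat g))).hom ≫
        (midUnit X Y).hom ▷ (f ⊠₁ g)
  /-- The left 2-unitor is a modification. -/
  leftUnit_naturality {X X' Y Y' : B} (f : X ⟶ X') (g : Y ⟶ Y') :
    ((unit B ⊠ₗ f) ⊠₁ g) ◁ (leftUnit X' Y').hom ≫ (tSq (lunNat f) (Sq.idSq g)).hom =
      ((assNat (𝟙 (unit B)) f g).paste (lunNat (f ⊠₁ g))).hom ≫
        (leftUnit X Y).hom ▷ (f ⊠₁ g)
  /-- The right 2-unitor is a modification. -/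
  rightUnit_naturality {X X' Y Y' : B} (f : X ⟶ X') (g : Y ⟶ Y') :
    ((f ⊠₁ g) ⊠ᵣ unit B) ◁ (rightUnit X' Y').hom ≫ (runNat (f ⊠₁ g)).hom =
      ((assNat f g (𝟙 (unit B))).paste (tSq (Sq.idSq f) (runNat g))).hom ≫
        (rightUnit X Y).hom ▷ (f ⊠₁ g)
  /-- The nonabelian 4-cocycle condition (Stasheff polytope `K₅`). -/
  cocycle (V W X Y Z : B) :
    ((rComp₃ (ass V W X ⊠ᵣ Y) (ass V (W ⊠ X) Y) (V ⊠ₗ ass W X Y) Z).inv ≫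
          (rIso (pent V W X Y) Z).hom ≫
          (rComp (ass (V ⊠ W) X Y) (ass V W (X ⊠ Y)) Z).hom) ▷
        (ass V (W ⊠ (X ⊠ Y)) Z ≫ (V ⊠ₗ ass W (X ⊠ Y) Z) ≫ (V ⊠ₗ (W ⊠ₗ ass X Y Z))) ⊗≫
      (ass (V ⊠ W) X Y ⊠ᵣ Z) ◁ (pent V W (X ⊠ Y) Z).hom ▷ (V ⊠ₗ (W ⊠ₗ ass X Y Z)) ⊗≫
      ((ass (V ⊠ W) X Y ⊠ᵣ Z) ≫ ass (V ⊠ W) (X ⊠ Y) Z) ◁ (assNat₃ V W (ass X Y Z)).inv ⊗≫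
      (pent (V ⊠ W) X Y Z).hom ▷ ass V W (X ⊠ (Y ⊠ Z)) =
    𝟙 _ ⊗≫
      (((ass V W X ⊠ᵣ Y) ⊠ᵣ Z) ≫ (ass V (W ⊠ X) Y ⊠ᵣ Z)) ◁ (assNat₂ V (ass W X Y) Z).hom ▷
        ((V ⊠ₗ ass W (X ⊠ Y) Z) ≫ (V ⊠ₗ (W ⊠ₗ ass X Y Z))) ⊗≫
      (((ass V W X ⊠ᵣ Y) ⊠ᵣ Z) ≫ (ass V (W ⊠ X) Y ⊠ᵣ Z) ≫ ass V ((W ⊠ X) ⊠ Y) Z) ◁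
        ((lComp₃ V (ass W X Y ⊠ᵣ Z) (ass W (X ⊠ Y) Z) (W ⊠ₗ ass X Y Z)).inv ≫
          (lIso V (pent W X Y Z)).hom ≫
          (lComp V (ass (W ⊠ X) Y Z) (ass W X (Y ⊠ Z))).hom) ⊗≫
      ((ass V W X ⊠ᵣ Y) ⊠ᵣ Z) ◁ (pent V (W ⊠ X) Y Z).hom ▷ (V ⊠ₗ ass W X (Y ⊠ Z)) ⊗≫
      (assNat₁ (ass V W X) Y Z).hom ▷ (ass V (W ⊠ X) (Y ⊠ Z) ≫ (V ⊠ₗ ass W X (Y ⊠ Z))) ⊗≫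
      ass ((V ⊠ W) ⊠ X) Y Z ◁ (pent V W X (Y ⊠ Z)).hom ⊗≫ 𝟙 _
  /-- The left normalization condition. -/
  left_normalization (X Y Z : B) :
    (pent X (unit B) Y Z).hom ▷ (X ⊠ₗ lun (Y ⊠ Z)) ⊗≫
      ass (X ⊠ unit B) Y Z ◁ (midUnit X (Y ⊠ Z)).hom ⊗≫
      (assNat₁ (run X) Y Z).inv =
    𝟙 _ ⊗≫
      ((ass X (unit B) Y ⊠ᵣ Z) ≫ ass X (unit B ⊠ Y) Z) ◁
        ((lComp X (ass (unit B) Y Z) (lun (Y ⊠ Z))).inv ≫ (lIso X (leftUnit Y Z)).hom) ⊗≫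
      (ass X (unit B) Y ⊠ᵣ Z) ◁ (assNat₂ X (lun Y) Z).inv ⊗≫
      ((rComp (ass X (unit B) Y) (X ⊠ₗ lun Y) Z).inv ≫ (rIso (midUnit X Y) Z).hom) ▷
        ass X Y Z
  /-- The right normalization condition. -/
  right_normalization (X Y Z : B) :
    (pent X Y (unit B) Z).hom ▷ (X ⊠ₗ (Y ⊠ₗ lun Z)) ⊗≫
      ass (X ⊠ Y) (unit B) Z ◁ (assNat₃ X Y (lun Z)).inv ⊗≫
      (midUnit (X ⊠ Y) Z).hom ▷ ass X Y Z =
    𝟙 _ ⊗≫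
      ((ass X Y (unit B) ⊠ᵣ Z) ≫ ass X (Y ⊠ unit B) Z) ◁
        ((lComp X (ass Y (unit B) Z) (Y ⊠ₗ lun Z)).inv ≫ (lIso X (midUnit Y Z)).hom) ⊗≫
      (ass X Y (unit B) ⊠ᵣ Z) ◁ (assNat₂ X (run Y) Z).inv ⊗≫
      ((rComp (ass X Y (unit B)) (X ⊠ₗ run Y) Z).inv ≫ (rIso (rightUnit X Y) Z).hom) ▷
        ass X Y Z

section Algebra

variable {B : Type u} [Bicategory.{w, v} B] [MonoidalBicategory B]

open MonoidalBicategory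

/-- A pseudomonoid structure on an object of a monoidal bicategory. -/
structure Pseudomonoid (A : B) where
  /-- The multiplication `μ`. -/
  mul : A ⊠ A ⟶ A
  /-- The unit `η`. -/
  one : unit B ⟶ A
  /-- The associator `α`. -/
  α : (mul ⊠ᵣ A) ≫ mul ≅ ass A A A ≫ (A ⊠ₗ mul) ≫ mul
  /-- The left unitor `λ`. -/
  lam : (one ⊠ᵣ A) ≫ mul ≅ lun A
  /-- The right unitor `ρ`. -/
  rho : (A ⊠ₗ one) ≫ mul ≅ run A
  /-- The pentagon axiom. -/
  pentagon :
    ((rComp (mul ⊠ᵣ A) mul A).inv ≫ (rIso α A).hom ≫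
          (rComp₃ (ass A A A) (A ⊠ₗ mul) mul A).hom) ▷ mul ⊗≫
      ((ass A A A ⊠ᵣ A) ≫ ((A ⊠ₗ mul) ⊠ᵣ A)) ◁ α.hom ⊗≫
      (ass A A A ⊠ᵣ A) ◁ (assNat₂ A mul A).hom ▷ ((A ⊠ₗ mul) ≫ mul) ⊗≫
      ((ass A A A ⊠ᵣ A) ≫ ass A (A ⊠ A) A) ◁
        ((lComp A (mul ⊠ᵣ A) mul).inv ≫ (lIso A α).hom ≫
          (lComp₃ A (ass A A A) (A ⊠ₗ mul) mul).hom) ▷ mul ⊗≫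
      (pent A A A A).hom ▷ ((A ⊠ₗ (A ⊠ₗ mul)) ≫ (A ⊠ₗ mul) ≫ mul) =
    𝟙 _ ⊗≫
      ((mul ⊠ᵣ A) ⊠ᵣ A) ◁ α.hom ⊗≫
      (assNat₁ mul A A).hom ▷ ((A ⊠ₗ mul) ≫ mul) ⊗≫
      ass (A ⊠ A) A A ◁ (interchange mul mul).hom ▷ mul ⊗≫
      (ass (A ⊠ A) A A ≫ ((A ⊠ A) ⊠ₗ mul)) ◁ α.hom ⊗≫
      ass (A ⊠ A) A A ◁ (assNat₃ A A mul).hom ▷ ((A ⊠ₗ mul) ≫ mul) ⊗≫ 𝟙 _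
  /-- The unit axiom. -/
  triangle :
    ((A ⊠ₗ one) ⊠ᵣ A) ◁ α.hom ⊗≫
      (assNat₂ A one A).hom ▷ ((A ⊠ₗ mul) ≫ mul) ⊗≫
      ass A (unit B) A ◁ ((lComp A (one ⊠ᵣ A) mul).inv ≫ (lIso A lam).hom) ▷ mul ⊗≫
      (midUnit A A).hom ▷ mul =
    𝟙 _ ⊗≫ ((rComp (A ⊠ₗ one) mul A).inv ≫ (rIso rho A).hom) ▷ mul ⊗≫ 𝟙 _

/-- A pseudocomonoid structure on an object of a monoidal bicategory, i.e. a pseudomonoid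
structure in the bicategory with reversed 1-cells, spelled out. -/
structure Pseudocomonoid (A : B) where
  /-- The comultiplication `δ`. -/
  comul : A ⟶ A ⊠ A
  /-- The counit `ε`. -/
  counit : A ⟶ unit B
  /-- The coassociator. -/
  α : comul ≫ (comul ⊠ᵣ A) ≫ ass A A A ≅ comul ≫ (A ⊠ₗ comul)
  /-- The left counitor. -/
  lam : comul ≫ (counit ⊠ᵣ A) ≫ lun A ≅ 𝟙 A
  /-- The right counitor. -/
  rho : comul ≫ (A ⊠ₗ counit) ≫ run A ≅ 𝟙 A
  /-- The pentagon axiom. -/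
  pentagon :
    comul ◁ ((rComp₃ comul (comul ⊠ᵣ A) (ass A A A) A).inv ≫ (rIso α A).hom ≫
          (rComp comul (A ⊠ₗ comul) A).hom) ▷ (ass A (A ⊠ A) A ≫ (A ⊠ₗ ass A A A)) ⊗≫
      (comul ≫ (comul ⊠ᵣ A)) ◁ (assNat₂ A comul A).hom ▷ (A ⊠ₗ ass A A A) ⊗≫
      α.hom ▷ ((A ⊠ₗ (comul ⊠ᵣ A)) ≫ (A ⊠ₗ ass A A A)) ⊗≫
      comul ◁ ((lComp₃ A comul (comul ⊠ᵣ A) (ass A A A)).inv ≫ (lIso A α).hom ≫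
          (lComp A comul (A ⊠ₗ comul)).hom) =
    𝟙 _ ⊗≫
      (comul ≫ (comul ⊠ᵣ A) ≫ ((comul ⊠ᵣ A) ⊠ᵣ A)) ◁ (pent A A A A).hom ⊗≫
      (comul ≫ (comul ⊠ᵣ A)) ◁ (assNat₁ comul A A).hom ▷ ass A A (A ⊠ A) ⊗≫
      α.hom ▷ ((comul ⊠ᵣ (A ⊠ A)) ≫ ass A A (A ⊠ A)) ⊗≫
      comul ◁ (interchange comul comul).inv ▷ ass A A (A ⊠ A) ⊗≫
      (comul ≫ (comul ⊠ᵣ A)) ◁ (assNat₃ A A comul).hom ⊗≫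
      α.hom ▷ (A ⊠ₗ (A ⊠ₗ comul)) ⊗≫ 𝟙 _
  /-- The counit axiom. -/
  triangle :
    (comul ≫ (comul ⊠ᵣ A) ≫ ((A ⊠ₗ counit) ⊠ᵣ A)) ◁ (midUnit A A).inv ⊗≫
      (comul ≫ (comul ⊠ᵣ A)) ◁ (assNat₂ A counit A).hom ▷ (A ⊠ₗ lun A) ⊗≫
      α.hom ▷ ((A ⊠ₗ (counit ⊠ᵣ A)) ≫ (A ⊠ₗ lun A)) ⊗≫
      comul ◁ ((lComp₃ A comul (counit ⊠ᵣ A) (lun A)).inv ≫ (lIso A lam).hom ≫ (tId A A).hom) =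
    𝟙 _ ⊗≫
      comul ◁ ((rComp₃ comul (A ⊠ₗ counit) (run A) A).inv ≫ (rIso rho A).hom ≫
        (tId A A).hom) ⊗≫ 𝟙 _

/-- A biexact pairing `x ⊣ y`. -/
structure BiexactPairing (x y : B) where
  /-- The evaluation. -/
  ev : x ⊠ y ⟶ unit B
  /-- The coevaluation. -/
  coev : unit B ⟶ y ⊠ x
  /-- The zig-zag 2-cell at `y`. -/
  zigzag_right : lunInv y ≫ (coev ⊠ᵣ y) ≫ ass y x y ≫ (y ⊠ₗ ev) ≫ run y ≅ 𝟙 y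
  /-- The zig-zag 2-cell at `x`. -/
  zigzag_left : 𝟙 x ≅ runInv x ≫ (x ⊠ₗ coev) ≫ assInv x y x ≫ (ev ⊠ᵣ x) ≫ lun x

/-- The 1-cell `σ` is the evaluation of some biexact pairing `x ⊣ y`. -/
def IsBiexactEvaluation {x y : B} (σ : x ⊠ y ⟶ unit B) : Prop :=
  ∃ P : BiexactPairing x y, P.ev = σ

end Algebra

end MonBicat

open MonBicat

/-! Biexact pairings and the Frobenius isomorphisms carry no conditions on 2-cells, so they amount
to equations in the ordinary monoidal category `Ho B` of objects and isomorphism classes of 1-cells.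
There the classical arguments on Frobenius monoids apply. Associativity makes ε∘μ invariant (1 ⇒ 2).
An invariant σ equals ε∘μ with ε = σ∘(η⊗A)∘l° (`mul_comp_of_invariant`, 2 ⇒ 1). A Frobenius
structure has evaluation ε∘μ and coevaluation δ∘η (`isPairing_of_frobenius`, 3 ⇒ 1). Given a
coevaluation c, the 1-cell δ = (A⊗μ)∘a∘(c⊗A)∘l° satisfies both Frobenius laws (`mul_comulOf`,
`frobenius_left`).

What `Ho B` cannot see is the coherence of the comonoid in 1 ⇒ 3: the zig-zag 2-cells satisfy no
equation, yet the coassociator and counitors must satisfy the pentagon and the triangle. The remedy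
is linearity. An algebra `Alg` is a right action of A with an invertible associativity 2-cell; A and
every X⊗A are algebras, and δ is a morphism of algebras (`AlgMap.exists_comul`). Suppose act ≫ p :
N⊗A ⟶ K is universal, in the sense that f ↦ (f⊗A) ≫ act ≫ p is an equivalence from 1-cells Z ⟶ N to
1-cells Z⊗A ⟶ K. Then linear 2-cells between algebra morphisms f, g : A ⟶ N correspond bijectively
to arbitrary 2-cells f ≫ p ⟶ g ≫ p (`AlgMap.hom₂_unique`, `AlgMap.exists_hom₂`). The evaluation ε∘μ
is universal, and tensoring on the left preserves universality.

Hence the coassociator and the left counitor can be taken to be the linear 2-cells with a prescribed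
canonical image once ε is applied to the last factor, and the right counitor is solved for from the
triangle. All sides of the two axioms are linear, so only their images must be compared. For the
pentagon these agree whatever the coassociator is (`pentagon_r`); for the triangle they agree by the
choice of the right counitor (`exists_counitor`).

The bicategory `VArr V`, on which B acts, does the bookkeeping. Its 2-cells are compatible pairs.
For V = A a pair (l, l) is a linear 2-cell; for V the unit object a pair (l, r) is a 2-cell with its
image under the test. A diagram pasted in `VArr V` is therefore compatible automatically. This
requires the action to have the coherence 2-cells `actPent`, `actMidUnit` and `actLeftUnit`, which
come from the cocycle, normalization and modification axioms. -/

namespace MonBicat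

/-! ### The monoidal category of isomorphism classes of 1-cells. -/

section HomotopyCategory

variable {B : Type u} [Bicategory.{w, v} B]

/-- The components of an invertible modification. -/
def modIso {C : Type u} [Bicategory.{w, v} C] {F G : B ⥤ᵖ C} {η θ : F ⟶ G} (Γ : η ≅ θ) (X : B) :
    η.app X ≅ θ.app X where
  hom := Γ.hom.as.app X
  inv := Γ.inv.as.app X
  hom_inv_id := congrArg (fun t => t.as.app X) Γ.hom_inv_id
  inv_hom_id := congrArg (fun t => t.as.app X) Γ.inv_hom_id

variable [MonoidalData B]

/-- The unit of the adjoint equivalence `ass ⊣ assInv`. -/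
def assUnit (X Y Z : B) : 𝟙 ((X ⊠ Y) ⊠ Z) ≅ ass X Y Z ≫ assInv X Y Z :=
  modIso (MonoidalData.assoc (B := B)).unit ((X, Y), Z)

/-- The counit of the adjoint equivalence `ass ⊣ assInv`. -/
def assCounit (X Y Z : B) : assInv X Y Z ≫ ass X Y Z ≅ 𝟙 (X ⊠ (Y ⊠ Z)) :=
  modIso (MonoidalData.assoc (B := B)).counit ((X, Y), Z)

/-- The unit of the adjoint equivalence `lun ⊣ lunInv`. -/
def lunUnit (X : B) : 𝟙 (unit B ⊠ X) ≅ lun X ≫ lunInv X :=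
  modIso (MonoidalData.lUnit (B := B)).unit X

/-- The counit of the adjoint equivalence `lun ⊣ lunInv`. -/
def lunCounit (X : B) : lunInv X ≫ lun X ≅ 𝟙 X :=
  modIso (MonoidalData.lUnit (B := B)).counit X

/-- The unit of the adjoint equivalence `run ⊣ runInv`. -/
def runUnit (X : B) : 𝟙 (X ⊠ unit B) ≅ run X ≫ runInv X :=
  modIso (MonoidalData.rUnit (B := B)).unit X

/-- The counit of the adjoint equivalence `run ⊣ runInv`. -/
def runCounit (X : B) : runInv X ≫ run X ≅ 𝟙 X :=
  modIso (MonoidalData.rUnit (B := B)).counit X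

end HomotopyCategory

/-- The category of objects of `B` and isomorphism classes of 1-cells. -/
structure Ho (B : Type u) where
  /-- The underlying object. -/
  as : B

namespace Ho

variable {B : Type u} [Bicategory.{w, v} B]

instance : Category (Ho B) where
  Hom X Y := Quotient (isIsomorphicSetoid (X.as ⟶ Y.as))
  id X := Quotient.mk _ (𝟙 X.as)
  comp := Quotient.map₂ (fun f g => f ≫ g)
    (fun _ _ ⟨θ⟩ _ _ ⟨ψ⟩ => ⟨whiskerRightIso θ _ ≪≫ whiskerLeftIso _ ψ⟩)
  id_comp := by rintro _ _ ⟨f⟩; exact Quotient.sound ⟨λ_ f⟩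
  comp_id := by rintro _ _ ⟨f⟩; exact Quotient.sound ⟨ρ_ f⟩
  assoc := by rintro _ _ _ _ ⟨f⟩ ⟨g⟩ ⟨h⟩; exact Quotient.sound ⟨α_ f g h⟩

/-- The isomorphism class of a 1-cell. -/
def cls {X Y : B} (f : X ⟶ Y) : (⟨X⟩ : Ho B) ⟶ ⟨Y⟩ := Quotient.mk _ f

theorem cls_eq {X Y : B} {f g : X ⟶ Y} : cls f = cls g ↔ Nonempty (f ≅ g) :=
  ⟨fun h => Quotient.exact h, fun h => Quotient.sound h⟩

theorem cls_surjective {X Y : B} (f : (⟨X⟩ : Ho B) ⟶ ⟨Y⟩) : ∃ g : X ⟶ Y, cls g = f :=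
  Quotient.exists_rep f

theorem cls_comp {X Y Z : B} (f : X ⟶ Y) (g : Y ⟶ Z) : cls (f ≫ g) = cls f ≫ cls g := rfl

theorem cls_id (X : B) : cls (𝟙 X) = 𝟙 (⟨X⟩ : Ho B) := rfl

/-- An equivalence gives an isomorphism of isomorphism classes. -/
def isoOfEquiv {X Y : B} (f : X ⟶ Y) (g : Y ⟶ X) (u : 𝟙 X ≅ f ≫ g) (c : g ≫ f ≅ 𝟙 Y) :
    (⟨X⟩ : Ho B) ≅ ⟨Y⟩ where
  hom := cls f
  inv := cls g
  hom_inv_id := Quotient.sound ⟨u.symm⟩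
  inv_hom_id := Quotient.sound ⟨c⟩

/-- The tensor product of isomorphism classes of 1-cells. -/
def tensorCls [MonoidalData B] {X X' Y Y' : B} (f : Quotient (isIsomorphicSetoid (X ⟶ X')))
    (g : Quotient (isIsomorphicSetoid (Y ⟶ Y'))) :
    Quotient (isIsomorphicSetoid (X ⊠ Y ⟶ X' ⊠ Y')) :=
  Quotient.liftOn₂ f g (fun f g => Quotient.mk _ (f ⊠₁ g))
    (fun _ _ _ _ ⟨θ⟩ ⟨ψ⟩ => Quotient.sound ⟨tIso θ ψ⟩)

instance [MonoidalData B] : MonoidalCategoryStruct (Ho B) where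
  tensorObj X Y := ⟨X.as ⊠ Y.as⟩
  tensorHom f g := tensorCls f g
  whiskerLeft X _ _ g := tensorCls (Quotient.mk _ (𝟙 X.as)) g
  whiskerRight f Y := tensorCls f (Quotient.mk _ (𝟙 Y.as))
  tensorUnit := ⟨unit B⟩
  associator X Y Z := isoOfEquiv (ass X.as Y.as Z.as) (assInv X.as Y.as Z.as)
    (assUnit _ _ _) (assCounit _ _ _)
  leftUnitor X := isoOfEquiv (lun X.as) (lunInv X.as) (lunUnit _) (lunCounit _)
  rightUnitor X := isoOfEquiv (run X.as) (runInv X.as) (runUnit _) (runCounit _)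

variable [MonoidalBicategory B]

/-- Each invertible 2-cell of the structure becomes an equation: the pentagonator gives the pentagon
and the middle 2-unitor gives the triangle. -/
instance : MonoidalCategory (Ho B) := MonoidalCategory.ofTensorHom
  (id_tensorHom_id := fun X Y => Quotient.sound ⟨tId X.as Y.as⟩)
  (id_tensorHom := by rintro _ _ _ ⟨f⟩; rfl)
  (tensorHom_id := by rintro _ _ ⟨f⟩ _; rfl)
  (tensorHom_comp_tensorHom := by
    rintro _ _ _ _ _ _ ⟨f⟩ ⟨g⟩ ⟨h⟩ ⟨k⟩; exact Quotient.sound ⟨(tComp f h g k).symm⟩)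
  (associator_naturality := by
    rintro _ _ _ _ _ _ ⟨f⟩ ⟨g⟩ ⟨h⟩; exact Quotient.sound ⟨assNat f g h⟩)
  (leftUnitor_naturality := by rintro _ _ ⟨f⟩; exact Quotient.sound ⟨lunNat f⟩)
  (rightUnitor_naturality := by rintro _ _ ⟨f⟩; exact Quotient.sound ⟨runNat f⟩)
  (pentagon := fun W X Y Z =>
    Quotient.sound ⟨MonoidalBicategory.pent W.as X.as Y.as Z.as⟩)
  (triangle := fun X Y => Quotient.sound ⟨MonoidalBicategory.midUnit X.as Y.as⟩)

open MonoidalCategory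

theorem cls_tLeft (X : B) {Y Y' : B} (f : Y ⟶ Y') :
    cls (X ⊠ₗ f) = (⟨X⟩ : Ho B) ◁ cls f := rfl

theorem cls_tRight {X X' : B} (f : X ⟶ X') (Y : B) :
    cls (f ⊠ᵣ Y) = cls f ▷ (⟨Y⟩ : Ho B) := rfl

theorem cls_ass (X Y Z : B) : cls (ass X Y Z) = (α_ (⟨X⟩ : Ho B) ⟨Y⟩ ⟨Z⟩).hom := rfl
theorem cls_lun (X : B) : cls (lun X) = (λ_ (⟨X⟩ : Ho B)).hom := rfl
theorem cls_lunInv (X : B) : cls (lunInv X) = (λ_ (⟨X⟩ : Ho B)).inv := rfl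
theorem cls_run (X : B) : cls (run X) = (ρ_ (⟨X⟩ : Ho B)).hom := rfl
theorem cls_runInv (X : B) : cls (runInv X) = (ρ_ (⟨X⟩ : Ho B)).inv := rfl

end Ho

end MonBicat

/-! ### Frobenius monoids in an ordinary monoidal category. -/

namespace MonBicat

section NonCoherent

open MonoidalCategory

variable {C : Type*} [Category C] [MonoidalCategory C]

/-- `s` is the evaluation of an exact pairing with coevaluation `c`, with the unit constraints
arranged as in `BiexactPairing`. -/
structure IsPairing {X Y : C} (s : X ⊗ Y ⟶ 𝟙_ C) (c : 𝟙_ C ⟶ Y ⊗ X) : Prop where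
  right : (λ_ Y).inv ≫ c ▷ Y ≫ (α_ Y X Y).hom ≫ Y ◁ s ≫ (ρ_ Y).hom = 𝟙 Y
  left : (ρ_ X).inv ≫ X ◁ c ≫ (α_ X Y X).inv ≫ s ▷ X ≫ (λ_ X).hom = 𝟙 X

theorem IsPairing.whiskerRight_assoc_whiskerLeft {X Y : C} {s : X ⊗ Y ⟶ 𝟙_ C} {c : 𝟙_ C ⟶ Y ⊗ X}
    (h : IsPairing s c) :
    c ▷ Y ≫ (α_ Y X Y).hom ≫ Y ◁ s = (λ_ Y).hom ≫ (ρ_ Y).inv := by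
  rw [← cancel_epi (λ_ Y).inv, ← cancel_mono (ρ_ Y).hom]
  simpa using h.right

variable {A : C} {m : A ⊗ A ⟶ A} {n : 𝟙_ C ⟶ A}

/-- In elements: s(1, xy) = s(1x, y) = s(x, y), by invariance and then the unit law. -/
theorem mul_comp_of_invariant (hl : n ▷ A ≫ m = (λ_ A).hom) {s : A ⊗ A ⟶ 𝟙_ C}
    (hs : m ▷ A ≫ s = (α_ A A A).hom ≫ A ◁ m ≫ s) :
    m ≫ (λ_ A).inv ≫ n ▷ A ≫ s = s := by
  have h : A ◁ m ≫ s = (α_ A A A).inv ≫ m ▷ A ≫ s := by simp [hs]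
  calc m ≫ (λ_ A).inv ≫ n ▷ A ≫ s = (λ_ (A ⊗ A)).inv ≫ n ▷ (A ⊗ A) ≫ A ◁ m ≫ s := by
        rw [← MonoidalCategory.whisker_exchange_assoc]; simp
    _ = ((λ_ A).inv ≫ n ▷ A ≫ m) ▷ A ≫ s := by rw [h]; simp
    _ = s := by rw [hl]; simp

/-- Each zig-zag contains one side of a Frobenius law. Replacing it by `m ≫ d` leaves a unit law
followed by a counit law. -/
theorem isPairing_of_frobenius (hl : n ▷ A ≫ m = (λ_ A).hom) (hr : A ◁ n ≫ m = (ρ_ A).hom)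
    {d : A ⟶ A ⊗ A} {e : A ⟶ 𝟙_ C} (dl : d ≫ e ▷ A ≫ (λ_ A).hom = 𝟙 A)
    (dr : d ≫ A ◁ e ≫ (ρ_ A).hom = 𝟙 A)
    (f₁ : A ◁ d ≫ (α_ A A A).inv ≫ m ▷ A = m ≫ d)
    (f₂ : m ≫ d = d ▷ A ≫ (α_ A A A).hom ≫ A ◁ m) :
    IsPairing (m ≫ e) (n ≫ d) where
  right := by
    calc _ = (λ_ A).inv ≫ n ▷ A ≫ (d ▷ A ≫ (α_ A A A).hom ≫ A ◁ m) ≫ A ◁ e ≫ (ρ_ A).hom := by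
          simp
      _ = (λ_ A).inv ≫ (n ▷ A ≫ m) ≫ d ≫ A ◁ e ≫ (ρ_ A).hom := by rw [← f₂]; simp
      _ = 𝟙 A := by rw [hl, dr]; simp
  left := by
    calc _ = (ρ_ A).inv ≫ A ◁ n ≫ (A ◁ d ≫ (α_ A A A).inv ≫ m ▷ A) ≫ e ▷ A ≫ (λ_ A).hom := by
          simp
      _ = (ρ_ A).inv ≫ (A ◁ n ≫ m) ≫ d ≫ e ▷ A ≫ (λ_ A).hom := by rw [f₁]; simp
      _ = 𝟙 A := by rw [hr, dl]; simp

/-- The comultiplication induced by a coevaluation. -/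
def comulOf (m : A ⊗ A ⟶ A) (c : 𝟙_ C ⟶ A ⊗ A) : A ⟶ A ⊗ A :=
  (λ_ A).inv ≫ c ▷ A ≫ (α_ A A A).hom ≫ A ◁ m

/-- The composite is the zig-zag at the second variable, with the last unit constraint removed. -/
theorem comulOf_counit {e : A ⟶ 𝟙_ C} {c : 𝟙_ C ⟶ A ⊗ A} (h : IsPairing (m ≫ e) c) :
    comulOf m c ≫ A ◁ e = (ρ_ A).inv := by
  have := h.whiskerRight_assoc_whiskerLeft
  simp only [comulOf, Category.assoc, ← MonoidalCategory.whiskerLeft_comp, this,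
    Iso.inv_hom_id_assoc]

/-- Both sides multiply the second leg of `c` by the two factors, in the two possible bracketings.
Only associativity is used, for an arbitrary `c`. -/
theorem mul_comulOf (ha : m ▷ A ≫ m = (α_ A A A).hom ≫ A ◁ m ≫ m) (c : 𝟙_ C ⟶ A ⊗ A) :
    m ≫ comulOf m c = comulOf m c ▷ A ≫ (α_ A A A).hom ≫ A ◁ m := by
  calc _ = (λ_ (A ⊗ A)).inv ≫ c ▷ (A ⊗ A) ≫ (α_ A A (A ⊗ A)).hom ≫ A ◁ (A ◁ m ≫ m) := by
        simp only [comulOf, MonoidalCategory.whiskerLeft_comp, ← MonoidalCategory.associator_naturality_right_assoc]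
        rw [← MonoidalCategory.whisker_exchange_assoc]
        simp
    _ = ((λ_ A).inv ▷ A) ≫ (c ▷ A) ▷ A ≫ (α_ A A A).hom ▷ A ≫ (α_ A (A ⊗ A) A).hom ≫
          A ◁ ((α_ A A A).hom ≫ A ◁ m ≫ m) := by simp
    _ = _ := by rw [← ha]; simp [comulOf]

/-- A morphism into `W ⊗ X` is recovered from its pairing with `Y`: create `Y ⊗ X` by `c`, pair, and
apply the zig-zag at `X`. -/
theorem pairing_injective {X Y Z W : C} {s : X ⊗ Y ⟶ 𝟙_ C} {c : 𝟙_ C ⟶ Y ⊗ X} (h : IsPairing s c)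
    {f g : Z ⟶ W ⊗ X} (hfg : f ▷ Y ≫ (α_ W X Y).hom ≫ W ◁ s = g ▷ Y ≫ (α_ W X Y).hom ≫ W ◁ s) :
    f = g := by
  have key : ∀ f : Z ⟶ W ⊗ X, f = (ρ_ Z).inv ≫ Z ◁ c ≫ (α_ Z Y X).inv ≫
      (f ▷ Y ≫ (α_ W X Y).hom ≫ W ◁ s) ▷ X ≫ (α_ W (𝟙_ C) X).hom ≫ W ◁ (λ_ X).hom := by
    intro f
    have := h.left
    calc f = f ≫ W ◁ ((ρ_ X).inv ≫ X ◁ c ≫ (α_ X Y X).inv ≫ s ▷ X ≫ (λ_ X).hom) := by simp [this]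
      _ = (f ≫ (ρ_ (W ⊗ X)).inv ≫ (W ⊗ X) ◁ c ≫ (α_ (W ⊗ X) Y X).inv) ≫
          ((α_ W X Y).hom ≫ W ◁ s) ▷ X ≫ (α_ W (𝟙_ C) X).hom ≫ W ◁ (λ_ X).hom := by monoidal
      _ = ((ρ_ Z).inv ≫ Z ◁ c ≫ (α_ Z Y X).inv ≫ f ▷ Y ▷ X) ≫
          ((α_ W X Y).hom ≫ W ◁ s) ▷ X ≫ (α_ W (𝟙_ C) X).hom ≫ W ◁ (λ_ X).hom := by
        congr 1
        rw [← MonoidalCategory.associator_inv_naturality_left,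
          MonoidalCategory.whisker_exchange_assoc, MonoidalCategory.rightUnitor_inv_naturality_assoc]
      _ = _ := by simp
  rw [key f, key g, hfg]

/-- The evaluation is nondegenerate, so both sides may be paired with a further factor `A`. Since
pairing the comultiplication gives back the product (`test`), both become the threefold product, up
to associativity. -/
theorem frobenius_left (ha : m ▷ A ≫ m = (α_ A A A).hom ≫ A ◁ m ≫ m) {e : A ⟶ 𝟙_ C}
    {c : 𝟙_ C ⟶ A ⊗ A} (h : IsPairing (m ≫ e) c) :
    A ◁ comulOf m c ≫ (α_ A A A).inv ≫ m ▷ A = m ≫ comulOf m c := by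
  have test : comulOf m c ▷ A ≫ (α_ A A A).hom ≫ A ◁ (m ≫ e) = m ≫ (ρ_ A).inv := by
    rw [MonoidalCategory.whiskerLeft_comp, ← comulOf_counit h, ← Category.assoc m, mul_comulOf ha]
    simp
  apply pairing_injective h
  calc _ = (α_ A A A).hom ≫ A ◁ (comulOf m c ▷ A ≫ (α_ A A A).hom ≫ A ◁ (m ≫ e)) ≫
        (α_ A A (𝟙_ C)).inv ≫ m ▷ 𝟙_ C := by
        have : m ▷ A ▷ A ≫ (α_ A A A).hom ≫ A ◁ (m ≫ e) =
            (α_ (A ⊗ A) A A).hom ≫ (A ⊗ A) ◁ (m ≫ e) ≫ m ▷ 𝟙_ C := by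
          rw [MonoidalCategory.whisker_exchange]; simp
        simp only [MonoidalCategory.comp_whiskerRight, Category.assoc, this]
        monoidal
    _ = m ▷ A ≫ m ≫ (ρ_ A).inv := by rw [test]; simp [reassoc_of% ha]
    _ = _ := by simp [← test]

end NonCoherent

/-! ### Pairings and pseudomonoids read in the homotopy category. -/

namespace Ho

open MonoidalCategory

variable {B : Type u} [Bicategory.{w, v} B] [MonoidalBicategory B]

/-- As no equation is imposed on the zig-zag 2-cells, their mere existence is what is needed. -/
theorem isBiexactEvaluation_iff {x y : B} (s : x ⊠ y ⟶ unit B) :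
    IsBiexactEvaluation s ↔ ∃ c : unit B ⟶ y ⊠ x,
      IsPairing (C := Ho B) (X := ⟨x⟩) (Y := ⟨y⟩) (cls s) (cls c) := by
  constructor
  · rintro ⟨P, rfl⟩
    exact ⟨P.coev, cls_eq.2 ⟨P.zigzag_right⟩, cls_eq.2 ⟨P.zigzag_left.symm⟩⟩
  · rintro ⟨c, hr, hl⟩
    exact ⟨⟨s, c, (cls_eq.1 hr).some, (cls_eq.1 hl).some.symm⟩, rfl⟩

theorem IsBiexactEvaluation.of_iso {x y : B} {s t : x ⊠ y ⟶ unit B} (θ : s ≅ t)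
    (h : IsBiexactEvaluation s) : IsBiexactEvaluation t := by
  rw [isBiexactEvaluation_iff] at *
  rwa [← cls_eq.2 ⟨θ⟩]

variable {A : B} (M : Pseudomonoid A)

theorem cls_mul_assoc : cls M.mul ▷ (⟨A⟩ : Ho B) ≫ cls M.mul =
    (α_ (⟨A⟩ : Ho B) ⟨A⟩ ⟨A⟩).hom ≫ (⟨A⟩ : Ho B) ◁ cls M.mul ≫ cls M.mul :=
  cls_eq.2 ⟨M.α⟩

theorem cls_one_mul : cls M.one ▷ (⟨A⟩ : Ho B) ≫ cls M.mul = (λ_ (⟨A⟩ : Ho B)).hom :=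
  cls_eq.2 ⟨M.lam⟩

theorem cls_mul_one : (⟨A⟩ : Ho B) ◁ cls M.one ≫ cls M.mul = (ρ_ (⟨A⟩ : Ho B)).hom :=
  cls_eq.2 ⟨M.rho⟩

end Ho

end MonBicat

/-! ### Calculus of squares filled by invertible 2-cells. -/

namespace MonBicat

namespace Sq

variable {B : Type u} [Bicategory.{w, v} B]

/-- The identity square on a horizontal 1-cell. -/
def vid {a b : B} (p : a ⟶ b) : Sq (𝟙 a) (𝟙 b) p p := λ_ p ≪≫ (ρ_ p).symm

/-- Stacking of two squares. -/
def vcomp {a a' a'' b b' b'' : B} {f : a ⟶ a'} {g : b ⟶ b'} {f' : a' ⟶ a''} {g' : b' ⟶ b''}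
    {p : a ⟶ b} {q : a' ⟶ b'} {r : a'' ⟶ b''} (θ : Sq f g p q) (φ : Sq f' g' q r) :
    Sq (f ≫ f') (g ≫ g') p r :=
  α_ f f' r ≪≫ whiskerLeftIso f φ ≪≫ (α_ f q g').symm ≪≫ whiskerRightIso θ g' ≪≫ α_ p g g'

/-- Changing the left vertical side of a square. -/
def precomp {a a' b b' : B} {f f' : a ⟶ a'} {g : b ⟶ b'} {p : a ⟶ b} {q : a' ⟶ b'}
    (κ : f' ≅ f) (θ : Sq f g p q) : Sq f' g p q :=
  whiskerRightIso κ q ≪≫ θ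

/-- Changing the horizontal sides of a square. -/
def cast {a a' b b' : B} {f : a ⟶ a'} {g : b ⟶ b'} {p p' : a ⟶ b} {q q' : a' ⟶ b'}
    (κ : p ≅ p') (κ' : q ≅ q') (θ : Sq f g p q) : Sq f g p' q' :=
  whiskerLeftIso f κ'.symm ≪≫ θ ≪≫ whiskerRightIso κ g

/-- Compatibility of two squares with the same horizontal sides with a pair of 2-cells between
their vertical sides. -/
def Cyl {a a' b b' : B} {f f' : a ⟶ a'} {g g' : b ⟶ b'} {p : a ⟶ b} {q : a' ⟶ b'}
    (θ : Sq f g p q) (θ' : Sq f' g' p q) (l : f ⟶ f') (r : g ⟶ g') : Prop :=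
  l ▷ q ≫ θ'.hom = θ.hom ≫ p ◁ r

section Cyl

variable {a a' a'' a₃ b b' b'' b₃ c c' : B}

theorem Cyl.refl {f : a ⟶ a'} {g : b ⟶ b'} {p : a ⟶ b} {q : a' ⟶ b'} (θ : Sq f g p q) :
    Cyl θ θ (𝟙 f) (𝟙 g) := by
  simp [Cyl]

theorem Cyl.congr {f f' : a ⟶ a'} {g g' : b ⟶ b'} {p : a ⟶ b} {q : a' ⟶ b'} {θ : Sq f g p q}
    {θ' : Sq f' g' p q} {l l' : f ⟶ f'} {r r' : g ⟶ g'} (h : Cyl θ θ' l r) (hl : l' = l)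
    (hr : r' = r) : Cyl θ θ' l' r' := by
  rwa [hl, hr]

theorem Cyl.trans {f f' f'' : a ⟶ a'} {g g' g'' : b ⟶ b'} {p : a ⟶ b} {q : a' ⟶ b'}
    {θ : Sq f g p q} {θ' : Sq f' g' p q} {θ'' : Sq f'' g'' p q} {l : f ⟶ f'} {r : g ⟶ g'}
    {l' : f' ⟶ f''} {r' : g' ⟶ g''} (h : Cyl θ θ' l r) (h' : Cyl θ' θ'' l' r') :
    Cyl θ θ'' (l ≫ l') (r ≫ r') := by
  unfold Cyl at *
  rw [comp_whiskerRight, Category.assoc, h', reassoc_of% h, whiskerLeft_comp]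

theorem Cyl.inv {f f' : a ⟶ a'} {g g' : b ⟶ b'} {p : a ⟶ b} {q : a' ⟶ b'}
    {θ : Sq f g p q} {θ' : Sq f' g' p q} {l : f ≅ f'} {r : g ≅ g'} (h : Cyl θ θ' l.hom r.hom) :
    Cyl θ' θ l.inv r.inv := by
  unfold Cyl at *
  rw [← cancel_epi (l.hom ▷ q), reassoc_of% h]
  simp

theorem Cyl.whiskerLeft {f : a ⟶ a'} {g : b ⟶ b'} {f' f'' : a' ⟶ a''} {g' g'' : b' ⟶ b''}
    {p : a ⟶ b} {q : a' ⟶ b'} {r : a'' ⟶ b''} (θ : Sq f g p q) {φ : Sq f' g' q r}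
    {φ' : Sq f'' g'' q r} {x : f' ⟶ f''} {y : g' ⟶ g''} (h : Cyl φ φ' x y) :
    Cyl (θ.vcomp φ) (θ.vcomp φ') (f ◁ x) (g ◁ y) := by
  have h' : f ◁ x ▷ r ≫ f ◁ φ'.hom = f ◁ φ.hom ≫ f ◁ q ◁ y := by
    rw [← whiskerLeft_comp, h, whiskerLeft_comp]
  simp only [Cyl, vcomp, Iso.trans_hom, whiskerLeftIso_hom, whiskerRightIso_hom, Iso.symm_hom,
    whisker_assoc, Category.assoc, Iso.inv_hom_id_assoc, reassoc_of% h']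
  rw [associator_inv_naturality_right_assoc, whisker_exchange_assoc, associator_naturality_right]

theorem Cyl.whiskerRight {f f' : a ⟶ a'} {g g' : b ⟶ b'} {h : a' ⟶ a''} {k : b' ⟶ b''}
    {p : a ⟶ b} {q : a' ⟶ b'} {r : a'' ⟶ b''} {θ : Sq f g p q} {θ' : Sq f' g' p q}
    {x : f ⟶ f'} {y : g ⟶ g'} (hc : Cyl θ θ' x y) (φ : Sq h k q r) :
    Cyl (θ.vcomp φ) (θ'.vcomp φ) (x ▷ h) (y ▷ k) := by
  have h' : x ▷ q ▷ k ≫ θ'.hom ▷ k = θ.hom ▷ k ≫ (p ◁ y) ▷ k := by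
    rw [← comp_whiskerRight, hc, comp_whiskerRight]
  simp only [Cyl, vcomp, Iso.trans_hom, whiskerLeftIso_hom, whiskerRightIso_hom, Iso.symm_hom,
    Category.assoc, associator_naturality_left_assoc, ← whisker_exchange_assoc,
    associator_inv_naturality_left_assoc, reassoc_of% h']
  simp

theorem Cyl.paste {f f' : a ⟶ a'} {g g' : b ⟶ b'} {h h' : c ⟶ c'} {p : a ⟶ b} {q : a' ⟶ b'}
    {r : b ⟶ c} {s : b' ⟶ c'} {θ : Sq f g p q} {θ' : Sq f' g' p q} {φ : Sq g h r s}
    {φ' : Sq g' h' r s} {x : f ⟶ f'} {y : g ⟶ g'} {z : h ⟶ h'} (h₁ : Cyl θ θ' x y)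
    (h₂ : Cyl φ φ' y z) : Cyl (θ.paste φ) (θ'.paste φ') x z := by
  have h₁' : x ▷ q ▷ s ≫ θ'.hom ▷ s = θ.hom ▷ s ≫ (p ◁ y) ▷ s := by
    rw [← comp_whiskerRight, h₁, comp_whiskerRight]
  have h₂' : p ◁ y ▷ s ≫ p ◁ φ'.hom = p ◁ φ.hom ≫ p ◁ r ◁ z := by
    rw [← whiskerLeft_comp, h₂, whiskerLeft_comp]
  simp only [Cyl, Sq.paste, Iso.trans_hom, whiskerLeftIso_hom, whiskerRightIso_hom, Iso.symm_hom,
    Category.assoc, associator_inv_naturality_left_assoc, reassoc_of% h₁', whisker_assoc,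
    Iso.inv_hom_id_assoc, reassoc_of% h₂', comp_whiskerLeft]

theorem Cyl.cast {f f' : a ⟶ a'} {g g' : b ⟶ b'} {p p' : a ⟶ b} {q q' : a' ⟶ b'}
    {θ : Sq f g p q} {θ' : Sq f' g' p q} {l : f ⟶ f'} {r : g ⟶ g'} (h : Cyl θ θ' l r)
    (κ : p ≅ p') (κ' : q ≅ q') : Cyl (θ.cast κ κ') (θ'.cast κ κ') l r := by
  unfold Cyl at *
  simp only [Sq.cast, Iso.trans_hom, whiskerLeftIso_hom, whiskerRightIso_hom, Iso.symm_hom,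
    Category.assoc, ← whisker_exchange_assoc, reassoc_of% h, whisker_exchange]

theorem Cyl.precomp {f f' g₁ g₂ : a ⟶ a'} {g g' : b ⟶ b'} {p : a ⟶ b} {q : a' ⟶ b'}
    {θ : Sq f g p q} {θ' : Sq f' g' p q} {κ : g₁ ≅ f} {κ' : g₂ ≅ f'} {l : g₁ ⟶ g₂}
    {r : g ⟶ g'} (h : Cyl θ θ' (κ.inv ≫ l ≫ κ'.hom) r) :
    Cyl (θ.precomp κ) (θ'.precomp κ') l r := by
  unfold Cyl at *
  simp only [comp_whiskerRight, Category.assoc] at h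
  simp only [Sq.precomp, Iso.trans_hom, whiskerRightIso_hom, Category.assoc, ← h,
    hom_inv_whiskerRight_assoc]

theorem cyl_associator {f : a ⟶ a'} {f' : a' ⟶ a''} {f'' : a'' ⟶ a₃} {g : b ⟶ b'} {g' : b' ⟶ b''}
    {g'' : b'' ⟶ b₃} {p : a ⟶ b} {q : a' ⟶ b'} {r : a'' ⟶ b''} {s : a₃ ⟶ b₃} (θ : Sq f g p q)
    (θ' : Sq f' g' q r) (θ'' : Sq f'' g'' r s) :
    Cyl ((θ.vcomp θ').vcomp θ'') (θ.vcomp (θ'.vcomp θ'')) (α_ f f' f'').hom (α_ g g' g'').hom := by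
  simp [Cyl, vcomp]

theorem cyl_leftUnitor {f : a ⟶ a'} {g : b ⟶ b'} {p : a ⟶ b} {q : a' ⟶ b'} (θ : Sq f g p q) :
    Cyl ((vid p).vcomp θ) θ (λ_ f).hom (λ_ g).hom := by
  simp [Cyl, vcomp, vid]

theorem cyl_rightUnitor {f : a ⟶ a'} {g : b ⟶ b'} {p : a ⟶ b} {q : a' ⟶ b'} (θ : Sq f g p q) :
    Cyl (θ.vcomp (vid q)) θ (ρ_ f).hom (ρ_ g).hom := by
  simp [Cyl, vcomp, vid]

/-- The interchange law for the two ways of composing squares. It lets a compatibility for the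
action be split into an associativity half and a half coming from the given 1-cell. -/
theorem paste_vcomp_paste {f : a ⟶ a'} {f' : a' ⟶ a''} {g : b ⟶ b'} {g' : b' ⟶ b''}
    {c'' : B} {h : c ⟶ c'} {h' : c' ⟶ c''} {p : a ⟶ b} {q : a' ⟶ b'} {r : a'' ⟶ b''}
    {x : b ⟶ c} {y : b' ⟶ c'} {z : b'' ⟶ c''} (θ : Sq f g p q) (φ : Sq g h x y)
    (θ' : Sq f' g' q r) (φ' : Sq g' h' y z) :
    (θ.paste φ).vcomp (θ'.paste φ') = (θ.vcomp θ').paste (φ.vcomp φ') := by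
  ext
  calc _ = 𝟙 _ ⊗≫ f ◁ θ'.hom ▷ z ⊗≫ ((f ≫ q) ◁ φ'.hom ≫ θ.hom ▷ (y ≫ h')) ⊗≫
        p ◁ φ.hom ▷ h' ⊗≫ 𝟙 _ := by
        simp [vcomp, Sq.paste, bicategoricalComp]
    _ = _ := by
      rw [whisker_exchange]
      simp [vcomp, Sq.paste, bicategoricalComp]

theorem vid_paste {p : a ⟶ b} {q : b ⟶ c} : (vid p).paste (vid q) = vid (p ≫ q) := by
  ext
  simp [vid, Sq.paste]

theorem vcomp_cast {f : a ⟶ a'} {g : b ⟶ b'} {f' : a' ⟶ a''} {g' : b' ⟶ b''}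
    {p p' : a ⟶ b} {q q' : a' ⟶ b'} {r r' : a'' ⟶ b''} (θ : Sq f g p q) (φ : Sq f' g' q r)
    (κ : p ≅ p') (κ' : q ≅ q') (κ'' : r ≅ r') :
    (θ.cast κ κ').vcomp (φ.cast κ' κ'') = (θ.vcomp φ).cast κ κ'' := by
  ext
  simp [vcomp, Sq.cast]

theorem precomp_vcomp_left {f f' : a ⟶ a'} {g : b ⟶ b'} {h : a' ⟶ a''} {k : b' ⟶ b''}
    {p : a ⟶ b} {q : a' ⟶ b'} {r : a'' ⟶ b''} (κ : f' ≅ f) (θ : Sq f g p q) (φ : Sq h k q r) :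
    (θ.precomp κ).vcomp φ = (θ.vcomp φ).precomp (whiskerRightIso κ h) := by
  ext
  simp only [vcomp, Sq.precomp, Iso.trans_hom, whiskerLeftIso_hom, whiskerRightIso_hom,
    comp_whiskerRight, Iso.symm_hom, Category.assoc]
  rw [associator_naturality_left_assoc, ← whisker_exchange_assoc,
    associator_inv_naturality_left_assoc]

theorem precomp_vcomp_right {f : a ⟶ a'} {g : b ⟶ b'} {h h' : a' ⟶ a''} {k : b' ⟶ b''}
    {p : a ⟶ b} {q : a' ⟶ b'} {r : a'' ⟶ b''} (κ : h' ≅ h) (θ : Sq f g p q) (φ : Sq h k q r) :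
    θ.vcomp (φ.precomp κ) = (θ.vcomp φ).precomp (whiskerLeftIso f κ) := by
  ext
  simp [vcomp, Sq.precomp]

theorem precomp_precomp {f f' f'' : a ⟶ a'} {g : b ⟶ b'} {p : a ⟶ b} {q : a' ⟶ b'}
    (κ : f' ≅ f) (κ' : f'' ≅ f') (θ : Sq f g p q) :
    (θ.precomp κ).precomp κ' = θ.precomp (κ' ≪≫ κ) := by
  ext
  simp [Sq.precomp]

theorem precomp_refl {f : a ⟶ a'} {g : b ⟶ b'} {p : a ⟶ b} {q : a' ⟶ b'} (θ : Sq f g p q) :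
    θ.precomp (Iso.refl f) = θ := by
  ext
  simp [Sq.precomp]

end Cyl

end Sq
end MonBicat

/-! ### Squares under pseudofunctors and pseudonatural transformations. -/

namespace MonBicat

namespace Sq

section Pseudofunctor

variable {B : Type u} [Bicategory.{w, v} B] {C : Type u} [Bicategory.{w, v} C]
  {a a' a'' b b' b'' c c' : B}

theorem map₂_associator_inv (F : B ⥤ᵖ C) {a b c d : B} (f : a ⟶ b) (g : b ⟶ c) (h : c ⟶ d) :
    F.map₂ (α_ f g h).inv = (F.mapComp f (g ≫ h)).hom ≫ F.map f ◁ (F.mapComp g h).hom ≫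
      (α_ _ _ _).inv ≫ (F.mapComp f g).inv ▷ F.map h ≫ (F.mapComp (f ≫ g) h).inv := by
  rw [← cancel_mono (F.map₂ (α_ f g h).hom), ← F.map₂_comp, F.map₂_associator]
  simp

theorem map₂_leftUnitor_inv (F : B ⥤ᵖ C) {a b : B} (f : a ⟶ b) :
    F.map₂ (λ_ f).inv = (λ_ _).inv ≫ (F.mapId a).inv ▷ F.map f ≫ (F.mapComp (𝟙 a) f).inv := by
  rw [← cancel_mono (F.map₂ (λ_ f).hom), ← F.map₂_comp, F.map₂_left_unitor]
  simp

theorem map₂_rightUnitor_inv (F : B ⥤ᵖ C) {a b : B} (f : a ⟶ b) :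
    F.map₂ (ρ_ f).inv = (ρ_ _).inv ≫ F.map f ◁ (F.mapId b).inv ≫ (F.mapComp f (𝟙 b)).inv := by
  rw [← cancel_mono (F.map₂ (ρ_ f).hom), ← F.map₂_comp, F.map₂_right_unitor]
  simp

/-- The image of a square under a pseudofunctor. -/
def map (F : B ⥤ᵖ C) {f : a ⟶ a'} {g : b ⟶ b'} {p : a ⟶ b} {q : a' ⟶ b'} (θ : Sq f g p q) :
    Sq (F.map f) (F.map g) (F.map p) (F.map q) :=
  (F.mapComp f q).symm ≪≫ F.map₂Iso θ ≪≫ F.mapComp p g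

theorem map_hom (F : B ⥤ᵖ C) {f : a ⟶ a'} {g : b ⟶ b'} {p : a ⟶ b} {q : a' ⟶ b'}
    (θ : Sq f g p q) :
    (θ.map F).hom = (F.mapComp f q).inv ≫ F.map₂ θ.hom ≫ (F.mapComp p g).hom := rfl

theorem Cyl.map (F : B ⥤ᵖ C) {f f' : a ⟶ a'} {g g' : b ⟶ b'} {p : a ⟶ b} {q : a' ⟶ b'}
    {θ : Sq f g p q} {θ' : Sq f' g' p q} {l : f ⟶ f'} {r : g ⟶ g'} (h : Cyl θ θ' l r) :
    Cyl (θ.map F) (θ'.map F) (F.map₂ l) (F.map₂ r) := by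
  have h' := congrArg F.map₂ h
  simp only [F.map₂_comp, F.map₂_whisker_right, F.map₂_whisker_left] at h'
  unfold Cyl
  simp only [Sq.map, Iso.trans_hom, Iso.symm_hom, PrelaxFunctor.map₂Iso_hom, Category.assoc]
  rw [← cancel_mono (F.mapComp p g').inv]
  simp only [Category.assoc, Iso.hom_inv_id, Category.comp_id]
  rw [← cancel_epi (F.mapComp f q).hom]
  simpa using h'

theorem cyl_map_vcomp (F : B ⥤ᵖ C) {f : a ⟶ a'} {g : b ⟶ b'} {f' : a' ⟶ a''} {g' : b' ⟶ b''}
    {p : a ⟶ b} {q : a' ⟶ b'} {r : a'' ⟶ b''} (θ : Sq f g p q) (φ : Sq f' g' q r) :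
    Cyl ((θ.vcomp φ).map F) ((θ.map F).vcomp (φ.map F)) (F.mapComp f f').hom
      (F.mapComp g g').hom := by
  simp [Cyl, map_hom, vcomp, F.map₂_associator, map₂_associator_inv]

theorem cyl_map_vid (F : B ⥤ᵖ C) (p : a ⟶ b) :
    Cyl ((vid p).map F) (vid (F.map p)) (F.mapId a).hom (F.mapId b).hom := by
  simp [Cyl, map_hom, vid, F.map₂_left_unitor, map₂_rightUnitor_inv]

theorem map_paste (F : B ⥤ᵖ C) {f : a ⟶ a'} {g : b ⟶ b'} {h : c ⟶ c'} {p : a ⟶ b}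
    {q : a' ⟶ b'} {r : b ⟶ c} {s : b' ⟶ c'} (θ : Sq f g p q) (φ : Sq g h r s) :
    (θ.paste φ).map F = ((θ.map F).paste (φ.map F)).cast (F.mapComp p r).symm
      (F.mapComp q s).symm := by
  ext
  simp [map_hom, Sq.paste, Sq.cast, F.map₂_associator, map₂_associator_inv]

theorem map_idSq (F : B ⥤ᵖ C) (f : a ⟶ a') :
    (idSq f).map F = (idSq (F.map f)).cast (F.mapId a).symm (F.mapId a').symm := by
  ext
  simp [map_hom, Sq.idSq, Sq.cast, map₂_leftUnitor_inv]

theorem map_cast (F : B ⥤ᵖ C) {f : a ⟶ a'} {g : b ⟶ b'} {p p' : a ⟶ b} {q q' : a' ⟶ b'}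
    (θ : Sq f g p q) (κ : p ≅ p') (κ' : q ≅ q') :
    (θ.cast κ κ').map F = (θ.map F).cast (F.map₂Iso κ) (F.map₂Iso κ') := by
  ext
  simp [map_hom, Sq.cast]

theorem map_precomp (F : B ⥤ᵖ C) {f f' : a ⟶ a'} {g : b ⟶ b'} {p : a ⟶ b} {q : a' ⟶ b'}
    (θ : Sq f g p q) (κ : f' ≅ f) : (θ.precomp κ).map F = (θ.map F).precomp (F.map₂Iso κ) := by
  ext
  simp [map_hom, Sq.precomp]

variable {F G : B ⥤ᵖ C} (t : F ⟶ G)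

/-- The components of a pseudonatural transformation as vertical sides of its naturality square. -/
def nat (p : a ⟶ b) : Sq (t.app a) (t.app b) (F.map p) (G.map p) :=
  (t.naturality p).symm

/-- Naturality of `t` at the 2-cell filling the square, after the naturality 2-cells at its two
composite sides are split by `naturality_comp`. -/
theorem cyl_nat {f : a ⟶ a'} {g : b ⟶ b'} {p : a ⟶ b} {q : a' ⟶ b'} (θ : Sq f g p q) :
    Cyl ((θ.map F).vcomp (nat t q)) ((nat t p).vcomp (θ.map G)) (t.naturality f).hom
      (t.naturality g).hom := by
  have h := t.naturality_naturality θ.hom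
  have h₁ := t.naturality_comp f q
  have h₂ := t.naturality_comp p g
  have key : (t.naturality f).hom ▷ G.map q ≫ (α_ (t.app a) (G.map f) (G.map q)).hom =
      (α_ _ _ _).hom ≫ F.map f ◁ (t.naturality q).inv ≫ (α_ _ _ _).inv ≫
        (F.mapComp f q).inv ▷ t.app b' ≫ (t.naturality (f ≫ q)).hom ≫
          t.app a ◁ (G.mapComp f q).hom := by
    simp [h₁]
  have key' : t.app a ◁ (G.mapComp p g).hom ≫ (α_ (t.app a) (G.map p) (G.map g)).inv =
      (t.naturality (p ≫ g)).inv ≫ (F.mapComp p g).hom ▷ t.app b' ≫ (α_ _ _ _).hom ≫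
        F.map p ◁ (t.naturality g).hom ≫ (α_ _ _ _).inv ≫ (t.naturality p).hom ▷ G.map g := by
    rw [← cancel_epi (t.naturality (p ≫ g)).hom, reassoc_of% h₂]
    simp
  simp only [Cyl, map_hom, vcomp, nat, Iso.trans_hom, whiskerLeftIso_hom, whiskerRightIso_hom,
    Iso.symm_hom, whiskerLeft_comp, comp_whiskerRight, Category.assoc, reassoc_of% key,
    reassoc_of% key', whiskerLeft_hom_inv_assoc, ← reassoc_of% h, Iso.hom_inv_id_assoc,
    hom_inv_whiskerRight_assoc, Iso.inv_hom_id, Category.comp_id]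

end Pseudofunctor

end Sq
end MonBicat

/-! ### Tensoring 2-cells with an object on the right. -/

namespace MonBicat

section Whisker

variable {B : Type u} [Bicategory.{w, v} B] [MonoidalData B]

/-- Tensor product of 2-cells. -/
def tHom₂ {X X' Y Y' : B} {f f' : X ⟶ X'} {g g' : Y ⟶ Y'} (θ : f ⟶ f') (ψ : g ⟶ g') :
    f ⊠₁ g ⟶ f' ⊠₁ g' :=
  (MonoidalData.tensor (B := B)).map₂ (θ ×ₘ ψ)

infixr:83 " ⊠₂ " => tHom₂

/-- Tensoring on the right with an object, as a pseudofunctor. -/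
abbrev tensorRight (V : B) : B ⥤ᵖ B :=
  (Bicategory.Prod.sectL B V).toPseudofunctor.comp (MonoidalData.tensor (B := B))

variable {V : B} {X X' X'' X₃ Y Y' Y'' : B}

/-- Tensoring a 2-cell on the right with an object. -/
abbrev tRight₂ {f g : X ⟶ X'} (θ : f ⟶ g) (V : B) : f ⊠ᵣ V ⟶ g ⊠ᵣ V := θ ⊠₂ 𝟙 (𝟙 V)

theorem tIso_hom {f f' : X ⟶ X'} {g g' : Y ⟶ Y'} (θ : f ≅ f') (ψ : g ≅ g') :
    (tIso θ ψ).hom = θ.hom ⊠₂ ψ.hom := rfl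

theorem tIso_inv {f f' : X ⟶ X'} {g g' : Y ⟶ Y'} (θ : f ≅ f') (ψ : g ≅ g') :
    (tIso θ ψ).inv = θ.inv ⊠₂ ψ.inv := rfl

@[simp]
theorem tHom₂_id (f : X ⟶ X') (g : Y ⟶ Y') : 𝟙 f ⊠₂ 𝟙 g = 𝟙 (f ⊠₁ g) :=
  (MonoidalData.tensor (B := B)).map₂_id _

theorem tHom₂_comp {f f' f'' : X ⟶ X'} {g g' g'' : Y ⟶ Y'} (θ : f ⟶ f') (θ' : f' ⟶ f'')
    (ψ : g ⟶ g') (ψ' : g' ⟶ g'') : (θ ≫ θ') ⊠₂ (ψ ≫ ψ') = (θ ⊠₂ ψ) ≫ (θ' ⊠₂ ψ') :=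
  (MonoidalData.tensor (B := B)).map₂_comp (f := f ×ₘ g) (g := f' ×ₘ g') (h := f'' ×ₘ g'')
    (θ ×ₘ ψ) (θ' ×ₘ ψ')

theorem tRight₂_comp {f g h : X ⟶ X'} (θ : f ⟶ g) (ψ : g ⟶ h) (V : B) :
    tRight₂ (θ ≫ ψ) V = tRight₂ θ V ≫ tRight₂ ψ V :=
  (tensorRight V).map₂_comp θ ψ

theorem rIso_hom {f g : X ⟶ X'} (θ : f ≅ g) (V : B) : (rIso θ V).hom = tRight₂ θ.hom V := rfl

theorem tRight₂_whiskerLeft (f : X ⟶ X') {g h : X' ⟶ X''} (θ : g ⟶ h) (V : B) :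
    tRight₂ (f ◁ θ) V = (rComp f g V).hom ≫ (f ⊠ᵣ V) ◁ tRight₂ θ V ≫ (rComp f h V).inv :=
  (tensorRight V).map₂_whisker_left f θ

theorem tRight₂_whiskerRight {f g : X ⟶ X'} (θ : f ⟶ g) (h : X' ⟶ X'') (V : B) :
    tRight₂ (θ ▷ h) V = (rComp f h V).hom ≫ tRight₂ θ V ▷ (h ⊠ᵣ V) ≫ (rComp g h V).inv :=
  (tensorRight V).map₂_whisker_right θ h

theorem tRight₂_associator (f : X ⟶ X') (g : X' ⟶ X'') (h : X'' ⟶ X₃) (V : B) :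
    tRight₂ (α_ f g h).hom V = (rComp (f ≫ g) h V).hom ≫ (rComp f g V).hom ▷ (h ⊠ᵣ V) ≫
      (α_ _ _ _).hom ≫ (f ⊠ᵣ V) ◁ (rComp g h V).inv ≫ (rComp f (g ≫ h) V).inv :=
  (tensorRight V).map₂_associator f g h

theorem tensorRight_mapId (X V : B) : ((tensorRight V).mapId X).hom = (tId X V).hom := by
  have : (𝟙 (𝟙 X) ⊠₂ 𝟙 (𝟙 V)) ≫ (tId X V).hom = (tId X V).hom := by simp
  exact this

theorem tRight₂_leftUnitor (f : X ⟶ X') (V : B) :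
    tRight₂ (λ_ f).hom V = (rComp (𝟙 X) f V).hom ≫ (tId X V).hom ▷ (f ⊠ᵣ V) ≫ (λ_ _).hom :=
  ((tensorRight V).map₂_left_unitor f).trans
    (congrArg (fun t => (rComp (𝟙 X) f V).hom ≫ t ▷ (f ⊠ᵣ V) ≫ (λ_ _).hom)
      (tensorRight_mapId X V))

theorem tRight₂_rightUnitor (f : X ⟶ X') (V : B) :
    tRight₂ (ρ_ f).hom V = (rComp f (𝟙 X') V).hom ≫ (f ⊠ᵣ V) ◁ (tId X' V).hom ≫ (ρ_ _).hom :=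
  ((tensorRight V).map₂_right_unitor f).trans
    (congrArg (fun t => (rComp f (𝟙 X') V).hom ≫ (f ⊠ᵣ V) ◁ t ≫ (ρ_ _).hom)
      (tensorRight_mapId X' V))

end Whisker
end MonBicat

/-! ### The bicategory of 1-cells `M ⊗ V ⟶ M'`. -/

namespace MonBicat

/-- A 1-cell `M ⊗ V ⟶ M'`. These are the objects of a bicategory on which `B` acts. -/
structure VArr {B : Type u} [Bicategory.{w, v} B] [MonoidalData B] (V : B) where
  /-- The object `M`. -/
  src : B
  /-- The object `M'`. -/
  tgt : B
  /-- The 1-cell. -/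
  hom : src ⊠ V ⟶ tgt

namespace VArr

variable {B : Type u} [Bicategory.{w, v} B] [MonoidalData B] {V : B}

/-- A 1-cell of `VArr V`: a square. -/
structure Hom (M N : VArr V) where
  /-- The 1-cell between the sources. -/
  fst : M.src ⟶ N.src
  /-- The 1-cell between the targets. -/
  snd : M.tgt ⟶ N.tgt
  /-- The square. -/
  sq : Sq (fst ⊠ᵣ V) snd M.hom N.hom

/-- A 2-cell of `VArr V`: a compatible pair of 2-cells. -/
@[ext]
structure Hom₂ {M N : VArr V} (F G : Hom M N) where
  /-- The 2-cell between the sources. -/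
  l : F.fst ⟶ G.fst
  /-- The 2-cell between the targets. -/
  r : F.snd ⟶ G.snd
  /-- The compatibility. -/
  comm : Sq.Cyl F.sq G.sq (tRight₂ l V) r

instance : CategoryStruct (VArr V) where
  Hom := Hom
  id M := ⟨𝟙 _, 𝟙 _, (Sq.vid M.hom).precomp (tId M.src V)⟩
  comp F G := ⟨F.fst ≫ G.fst, F.snd ≫ G.snd, (F.sq.vcomp G.sq).precomp (rComp F.fst G.fst V)⟩

instance (M N : VArr V) : Category (M ⟶ N) where
  Hom F G := Hom₂ F G
  id F := ⟨𝟙 _, 𝟙 _, by simpa using Sq.Cyl.refl F.sq⟩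
  comp η θ := ⟨η.l ≫ θ.l, η.r ≫ θ.r, by rw [tRight₂_comp]; exact η.comm.trans θ.comm⟩
  id_comp _ := Hom₂.ext (Category.id_comp _) (Category.id_comp _)
  comp_id _ := Hom₂.ext (Category.comp_id _) (Category.comp_id _)
  assoc _ _ _ := Hom₂.ext (Category.assoc _ _ _) (Category.assoc _ _ _)

section

variable {M N P : VArr V}

@[simp] theorem id_fst (M : VArr V) : (𝟙 M : M ⟶ M).fst = 𝟙 M.src := rfl
@[simp] theorem id_snd (M : VArr V) : (𝟙 M : M ⟶ M).snd = 𝟙 M.tgt := rfl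
@[simp] theorem comp_fst (F : M ⟶ N) (G : N ⟶ P) : (F ≫ G).fst = F.fst ≫ G.fst := rfl
theorem id_sq (M : VArr V) : (𝟙 M : M ⟶ M).sq = (Sq.vid M.hom).precomp (tId M.src V) := rfl
theorem comp_sq (F : M ⟶ N) (G : N ⟶ P) :
    (F ≫ G).sq = (F.sq.vcomp G.sq).precomp (rComp F.fst G.fst V) := rfl
@[simp] theorem comp_snd (F : M ⟶ N) (G : N ⟶ P) : (F ≫ G).snd = F.snd ≫ G.snd := rfl
@[simp] theorem id_l (F : M ⟶ N) : Hom₂.l (𝟙 F) = 𝟙 F.fst := rfl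
@[simp] theorem id_r (F : M ⟶ N) : Hom₂.r (𝟙 F) = 𝟙 F.snd := rfl
@[simp] theorem comp_l {F G H : M ⟶ N} (η : F ⟶ G) (θ : G ⟶ H) :
    Hom₂.l (η ≫ θ) = η.l ≫ θ.l := rfl
@[simp] theorem comp_r {F G H : M ⟶ N} (η : F ⟶ G) (θ : G ⟶ H) :
    Hom₂.r (η ≫ θ) = η.r ≫ θ.r := rfl

@[ext]
theorem hom₂_ext {F G : M ⟶ N} {η θ : F ⟶ G} (hl : η.l = θ.l) (hr : η.r = θ.r) : η = θ :=
  Hom₂.ext hl hr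

/-- An invertible 2-cell of `VArr V`. -/
@[simps]
def isoMk {F G : M ⟶ N} (l : F.fst ≅ G.fst) (r : F.snd ≅ G.snd)
    (comm : Sq.Cyl F.sq G.sq (rIso l V).hom r.hom) : F ≅ G where
  hom := ⟨l.hom, r.hom, comm⟩
  inv := ⟨l.inv, r.inv, comm.inv⟩
  hom_inv_id := by ext <;> simp
  inv_hom_id := by ext <;> simp

end

section

variable {M N P Q : VArr V}

/-- Whiskering on the left in `VArr V`. -/
@[simps]
def wLeft (F : M ⟶ N) {G H : N ⟶ P} (η : G ⟶ H) : Hom₂ (F ≫ G) (F ≫ H) :=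
  ⟨F.fst ◁ η.l, F.snd ◁ η.r, by
    apply Sq.Cyl.precomp
    rw [tRight₂_whiskerLeft]
    simpa using η.comm.whiskerLeft F.sq⟩

/-- Whiskering on the right in `VArr V`. -/
@[simps]
def wRight {F G : M ⟶ N} (η : F ⟶ G) (H : N ⟶ P) : Hom₂ (F ≫ H) (G ≫ H) :=
  ⟨η.l ▷ H.fst, η.r ▷ H.snd, by
    apply Sq.Cyl.precomp
    rw [tRight₂_whiskerRight]
    simpa using η.comm.whiskerRight H.sq⟩

/-- The associator of `VArr V`. -/
@[simps!]
def associator (F : M ⟶ N) (G : N ⟶ P) (H : P ⟶ Q) : (F ≫ G) ≫ H ≅ F ≫ G ≫ H :=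
  isoMk (α_ _ _ _) (α_ _ _ _) (by
    rw [comp_sq, comp_sq, comp_sq, comp_sq]
    rw [Sq.precomp_vcomp_left, Sq.precomp_vcomp_right, Sq.precomp_precomp, Sq.precomp_precomp]
    apply Sq.Cyl.precomp
    exact (Sq.cyl_associator F.sq G.sq H.sq).congr (by rw [rIso_hom, tRight₂_associator]; simp) rfl)

/-- The left unitor of `VArr V`. -/
@[simps!]
def leftUnitor (F : M ⟶ N) : 𝟙 M ≫ F ≅ F :=
  isoMk (λ_ _) (λ_ _) (by
    rw [← Sq.precomp_refl F.sq]
    rw [comp_sq, id_sq]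
    rw [Sq.precomp_vcomp_left, Sq.precomp_precomp]
    apply Sq.Cyl.precomp
    exact (Sq.cyl_leftUnitor F.sq).congr (by rw [rIso_hom, tRight₂_leftUnitor]; simp) rfl)

/-- The right unitor of `VArr V`. -/
@[simps!]
def rightUnitor (F : M ⟶ N) : F ≫ 𝟙 N ≅ F :=
  isoMk (ρ_ _) (ρ_ _) (by
    rw [← Sq.precomp_refl F.sq]
    rw [comp_sq, id_sq]
    rw [Sq.precomp_vcomp_right, Sq.precomp_precomp]
    apply Sq.Cyl.precomp
    exact (Sq.cyl_rightUnitor F.sq).congr (by rw [rIso_hom, tRight₂_rightUnitor]; simp) rfl)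

end

/-- A 2-cell is determined by its two components, so every axiom is the corresponding axiom of `B`,
taken twice. -/
instance : Bicategory (VArr V) where
  whiskerLeft F _ _ η := wLeft F η
  whiskerRight η H := wRight η H
  associator F G H := associator F G H
  leftUnitor F := leftUnitor F
  rightUnitor F := rightUnitor F
  whiskerLeft_id _ _ := by ext <;> simp
  whiskerLeft_comp _ _ _ _ _ _ := by ext <;> simp
  id_whiskerLeft _ := by ext <;> simp
  comp_whiskerLeft _ _ _ _ _ := by ext <;> simp
  id_whiskerRight _ _ := by ext <;> simp
  comp_whiskerRight _ _ _ := by ext <;> simp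
  whiskerRight_id _ := by ext <;> simp
  whiskerRight_comp _ _ _ := by ext <;> simp
  whisker_assoc _ _ _ _ _ := by ext <;> simp
  whisker_exchange _ _ := by ext <;> simp [whisker_exchange]
  pentagon _ _ _ _ := by ext <;> simp
  triangle _ _ := by ext <;> simp

end VArr
end MonBicat

/-! ### Commutative cubes and tensor products of squares. -/

namespace MonBicat

namespace Sq

section Calculus

variable {B : Type u} [Bicategory.{w, v} B] {a a' a'' b b' b'' c c' d d' : B}

/-- Changing the right vertical side of a square. -/
def postcomp {f : a ⟶ a'} {g g' : b ⟶ b'} {p : a ⟶ b} {q : a' ⟶ b'} (θ : Sq f g p q)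
    (κ : g ≅ g') : Sq f g' p q :=
  θ ≪≫ whiskerLeftIso p κ

theorem postcomp_paste_precomp {f : a ⟶ a'} {g g' : b ⟶ b'} {h : c ⟶ c'} {p : a ⟶ b} {q : a' ⟶ b'}
    {r : b ⟶ c} {s : b' ⟶ c'} (θ : Sq f g p q) (κ : g ≅ g') (φ : Sq g' h r s) :
    (θ.postcomp κ).paste φ = θ.paste (φ.precomp κ) := by
  ext
  simp [Sq.paste, postcomp, precomp]

theorem paste_cast_paste {f : a ⟶ a'} {g : b ⟶ b'} {h : c ⟶ c'} {k : d ⟶ d'} {p : a ⟶ b}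
    {q : a' ⟶ b'} {r : b ⟶ c} {s : b' ⟶ c'} {x : c ⟶ d} {y : c' ⟶ d'} {z : b ⟶ d} {z' : b' ⟶ d'}
    (θ : Sq f g p q) (φ : Sq g h r s) (χ : Sq h k x y) (κ : r ≫ x ≅ z) (κ' : s ≫ y ≅ z') :
    θ.paste ((φ.paste χ).cast κ κ') =
      ((θ.paste φ).paste χ).cast (α_ p r x ≪≫ whiskerLeftIso p κ)
        (α_ q s y ≪≫ whiskerLeftIso q κ') := by
  ext
  have : (α_ f q z').inv ≫ θ.hom ▷ z' ≫ (α_ p g z').hom ≫ p ◁ g ◁ κ'.inv =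
      f ◁ q ◁ κ'.inv ≫ (α_ f q (s ≫ y)).inv ≫ θ.hom ▷ (s ≫ y) ≫ (α_ p g (s ≫ y)).hom := by
    rw [associator_inv_naturality_right_assoc, whisker_exchange_assoc, associator_naturality_right]
  simp [Sq.paste, Sq.cast, reassoc_of% this]

theorem cast_cast {f : a ⟶ a'} {g : b ⟶ b'} {p p' p'' : a ⟶ b} {q q' q'' : a' ⟶ b'}
    (θ : Sq f g p q) (κ : p ≅ p') (κ' : q ≅ q') (l : p' ≅ p'') (l' : q' ≅ q'') :
    (θ.cast κ κ').cast l l' = θ.cast (κ ≪≫ l) (κ' ≪≫ l') := by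
  ext
  simp [Sq.cast]

theorem cast_refl {f : a ⟶ a'} {g : b ⟶ b'} {p : a ⟶ b} {q : a' ⟶ b'}
    (θ : Sq f g p q) : θ.cast (Iso.refl p) (Iso.refl q) = θ := by
  ext
  simp [Sq.cast]

theorem idSq_paste_idSq (f : a ⟶ a') :
    (idSq f).paste (idSq f) = (idSq f).cast (λ_ _).symm (λ_ _).symm := by
  ext
  simp [idSq, Sq.paste, Sq.cast, -unitors_inv_equal]

theorem idSq_vcomp_idSq (f : a ⟶ a') (g : a' ⟶ a'') :
    (idSq f).vcomp (idSq g) = idSq (f ≫ g) := by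
  ext
  simp [idSq, vcomp]

theorem vid_eq_idSq (a : B) : vid (𝟙 a) = idSq (𝟙 a) := by
  ext
  simp [idSq, vid, unitors_equal, unitors_inv_equal]

/-- A commutative cube, with one pair of opposite faces read as 2-cells between vertical sides. -/
theorem Cyl.of_cube {X : a ⟶ a'} {Y : b ⟶ b'} {Y' : d ⟶ d'} {Z : c ⟶ c'} {x : a ⟶ b} {x' : a' ⟶ b'}
    {y : b ⟶ c} {y' : b' ⟶ c'} {z : a ⟶ d} {z' : a' ⟶ d'} {t : d ⟶ c} {t' : d' ⟶ c'}
    {L : Sq X Y x x'} {R : Sq Y Z y y'} {S : Sq X Y' z z'} {T : Sq Y' Z t t'}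
    {e : Sq x t z y} {e' : Sq x' t' z' y'}
    (h : X ◁ e'.hom ≫ (S.paste T).hom = (L.paste R).hom ≫ e.hom ▷ Z) :
    Cyl (S.vcomp e') (e.vcomp R) L.hom T.hom := by
  simp only [Sq.paste, Iso.trans_hom, Iso.symm_hom, whiskerRightIso_hom, whiskerLeftIso_hom,
    Category.assoc] at h
  have h' := congrArg (fun t => (α_ _ _ _).hom ≫ t ≫ (α_ _ _ _).hom) h
  simp only [Category.assoc, Iso.inv_hom_id, Category.comp_id, Iso.hom_inv_id_assoc] at h'
  simp only [Cyl, vcomp, Iso.trans_hom, Iso.symm_hom, whiskerRightIso_hom, whiskerLeftIso_hom,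
    Category.assoc]
  rw [h']

end Calculus

section Tensor

variable {B : Type u} [Bicategory.{w, v} B] [MonoidalData B] {a a' a'' b b' b'' c c' d d' c'' d'' : B}

theorem Cyl.tSq {f f' : a ⟶ a'} {g g' : b ⟶ b'} {p : a ⟶ b} {q : a' ⟶ b'}
    {h h' : c ⟶ c'} {k k' : d ⟶ d'} {r : c ⟶ d} {s : c' ⟶ d'}
    {θ : Sq f g p q} {θ' : Sq f' g' p q} {ψ : Sq h k r s} {ψ' : Sq h' k' r s}
    {x : f ⟶ f'} {y : g ⟶ g'} {z : h ⟶ h'} {t : k ⟶ k'} (h₁ : Cyl θ θ' x y) (h₂ : Cyl ψ ψ' z t) :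
    Cyl (tSq θ ψ) (tSq θ' ψ') (x ⊠₂ z) (y ⊠₂ t) :=
  Cyl.map (B := B × B) (a := (a, c)) (a' := (a', c')) (b := (b, d)) (b' := (b', d'))
    (f := f ×ₘ h) (f' := f' ×ₘ h') (g := g ×ₘ k) (g' := g' ×ₘ k') (p := p ×ₘ r) (q := q ×ₘ s)
    (θ := Iso.prod θ ψ) (θ' := Iso.prod θ' ψ') (l := x ×ₘ z) (r := y ×ₘ t)
    (MonoidalData.tensor (B := B)) (Prod.ext h₁ h₂)

theorem cyl_tSq_vcomp {f : a ⟶ a'} {g : b ⟶ b'} {f' : a' ⟶ a''} {g' : b' ⟶ b''}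
    {p : a ⟶ b} {q : a' ⟶ b'} {r : a'' ⟶ b''} (θ : Sq f g p q) (φ : Sq f' g' q r)
    {h : c ⟶ c'} {k : d ⟶ d'} {h' : c' ⟶ c''} {k' : d' ⟶ d''}
    {x : c ⟶ d} {y : c' ⟶ d'} {z : c'' ⟶ d''} (ψ : Sq h k x y) (χ : Sq h' k' y z) :
    Cyl (tSq (θ.vcomp φ) (ψ.vcomp χ)) ((tSq θ ψ).vcomp (tSq φ χ)) (tComp f f' h h').hom
      (tComp g g' k k').hom :=
  cyl_map_vcomp (B := B × B) (a := (a, c)) (a' := (a', c')) (b := (b, d)) (b' := (b', d'))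
    (a'' := (a'', c'')) (b'' := (b'', d''))
    (f := f ×ₘ h) (f' := f' ×ₘ h') (g := g ×ₘ k) (g' := g' ×ₘ k') (p := p ×ₘ x) (q := q ×ₘ y)
    (r := r ×ₘ z) (MonoidalData.tensor (B := B)) (Iso.prod θ ψ) (Iso.prod φ χ)

theorem cyl_tSq_vid (p : a ⟶ b) (q : c ⟶ d) :
    Cyl (tSq (vid p) (vid q)) (vid (p ⊠₁ q)) (tId a c).hom (tId b d).hom :=
  cyl_map_vid (B := B × B) (a := (a, c)) (b := (b, d)) (MonoidalData.tensor (B := B)) (p ×ₘ q)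

theorem tSq_paste {a₁ b₁ c₁ a₂ b₂ c₂ a₁' b₁' c₁' a₂' b₂' c₂' : B}
    {f : a₁ ⟶ a₁'} {g : b₁ ⟶ b₁'} {h : c₁ ⟶ c₁'} {p : a₁ ⟶ b₁}
    {q : a₁' ⟶ b₁'} {r : b₁ ⟶ c₁} {s : b₁' ⟶ c₁'} (θ : Sq f g p q) (φ : Sq g h r s)
    {f' : a₂ ⟶ a₂'} {g' : b₂ ⟶ b₂'} {h' : c₂ ⟶ c₂'} {p' : a₂ ⟶ b₂}
    {q' : a₂' ⟶ b₂'} {r' : b₂ ⟶ c₂} {s' : b₂' ⟶ c₂'} (θ' : Sq f' g' p' q') (φ' : Sq g' h' r' s') :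
    tSq (θ.paste φ) (θ'.paste φ') = ((tSq θ θ').paste (tSq φ φ')).cast (tComp p r p' r').symm
      (tComp q s q' s').symm :=
  map_paste (B := B × B) (a := (a₁, a₂)) (b := (b₁, b₂)) (c := (c₁, c₂)) (a' := (a₁', a₂'))
    (b' := (b₁', b₂')) (c' := (c₁', c₂')) (f := f ×ₘ f') (g := g ×ₘ g') (h := h ×ₘ h')
    (p := p ×ₘ p') (q := q ×ₘ q') (r := r ×ₘ r') (s := s ×ₘ s')
    (MonoidalData.tensor (B := B)) (Iso.prod θ θ') (Iso.prod φ φ')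

theorem tSq_idSq_idSq (f : a ⟶ a') (g : c ⟶ c') :
    tSq (idSq f) (idSq g) = (idSq (f ⊠₁ g)).cast (tId a c).symm (tId a' c').symm :=
  map_idSq (B := B × B) (a := (a, c)) (a' := (a', c')) (MonoidalData.tensor (B := B)) (f ×ₘ g)

theorem tSq_cast {f : a ⟶ a'} {g : b ⟶ b'} {p p' : a ⟶ b} {q q' : a' ⟶ b'}
    {h : c ⟶ c'} {k : d ⟶ d'} {r r' : c ⟶ d} {s s' : c' ⟶ d'}
    (θ : Sq f g p q) (ψ : Sq h k r s) (κ : p ≅ p') (κ' : q ≅ q') (l : r ≅ r') (l' : s ≅ s') :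
    tSq (θ.cast κ κ') (ψ.cast l l') = (tSq θ ψ).cast (tIso κ l) (tIso κ' l') :=
  map_cast (B := B × B) (a := (a, c)) (a' := (a', c')) (b := (b, d)) (b' := (b', d'))
    (f := f ×ₘ h) (g := g ×ₘ k) (p := p ×ₘ r) (q := q ×ₘ s) (p' := p' ×ₘ r') (q' := q' ×ₘ s')
    (MonoidalData.tensor (B := B)) (Iso.prod θ ψ) (Iso.prod κ l) (Iso.prod κ' l')

theorem tSq_precomp {f f' : a ⟶ a'} {g : b ⟶ b'} {p : a ⟶ b} {q : a' ⟶ b'}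
    {h h' : c ⟶ c'} {k : d ⟶ d'} {r : c ⟶ d} {s : c' ⟶ d'}
    (θ : Sq f g p q) (ψ : Sq h k r s) (κ : f' ≅ f) (l : h' ≅ h) :
    tSq (θ.precomp κ) (ψ.precomp l) = (tSq θ ψ).precomp (tIso κ l) :=
  map_precomp (B := B × B) (a := (a, c)) (a' := (a', c')) (b := (b, d)) (b' := (b', d'))
    (f := f ×ₘ h) (g := g ×ₘ k) (p := p ×ₘ r) (q := q ×ₘ s) (f' := f' ×ₘ h')
    (MonoidalData.tensor (B := B)) (Iso.prod θ ψ) (Iso.prod κ l)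

theorem tSq_idSq_paste {X X' : B} (k : X ⟶ X') {f : a ⟶ a'} {g : b ⟶ b'} {h : c ⟶ c'} {p : a ⟶ b}
    {q : a' ⟶ b'} {r : b ⟶ c} {s : b' ⟶ c'} (θ : Sq f g p q) (φ : Sq g h r s) :
    tSq (idSq k) (θ.paste φ) = ((tSq (idSq k) θ).paste (tSq (idSq k) φ)).cast
      (lComp X p r).symm (lComp X' q s).symm := by
  -- Doubling the canonical square makes it match the paste of `θ` and `φ`, so that the tensor
  -- product of pastes applies.
  have e : idSq k = ((idSq k).paste (idSq k)).cast (λ_ _) (λ_ _) := by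
    rw [idSq_paste_idSq, cast_cast]
    simp [cast_refl]
  conv_lhs => rw [e, ← cast_refl (θ.paste φ), tSq_cast, tSq_paste, cast_cast]
  rfl

end Tensor

end Sq

end MonBicat

/-! ### Pseudonaturality of associativity with respect to squares. -/

namespace MonBicat

section AssNat

open Sq

variable {B : Type u} [Bicategory.{w, v} B] [MonoidalData B]
  {X X' X'' Y Y' Y'' Z Z' Z'' : B}

theorem cyl_assNat {f f' : X ⟶ X'} {g g' : Y ⟶ Y'} {h h' : Z ⟶ Z'} (x : f ⟶ f') (y : g ⟶ g')
    (z : h ⟶ h') : Cyl (assNat f g h) (assNat f' g' h') ((x ⊠₂ y) ⊠₂ z) (x ⊠₂ y ⊠₂ z) :=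
  (MonoidalData.assoc (B := B)).hom.naturality_naturality (a := ((X, Y), Z)) (b := ((X', Y'), Z'))
    (f := (f ×ₘ g) ×ₘ h) (g := (f' ×ₘ g') ×ₘ h') ((x ×ₘ y) ×ₘ z)

/-- The constraint of the composite pseudofunctor begins with the image of the identity constraint
of `prodAssoc`; this removes that factor. -/
theorem tripleR_mapComp (f : X ⟶ X') (f' : X' ⟶ X'') (g : Y ⟶ Y') (g' : Y' ⟶ Y'')
    (h : Z ⟶ Z') (h' : Z' ⟶ Z'') :
    ((tripleR (MonoidalData.tensor (B := B))).mapComp (a := ((X, Y), Z)) (b := ((X', Y'), Z'))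
      (c := ((X'', Y''), Z'')) ((f ×ₘ g) ×ₘ h) ((f' ×ₘ g') ×ₘ h')).hom =
      (𝟙 (f ≫ f') ⊠₂ (tComp g g' h h').hom) ≫ (tComp f f' (g ⊠₁ h) (g' ⊠₁ h')).hom :=
  (congrArg (fun t => t ≫ (𝟙 (f ≫ f') ⊠₂ (tComp g g' h h').hom) ≫ (tComp f f' _ _).hom)
    (((prodMap (Pseudofunctor.id B) (MonoidalData.tensor (B := B))).comp
      (MonoidalData.tensor (B := B))).map₂_id (a := (X, (Y, Z))) (b := (X'', (Y'', Z'')))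
      ((f ≫ f') ×ₘ ((g ≫ g') ×ₘ (h ≫ h'))))).trans (Category.id_comp _)

theorem tripleR_mapId (X Y Z : B) :
    ((tripleR (MonoidalData.tensor (B := B))).mapId ((X, Y), Z)).hom =
      (𝟙 (𝟙 X) ⊠₂ (tId Y Z).hom) ≫ (tId X (Y ⊠ Z)).hom :=
  (congrArg (fun t => t ≫ (𝟙 (𝟙 X) ⊠₂ (tId Y Z).hom) ≫ (tId X (Y ⊠ Z)).hom)
    (((prodMap (Pseudofunctor.id B) (MonoidalData.tensor (B := B))).comp
      (MonoidalData.tensor (B := B))).map₂_id (a := (X, (Y, Z))) (b := (X, (Y, Z)))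
      (𝟙 X ×ₘ (𝟙 Y ×ₘ 𝟙 Z)))).trans (Category.id_comp _)

theorem cyl_assNat_comp (f : X ⟶ X') (f' : X' ⟶ X'') (g : Y ⟶ Y') (g' : Y' ⟶ Y'')
    (h : Z ⟶ Z') (h' : Z' ⟶ Z'') :
    Cyl (assNat (f ≫ f') (g ≫ g') (h ≫ h')) ((assNat f g h).vcomp (assNat f' g' h'))
      (((tComp f f' g g').hom ⊠₂ 𝟙 (h ≫ h')) ≫ (tComp _ _ h h').hom)
      ((𝟙 (f ≫ f') ⊠₂ (tComp g g' h h').hom) ≫ (tComp f f' _ _).hom) :=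
  (((MonoidalData.assoc (B := B)).hom.naturality_comp (a := ((X, Y), Z)) (b := ((X', Y'), Z'))
    (c := ((X'', Y''), Z'')) ((f ×ₘ g) ×ₘ h) ((f' ×ₘ g') ×ₘ h')).symm).trans
    (congrArg (fun t => (assNat (f ≫ f') (g ≫ g') (h ≫ h')).hom ≫ ass X Y Z ◁ t)
      (tripleR_mapComp f f' g g' h h'))

theorem cyl_assNat_id (X Y Z : B) :
    Cyl (assNat (𝟙 X) (𝟙 Y) (𝟙 Z)) (vid (ass X Y Z))
      (((tId X Y).hom ⊠₂ 𝟙 (𝟙 Z)) ≫ (tId (X ⊠ Y) Z).hom)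
      ((𝟙 (𝟙 X) ⊠₂ (tId Y Z).hom) ≫ (tId X (Y ⊠ Z)).hom) :=
  ((MonoidalData.assoc (B := B)).hom.naturality_id ((X, Y), Z)).symm.trans
    (congrArg (fun t => (assNat (𝟙 X) (𝟙 Y) (𝟙 Z)).hom ≫ ass X Y Z ◁ t) (tripleR_mapId X Y Z))

theorem tripleL_map {x x' : B} {f : X ⟶ X'} {g : Y ⟶ Y'} {p : X ⟶ Y} {q : X' ⟶ Y'}
    (θ : Sq f g p q) {f₁ : Z ⟶ Z'} {g₁ : x ⟶ x'} {p₁ : Z ⟶ x} {q₁ : Z' ⟶ x'}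
    (θ₁ : Sq f₁ g₁ p₁ q₁) {X₂ X₂' Y₂ Y₂' : B} {f₂ : X₂ ⟶ X₂'} {g₂ : Y₂ ⟶ Y₂'} {p₂ : X₂ ⟶ Y₂}
    {q₂ : X₂' ⟶ Y₂'} (θ₂ : Sq f₂ g₂ p₂ q₂) :
    Sq.map (a := ((X, Z), X₂)) (a' := ((X', Z'), X₂')) (b := ((Y, x), Y₂))
      (b' := ((Y', x'), Y₂')) (f := (f ×ₘ f₁) ×ₘ f₂) (g := (g ×ₘ g₁) ×ₘ g₂)
      (p := (p ×ₘ p₁) ×ₘ p₂) (q := (q ×ₘ q₁) ×ₘ q₂) (tripleL (MonoidalData.tensor (B := B)))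
      (Iso.prod (Iso.prod θ θ₁) θ₂) = tSq (tSq θ θ₁) θ₂ := by
  ext
  change ((tComp _ _ _ _).inv ≫ ((tComp f q f₁ q₁).inv ⊠₂ 𝟙 _)) ≫
    ((θ.hom ⊠₂ θ₁.hom) ⊠₂ θ₂.hom) ≫ ((tComp p g p₁ g₁).hom ⊠₂ 𝟙 _) ≫ (tComp _ _ _ _).hom =
    (tComp _ _ _ _).inv ≫ (((tComp f q f₁ q₁).inv ≫ (θ.hom ⊠₂ θ₁.hom) ≫ (tComp p g p₁ g₁).hom) ⊠₂
      θ₂.hom) ≫ (tComp _ _ _ _).hom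
  rw [Category.assoc, ← reassoc_of% tHom₂_comp, ← reassoc_of% tHom₂_comp]
  simp

theorem tripleR_map {x x' : B} {f : X ⟶ X'} {g : Y ⟶ Y'} {p : X ⟶ Y} {q : X' ⟶ Y'}
    (θ : Sq f g p q) {f₁ : Z ⟶ Z'} {g₁ : x ⟶ x'} {p₁ : Z ⟶ x} {q₁ : Z' ⟶ x'}
    (θ₁ : Sq f₁ g₁ p₁ q₁) {X₂ X₂' Y₂ Y₂' : B} {f₂ : X₂ ⟶ X₂'} {g₂ : Y₂ ⟶ Y₂'} {p₂ : X₂ ⟶ Y₂}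
    {q₂ : X₂' ⟶ Y₂'} (θ₂ : Sq f₂ g₂ p₂ q₂) :
    Sq.map (a := ((X, Z), X₂)) (a' := ((X', Z'), X₂')) (b := ((Y, x), Y₂))
      (b' := ((Y', x'), Y₂')) (f := (f ×ₘ f₁) ×ₘ f₂) (g := (g ×ₘ g₁) ×ₘ g₂)
      (p := (p ×ₘ p₁) ×ₘ p₂) (q := (q ×ₘ q₁) ×ₘ q₂) (tripleR (MonoidalData.tensor (B := B)))
      (Iso.prod (Iso.prod θ θ₁) θ₂) = tSq θ (tSq θ₁ θ₂) := by
  have e₁ : (tripleR (MonoidalData.tensor (B := B))).mapComp (a := ((X, Z), X₂))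
      (b := ((X', Z'), X₂')) (c := ((Y', x'), Y₂')) ((f ×ₘ f₁) ×ₘ f₂) ((q ×ₘ q₁) ×ₘ q₂) =
      tIso (Iso.refl _) (tComp f₁ q₁ f₂ q₂) ≪≫ tComp _ _ _ _ :=
    Iso.ext (tripleR_mapComp f q f₁ q₁ f₂ q₂)
  have e₂ : (tripleR (MonoidalData.tensor (B := B))).mapComp (a := ((X, Z), X₂))
      (b := ((Y, x), Y₂)) (c := ((Y', x'), Y₂')) ((p ×ₘ p₁) ×ₘ p₂) ((g ×ₘ g₁) ×ₘ g₂) =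
      tIso (Iso.refl _) (tComp p₁ g₁ p₂ g₂) ≪≫ tComp _ _ _ _ :=
    Iso.ext (tripleR_mapComp p g p₁ g₁ p₂ g₂)
  rw [Sq.map, e₁, e₂]
  ext
  change ((tComp _ _ _ _).inv ≫ (𝟙 _ ⊠₂ (tComp f₁ q₁ f₂ q₂).inv)) ≫
    (θ.hom ⊠₂ θ₁.hom ⊠₂ θ₂.hom) ≫ (𝟙 _ ⊠₂ (tComp p₁ g₁ p₂ g₂).hom) ≫ (tComp _ _ _ _).hom =
    (tComp _ _ _ _).inv ≫ (θ.hom ⊠₂ ((tComp f₁ q₁ f₂ q₂).inv ≫ (θ₁.hom ⊠₂ θ₂.hom) ≫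
      (tComp p₁ g₁ p₂ g₂).hom)) ≫ (tComp _ _ _ _).hom
  rw [Category.assoc, ← reassoc_of% tHom₂_comp, ← reassoc_of% tHom₂_comp]
  simp

/-- Naturality of the associativity constraint with respect to squares. -/
theorem cyl_assNat_tSq {x x' : B} {f : X ⟶ X'} {g : Y ⟶ Y'} {p : X ⟶ Y} {q : X' ⟶ Y'}
    (θ : Sq f g p q) {f₁ : Z ⟶ Z'} {g₁ : x ⟶ x'} {p₁ : Z ⟶ x} {q₁ : Z' ⟶ x'}
    (θ₁ : Sq f₁ g₁ p₁ q₁) {X₂ X₂' Y₂ Y₂' : B} {f₂ : X₂ ⟶ X₂'} {g₂ : Y₂ ⟶ Y₂'} {p₂ : X₂ ⟶ Y₂}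
    {q₂ : X₂' ⟶ Y₂'} (θ₂ : Sq f₂ g₂ p₂ q₂) :
    Cyl ((tSq (tSq θ θ₁) θ₂).vcomp (assNat q q₁ q₂).symm)
      (Sq.vcomp (assNat p p₁ p₂).symm (tSq θ (tSq θ₁ θ₂))) (assNat f f₁ f₂).hom
      (assNat g g₁ g₂).hom := by
  have := cyl_nat (MonoidalData.assoc (B := B)).hom
    (a := ((X, Z), X₂)) (a' := ((X', Z'), X₂')) (b := ((Y, x), Y₂))
    (b' := ((Y', x'), Y₂')) (f := (f ×ₘ f₁) ×ₘ f₂) (g := (g ×ₘ g₁) ×ₘ g₂)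
    (p := (p ×ₘ p₁) ×ₘ p₂) (q := (q ×ₘ q₁) ×ₘ q₂) (Iso.prod (Iso.prod θ θ₁) θ₂)
  rw [tripleL_map, tripleR_map] at this
  exact this

end AssNat
end MonBicat

/-! ### The action of `B` on `VArr V`. -/

namespace MonBicat

open Sq

theorem Sq.cyl_idSq {B : Type u} [Bicategory.{w, v} B] {a a' : B} {f g : a ⟶ a'} (θ : f ⟶ g) :
    Cyl (idSq f) (idSq g) θ θ := by
  simp [Cyl, idSq]

theorem Sq.Cyl.precomp_left {B : Type u} [Bicategory.{w, v} B] {a a' b b' : B}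
    {f f' g₁ : a ⟶ a'} {g g' : b ⟶ b'} {p : a ⟶ b} {q : a' ⟶ b'}
    {θ : Sq f g p q} {θ' : Sq f' g' p q} {κ : g₁ ≅ f} {l : g₁ ⟶ f'}
    {r : g ⟶ g'} (h : Cyl θ θ' (κ.inv ≫ l) r) : Cyl (θ.precomp κ) θ' l r := by
  rw [← precomp_refl θ']
  exact Cyl.precomp (h.congr (by simp) rfl)

theorem Sq.Cyl.precomp_right {B : Type u} [Bicategory.{w, v} B] {a a' b b' : B}
    {f f' g₁ : a ⟶ a'} {g g' : b ⟶ b'} {p : a ⟶ b} {q : a' ⟶ b'}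
    {θ : Sq f g p q} {θ' : Sq f' g' p q} {κ : g₁ ≅ f'} {l : f ⟶ g₁}
    {r : g ⟶ g'} (h : Cyl θ θ' (l ≫ κ.hom) r) : Cyl θ (θ'.precomp κ) l r := by
  rw [← precomp_refl θ]
  exact Cyl.precomp (h.congr (by simp) rfl)

section Tensor

variable {B : Type u} [Bicategory.{w, v} B] [MonoidalData B]
  {X X' X'' Y Y' Y'' : B}

theorem rComp_hom (f : X ⟶ X') (g : X' ⟶ X'') (Y : B) :
    (rComp f g Y).hom = (𝟙 _ ⊠₂ (λ_ (𝟙 Y)).inv) ≫ (tComp f g (𝟙 Y) (𝟙 Y)).hom := rfl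

theorem rComp_inv (f : X ⟶ X') (g : X' ⟶ X'') (Y : B) :
    (rComp f g Y).inv = (tComp f g (𝟙 Y) (𝟙 Y)).inv ≫ (𝟙 _ ⊠₂ (λ_ (𝟙 Y)).hom) := rfl

end Tensor

namespace VArr

section Data

variable {B : Type u} [Bicategory.{w, v} B] [MonoidalData B] {V : B}

@[simp] theorem whiskerLeft_l {M N P : VArr V} (F : M ⟶ N) {G H : N ⟶ P} (η : G ⟶ H) :
    Hom₂.l (F ◁ η) = F.fst ◁ η.l := rfl
@[simp] theorem whiskerLeft_r {M N P : VArr V} (F : M ⟶ N) {G H : N ⟶ P} (η : G ⟶ H) :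
    Hom₂.r (F ◁ η) = F.snd ◁ η.r := rfl
@[simp] theorem whiskerRight_l {M N P : VArr V} {F G : M ⟶ N} (η : F ⟶ G) (H : N ⟶ P) :
    Hom₂.l (η ▷ H) = η.l ▷ H.fst := rfl
@[simp] theorem whiskerRight_r {M N P : VArr V} {F G : M ⟶ N} (η : F ⟶ G) (H : N ⟶ P) :
    Hom₂.r (η ▷ H) = η.r ▷ H.snd := rfl

/-- The action of `B` on `VArr V` on objects. -/
abbrev actObj (X : B) (M : VArr V) : VArr V :=
  ⟨X ⊠ M.src, X ⊠ M.tgt, ass X M.src V ≫ X ⊠ₗ M.hom⟩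

infixr:83 " ⋆ " => actObj

variable {X X' X'' : B} {M N P : VArr V}

/-- The action of `B` on `VArr V` on 1-cells. -/
abbrev actHom (k : X ⟶ X') (F : M ⟶ N) : X ⋆ M ⟶ X' ⋆ N :=
  ⟨k ⊠₁ F.fst, k ⊠₁ F.snd, (assNat k F.fst (𝟙 V)).paste (tSq (idSq k) F.sq)⟩

infixr:83 " ⋆₁ " => actHom

/-- The action of `B` on `VArr V` on invertible 2-cells. -/
def actIso {k k' : X ⟶ X'} {F F' : M ⟶ N} (θ : k ≅ k') (Ψ : F ≅ F')  : k ⋆₁ F ≅ k' ⋆₁ F' :=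
  isoMk (tIso θ ⟨Ψ.hom.l, Ψ.inv.l, congrArg Hom₂.l Ψ.hom_inv_id, congrArg Hom₂.l Ψ.inv_hom_id⟩)
    (tIso θ ⟨Ψ.hom.r, Ψ.inv.r, congrArg Hom₂.r Ψ.hom_inv_id, congrArg Hom₂.r Ψ.inv_hom_id⟩)
    ((cyl_assNat θ.hom Ψ.hom.l (𝟙 (𝟙 V))).paste (Cyl.tSq (cyl_idSq θ.hom) Ψ.hom.comm))

/-- The composition constraint of the action. -/
def actComp (k : X ⟶ X') (k' : X' ⟶ X'') (F : M ⟶ N) (G : N ⟶ P) :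
    (k ≫ k') ⋆₁ (F ≫ G) ≅ (k ⋆₁ F) ≫ (k' ⋆₁ G) :=
  isoMk (tComp _ _ _ _) (tComp _ _ _ _) (by
    -- The square of an acted-on 1-cell has two halves: `h` treats the associativity half and `h'`
    -- the tensor product with the given square. The unitor of `𝟙 V` appears because `V` is fixed by
    -- both 1-cells.
    have h := (cyl_assNat (𝟙 (k ≫ k')) (𝟙 (F.fst ≫ G.fst)) (λ_ (𝟙 V)).inv).trans
      (cyl_assNat_comp k k' F.fst G.fst (𝟙 V) (𝟙 V))
    have h' : Cyl (tSq (idSq (k ≫ k')) (F ≫ G).sq)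
        ((tSq (idSq k) F.sq).vcomp (tSq (idSq k') G.sq))
        ((𝟙 _ ⊠₂ (rComp F.fst G.fst V).hom) ≫ (tComp _ _ _ _).hom) (tComp _ _ _ _).hom := by
      rw [comp_sq, ← idSq_vcomp_idSq, ← precomp_refl ((idSq k).vcomp (idSq k')), tSq_precomp]
      apply Cyl.precomp_left
      refine (cyl_tSq_vcomp _ _ _ _).congr ?_ rfl
      simp only [tIso_inv, Iso.refl_inv, ← reassoc_of% tHom₂_comp]
      simp
    have key := (h.congr (l' := ((tComp k k' F.fst G.fst).hom ⊠₂ (λ_ (𝟙 V)).inv) ≫ (tComp _ _ _ _).hom)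
      (r' := (𝟙 (k ≫ k') ⊠₂ (rComp F.fst G.fst V).hom) ≫ (tComp _ _ _ _).hom) (by
        rw [← reassoc_of% tHom₂_comp]; simp) (by
        rw [← reassoc_of% tHom₂_comp]; simp [rComp_hom])).paste h'
    rw [← paste_vcomp_paste] at key
    refine Cyl.precomp_right (key.congr ?_ rfl)
    change tRight₂ _ _ ≫ _ = _
    rw [rComp_hom, ← reassoc_of% tHom₂_comp]
    simp)

/-- The unit constraint of the action. -/
def actId (X : B) (M : VArr V) : 𝟙 X ⋆₁ 𝟙 M ≅ 𝟙 (X ⋆ M) :=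
  isoMk (tId X M.src) (tId X M.tgt) (by
    have h' : Cyl (tSq (idSq (𝟙 X)) (𝟙 M : M ⟶ M).sq) (vid (𝟙 X ⊠₁ M.hom))
        ((𝟙 _ ⊠₂ (tId M.src V).hom) ≫ (tId _ _).hom) (tId _ _).hom := by
      rw [id_sq, ← vid_eq_idSq, ← precomp_refl (vid (𝟙 X)), tSq_precomp]
      apply Cyl.precomp_left
      refine (cyl_tSq_vid _ _).congr ?_ rfl
      simp only [tIso_inv, Iso.refl_inv, ← reassoc_of% tHom₂_comp]
      simp
    have key := (cyl_assNat_id X M.src V).paste h'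
    rw [vid_paste] at key
    exact Cyl.precomp_right key)

end Data

end VArr
end MonBicat

/-! ### The associativity constraint of the action. -/

namespace MonBicat

open Sq MonoidalBicategory

namespace VArr

section

variable {B : Type u} [Bicategory.{w, v} B] [MonoidalBicategory B] {V : B}
  {X X' Y Y' Z : B} {M N P : VArr V}

/-- The pentagonator as a square. -/
abbrev pentSq (W X Y Z : B) : Sq (ass W X Y ⊠ᵣ Z) (ass W X (Y ⊠ Z)) (ass (W ⊠ X) Y Z)
    (ass W (X ⊠ Y) Z ≫ W ⊠ₗ ass X Y Z) :=
  pent W X Y Z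

/-- The regrouping of the target of `actAss`. -/
abbrev regroup (X Y : B) (M : VArr V) :
    (ass X (Y ⊠ M.src) V ≫ X ⊠ₗ ass Y M.src V) ≫ X ⊠ₗ Y ⊠ₗ M.hom ≅
      ass X (Y ⊠ M.src) V ≫ X ⊠ₗ (ass Y M.src V ≫ Y ⊠ₗ M.hom) :=
  α_ _ _ _ ≪≫ whiskerLeftIso _ (lComp X (ass Y M.src V) (Y ⊠ₗ M.hom)).symm

/-- The associativity constraint of the action. -/
abbrev actAss (X Y : B) (M : VArr V) : (X ⊠ Y) ⋆ M ⟶ X ⋆ Y ⋆ M :=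
  ⟨ass X Y M.src, ass X Y M.tgt,
    Sq.cast (Iso.refl _) (regroup X Y M)
      ((pentSq X Y M.src V).paste (assNat₃ X Y M.hom).symm)⟩

theorem actHom_actHom_sq (k : X ⟶ X') (k' : Y ⟶ Y') (F : M ⟶ N) :
    (k ⋆₁ k' ⋆₁ F).sq = Sq.cast (regroup X Y M) (regroup X' Y' N)
      (((assNat k (k' ⊠₁ F.fst) (𝟙 V)).paste (tSq (idSq k) (assNat k' F.fst (𝟙 V)))).paste
        (tSq (idSq k) (tSq (idSq k') F.sq))) := by
  dsimp only [actHom]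
  rw [tSq_idSq_paste, paste_cast_paste]

theorem assNat₃_symm (X Y : B) {Z Z' : B} (h : Z ⟶ Z') :
    (assNat₃ X Y h).symm = Sq.cast (f := ass X Y Z) (g := ass X Y Z')
      (tIso (tId X Y) (Iso.refl h)) (Iso.refl _) (assNat (𝟙 X) (𝟙 Y) h).symm := by
  ext
  simp [assNat₃, Sq.cast, tIso_hom, tIso_inv]

theorem tIso_trans {f g h : X ⟶ X'} {f' g' h' : Y ⟶ Y'} (θ : f ≅ g) (ψ : g ≅ h) (θ' : f' ≅ g')
    (ψ' : g' ≅ h') : tIso (θ ≪≫ ψ) (θ' ≪≫ ψ') = tIso θ θ' ≪≫ tIso ψ ψ' := by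
  ext
  simp [tIso_hom, tHom₂_comp]

theorem tIso_refl (f : X ⟶ X') (g : Y ⟶ Y') : tIso (Iso.refl f) (Iso.refl g) = Iso.refl _ := by
  ext
  simp [tIso_hom]

/-- The passage between conjugates by `rComp`, which the bicategory `VArr V` produces, and tensor
products of squares, which occur in the modification axioms. -/
theorem rComp_conj {a a' b b' : B} {f : a ⟶ a'} {g : b ⟶ b'} {p : a ⟶ b} {q : a' ⟶ b'}
    (θ : Sq f g p q) (V : B) :
    (rComp f q V).inv ≫ (rIso θ V).hom ≫ (rComp p g V).hom = (tSq θ (idSq (𝟙 V))).hom := by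
  rw [rComp_inv, rComp_hom, rIso_hom]
  simp only [Category.assoc, ← reassoc_of% tHom₂_comp]
  simp [tSq, tIso_hom, idSq, unitors_equal]

/-- Naturality of the associativity constraint. -/
def actAssNat (k : X ⟶ X') (k' : Y ⟶ Y') (F : M ⟶ N) :
    ((k ⊠₁ k') ⋆₁ F) ≫ actAss X' Y' N ≅ actAss X Y M ≫ (k ⋆₁ k' ⋆₁ F) :=
  isoMk (assNat k k' F.fst) (assNat k k' F.snd) (by
    rw [comp_sq, comp_sq, actHom_actHom_sq]
    -- The half involving the 1-cells `M.hom` and `N.hom`: naturality of associativity at the square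
    -- of `F`.
    have h : Cyl ((tSq (idSq (k ⊠₁ k')) F.sq).vcomp (assNat₃ X' Y' N.hom).symm)
        (Sq.vcomp (assNat₃ X Y M.hom).symm (tSq (idSq k) (tSq (idSq k') F.sq)))
        (assNat k k' (F.fst ⊠ᵣ V)).hom (assNat k k' F.snd).hom := by
      have h₁ := (cyl_assNat_tSq (idSq k) (idSq k') F.sq).cast (tIso (tId X Y) (Iso.refl _))
        (Iso.refl _)
      rw [tSq_idSq_idSq, ← vcomp_cast _ _ _ (tIso (tId X' Y') (Iso.refl _)),
        ← vcomp_cast _ _ _ (Iso.refl _), cast_refl, ← assNat₃_symm, ← assNat₃_symm,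
        ← cast_refl F.sq, tSq_cast, Sq.cast_cast, ← tIso_trans, ← tIso_trans] at h₁
      simpa [cast_refl, tIso_refl] using h₁
    -- The half involving only the sources: the modification axiom of the pentagonator, read as a
    -- commutative cube.
    have h' : Cyl ((assNat (k ⊠₁ k') F.fst (𝟙 V)).vcomp (pentSq X' Y' N.src V))
        ((pentSq X Y M.src V).vcomp
          ((assNat k (k' ⊠₁ F.fst) (𝟙 V)).paste (tSq (idSq k) (assNat k' F.fst (𝟙 V)))))
        (tSq (assNat k k' F.fst) (idSq (𝟙 V))).hom (assNat k k' (F.fst ⊠ᵣ V)).hom :=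
      Cyl.of_cube (pent_naturality k k' F.fst (𝟙 V))
    have key := (h'.paste h).cast (Iso.refl _) (regroup X' Y' N)
    rw [← paste_vcomp_paste, ← paste_vcomp_paste, ← vcomp_cast _ _ _ (Iso.refl _),
      ← vcomp_cast _ _ _ (regroup X Y M), cast_refl] at key
    exact Cyl.precomp (key.congr (rComp_conj _ V) rfl))

end

end VArr
end MonBicat

/-! ### The left unit constraint of the action. -/

namespace MonBicat

open Sq MonoidalBicategory

namespace Sq

section

variable {B : Type u} [Bicategory.{w, v} B] {a a' a'' b b' b'' c c' d d' : B}

theorem idSq_paste {f : a ⟶ a'} {g : b ⟶ b'} {p : a ⟶ b} {q : a' ⟶ b'} (θ : Sq f g p q) :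
    (idSq f).paste θ = θ.cast (λ_ p).symm (λ_ q).symm := by
  ext
  simp [Sq.paste, idSq, Sq.cast]

theorem paste_idSq {f : a ⟶ a'} {g : b ⟶ b'} {p : a ⟶ b} {q : a' ⟶ b'} (θ : Sq f g p q) :
    θ.paste (idSq g) = θ.cast (ρ_ p).symm (ρ_ q).symm := by
  ext
  simp [Sq.paste, idSq, Sq.cast]

theorem paste_symm {f : a ⟶ a'} {g : b ⟶ b'} {h : c ⟶ c'} {p : a ⟶ b}
    {q : a' ⟶ b'} {r : b ⟶ c} {s : b' ⟶ c'} (θ : Sq f g p q) (φ : Sq g h r s) :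
    (θ.paste φ).symm = Sq.vcomp (f := p) (f' := r) (g := q) (g' := s) θ.symm φ.symm := by
  ext
  simp [Sq.paste, vcomp]

/-- A modification square, read as a compatibility of transposed squares. -/
theorem Cyl.of_symm {X : a ⟶ a'} {Z : b ⟶ b'} {p p' : a ⟶ b} {q q' : a' ⟶ b'} {S : Sq X Z p q}
    {S' : Sq X Z p' q'} {e : p' ⟶ p} {e' : q' ⟶ q} (h : X ◁ e' ≫ S.hom = S'.hom ≫ e ▷ Z) :
    Cyl (f := p') (g := q') (f' := p) (g' := q) S'.symm S.symm e e' := by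
  simp only [Cyl, Iso.symm_hom]
  rw [Iso.eq_inv_comp, ← reassoc_of% h, Iso.hom_inv_id, Category.comp_id]

/-- A commutative triangular prism, with one pair of opposite faces read as 2-cells between
vertical sides. -/
theorem Cyl.of_prism {X : a ⟶ a'} {Y : d ⟶ d'} {Z : c ⟶ c'} {x : a ⟶ c} {x' : a' ⟶ c'}
    {z : a ⟶ d} {z' : a' ⟶ d'} {t : d ⟶ c} {t' : d' ⟶ c'} {L : Sq X Z x x'} {S : Sq X Y z z'}
    {T : Sq Y Z t t'} {e : z ≫ t ≅ x} {e' : z' ≫ t' ≅ x'}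
    (h : X ◁ e'.hom ≫ L.hom = (S.paste T).hom ≫ e.hom ▷ Z) :
    Cyl (S.vcomp (ρ_ x' ≪≫ e'.symm)) (Sq.vcomp (ρ_ x ≪≫ e.symm) (idSq Z)) L.hom T.hom := by
  apply Cyl.of_cube
  rw [paste_idSq]
  have h' : X ◁ e'.inv ≫ (S.paste T).hom = L.hom ≫ e.inv ▷ Z := by
    rw [← cancel_epi (X ◁ e'.hom), reassoc_of% h]
    simp
  simp [Sq.cast, h']

end

end Sq

section

variable {B : Type u} [Bicategory.{w, v} B] [MonoidalData B]

theorem lComp_hom (X : B) {Y Y' Y'' : B} (f : Y ⟶ Y') (g : Y' ⟶ Y'') :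
    (lComp X f g).hom = ((λ_ (𝟙 X)).inv ⊠₂ 𝟙 _) ≫ (tComp (𝟙 X) (𝟙 X) f g).hom := rfl

theorem lComp_inv (X : B) {Y Y' Y'' : B} (f : Y ⟶ Y') (g : Y' ⟶ Y'') :
    (lComp X f g).inv = (tComp (𝟙 X) (𝟙 X) f g).inv ≫ ((λ_ (𝟙 X)).hom ⊠₂ 𝟙 _) := rfl

theorem lComp_conj {a a' b b' : B} {f : a ⟶ a'} {g : b ⟶ b'} {p : a ⟶ b} {q : a' ⟶ b'}
    (X : B) (θ : Sq f g p q) :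
    (lComp X f q).inv ≫ (lIso X θ).hom ≫ (lComp X p g).hom = (tSq (idSq (𝟙 X)) θ).hom := by
  rw [lComp_inv, lComp_hom, lIso, tIso_hom]
  simp only [Category.assoc, ← reassoc_of% tHom₂_comp]
  simp [tSq, tIso_hom, idSq, unitors_equal]

theorem cyl_lunNat {a a' b b' : B} {f : a ⟶ a'} {g : b ⟶ b'} {p : a ⟶ b} {q : a' ⟶ b'}
    (θ : Sq f g p q) : Cyl ((tSq (idSq (𝟙 (unit B))) θ).vcomp (lunNat q).symm)
      (Sq.vcomp (lunNat p).symm θ) (lunNat f).hom (lunNat g).hom := by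
  have h := cyl_nat (MonoidalData.lUnit (B := B)).hom θ
  have e₁ : θ.map ((Bicategory.Prod.sectR (unit B) B).toPseudofunctor.comp
      (MonoidalData.tensor (B := B))) = tSq (idSq (𝟙 (unit B))) θ :=
    Iso.ext (by
      change ((tComp _ _ _ _).inv ≫ ((ρ_ (𝟙 (unit B))).hom ⊠₂ 𝟙 _)) ≫ (𝟙 _ ⊠₂ θ.hom) ≫
        ((ρ_ (𝟙 (unit B))).inv ⊠₂ 𝟙 _) ≫ (tComp _ _ _ _).hom = _
      rw [← unitors_equal, ← unitors_inv_equal]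
      exact lComp_conj (unit B) θ)
  have e₂ : θ.map (Pseudofunctor.id B) = θ :=
    Iso.ext ((Category.id_comp _).trans (Category.comp_id _))
  rw [e₁, e₂] at h
  exact h

end

namespace VArr

section

variable {B : Type u} [Bicategory.{w, v} B] [MonoidalBicategory B] {V : B}
  {X X' Y Y' Z : B} {M N P : VArr V}

/-- The left 2-unitor as a square. -/
abbrev leftUnitSq (X Y : B) : Sq (lun X ⊠ᵣ Y) (lun (X ⊠ Y)) (ass (unit B) X Y) (𝟙 (X ⊠ Y)) :=
  ρ_ _ ≪≫ (leftUnit X Y).symm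

/-- The left unit constraint of the action. -/
abbrev actLun (M : VArr V) : unit B ⋆ M ⟶ M :=
  ⟨lun M.src, lun M.tgt, Sq.cast (Iso.refl _) (λ_ M.hom)
    ((leftUnitSq M.src V).paste (lunNat M.hom).symm)⟩

/-- Naturality of the left unit constraint. -/
def actLunNat (F : M ⟶ N) : (𝟙 (unit B) ⋆₁ F) ≫ actLun N ≅ actLun M ≫ F :=
  isoMk (lunNat F.fst) (lunNat F.snd) (by
    have e : F.sq = ((idSq (F.fst ⊠ᵣ V)).paste F.sq).cast (λ_ _) (λ_ _) := by
      rw [idSq_paste, Sq.cast_cast]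
      simp [cast_refl]
    rw [comp_sq, comp_sq, e]
    -- The source half is the modification axiom of the left 2-unitor; the other half, `cyl_lunNat`,
    -- is naturality at the square of `F`.
    have h' : Cyl ((assNat (𝟙 (unit B)) F.fst (𝟙 V)).vcomp (leftUnitSq N.src V))
        ((leftUnitSq M.src V).vcomp (idSq (F.fst ⊠ᵣ V)))
        (tSq (lunNat F.fst) (idSq (𝟙 V))).hom (lunNat (F.fst ⊠ᵣ V)).hom :=
      Cyl.of_prism (leftUnit_naturality F.fst (𝟙 V))
    have key := (h'.paste (cyl_lunNat F.sq)).cast (Iso.refl _) (λ_ _)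
    rw [← paste_vcomp_paste, ← paste_vcomp_paste, ← vcomp_cast _ _ _ (Iso.refl _),
      ← vcomp_cast _ _ _ (λ_ M.hom), cast_refl] at key
    rw [← e]
    rw [← e] at key
    exact Cyl.precomp (key.congr (rComp_conj _ V) rfl))

end

end VArr
end MonBicat

/-! ### The middle 2-unitor of the action. -/

namespace MonBicat

open Sq MonoidalBicategory

section

variable {B : Type u} [Bicategory.{w, v} B] {a a' b b' c c' : B}

theorem Sq.idSq_symm (f : a ⟶ a') : Iso.symm (idSq f) = vid f := rfl

theorem Sq.cast_paste {f : a ⟶ a'} {g : b ⟶ b'} {h : c ⟶ c'} {p p' : a ⟶ b} {q q' : a' ⟶ b'}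
    {r : b ⟶ c} {s : b' ⟶ c'} (θ : Sq f g p q) (φ : Sq g h r s) (κ : p ≅ p') (κ' : q ≅ q') :
    (θ.cast κ κ').paste φ =
      (θ.paste φ).cast (whiskerRightIso κ r) (whiskerRightIso κ' s) := by
  ext
  simp only [Sq.paste, Sq.cast, Iso.trans_hom, Iso.symm_hom, whiskerRightIso_hom,
    whiskerLeftIso_hom, comp_whiskerRight, whisker_assoc, Category.assoc, whiskerRightIso_inv]
  rw [associator_naturality_left_assoc, ← whisker_exchange_assoc, associator_inv_naturality_left]
  simp

end

section

variable {B : Type u} [Bicategory.{w, v} B] [MonoidalData B] {a a' a'' b b' b'' c c' d d' : B}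

theorem tSq_symm {f : a ⟶ a'} {g : b ⟶ b'} {p : a ⟶ b} {q : a' ⟶ b'}
    {h : c ⟶ c'} {k : d ⟶ d'} {r : c ⟶ d} {s : c' ⟶ d'} (θ : Sq f g p q) (ψ : Sq h k r s) :
    (tSq θ ψ).symm = tSq (f := p) (g := q) (p := f) (q := g) (h := r) (k := s) (r := h) (s := k)
      θ.symm ψ.symm := by
  ext
  simp [tSq, tIso_hom, tIso_inv]

theorem tSq_idSq_cast {X X' : B} (k : X ⟶ X') {f : a ⟶ a'} {g : b ⟶ b'} {p p' : a ⟶ b}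
    {q q' : a' ⟶ b'} (θ : Sq f g p q) (κ : p ≅ p') (κ' : q ≅ q') :
    tSq (idSq k) (θ.cast κ κ') =
      (tSq (idSq k) θ).cast (lIso X κ) (lIso X' κ') := by
  conv_lhs => rw [← cast_refl (idSq k), tSq_cast]
  rfl

theorem tLeft_leftUnitor (X : B) (f : a ⟶ a') :
    (lIso X (λ_ f)).hom =
      (lComp X (𝟙 a) f).hom ≫ (tId X a).hom ▷ (X ⊠ₗ f) ≫ (λ_ (X ⊠ₗ f)).hom := by
  have h := (MonoidalData.tensor (B := B)).map₂_left_unitor (a := (X, a)) (b := (X, a'))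
    (𝟙 X ×ₘ f)
  have h' : (λ_ (𝟙 X)).hom ⊠₂ (λ_ f).hom = (tComp (𝟙 X) (𝟙 X) (𝟙 a) f).hom ≫
      (tId X a).hom ▷ (X ⊠ₗ f) ≫ (λ_ (X ⊠ₗ f)).hom := h
  rw [lComp_hom, Category.assoc, ← h', ← tHom₂_comp]
  simp [lIso, tIso_hom]

theorem tLeft_rightUnitor (X : B) (f : a ⟶ a') :
    (lIso X (ρ_ f)).hom =
      (lComp X f (𝟙 a')).hom ≫ (X ⊠ₗ f) ◁ (tId X a').hom ≫ (ρ_ (X ⊠ₗ f)).hom := by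
  have h := (MonoidalData.tensor (B := B)).map₂_right_unitor (a := (X, a)) (b := (X, a'))
    (𝟙 X ×ₘ f)
  have h' : (ρ_ (𝟙 X)).hom ⊠₂ (ρ_ f).hom = (tComp (𝟙 X) (𝟙 X) f (𝟙 a')).hom ≫
      (X ⊠ₗ f) ◁ (tId X a').hom ≫ (ρ_ (X ⊠ₗ f)).hom := h
  rw [lComp_hom, Category.assoc, ← h', ← tHom₂_comp]
  simp [lIso, tIso_hom]

theorem lIso_trans (X : B) {f g h : a ⟶ a'} (θ : f ≅ g) (ψ : g ≅ h) :
    lIso X (θ ≪≫ ψ) = lIso X θ ≪≫ lIso X ψ := by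
  ext
  simp [lIso, tIso_hom, ← tHom₂_comp]

end

/-- The diagrammatic manipulation turning the left normalization condition into a compatibility
of squares. -/
theorem midUnit_cyl_aux {B : Type u} [Bicategory.{w, v} B] {x₀ x₁ x₂ x₃ x₄ x₅ x₆ : B}
    {A : x₀ ⟶ x₁} {L : x₁ ⟶ x₂} {a : x₂ ⟶ x₃} {i : x₃ ⟶ x₃} (s : i ≅ 𝟙 x₃)
    {b : x₁ ⟶ x₄} {c : x₄ ⟶ x₃} {d : x₄ ⟶ x₅} {e : x₅ ⟶ x₃} {p : x₀ ⟶ x₆} {q : x₆ ⟶ x₅}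
    {R : x₀ ⟶ x₂} {R' : x₆ ⟶ x₃}
    (n₂ : L ≫ a ≅ b ≫ c) (l : d ≫ e ≅ c) (P : A ≫ b ≫ d ≅ p ≫ q) (m : q ≫ e ≅ R')
    (n₁ : R ≫ a ≅ p ≫ R') (k : A ≫ L ≅ R)
    (h : P.hom ▷ e ⊗≫ p ◁ m.hom ⊗≫ n₁.inv =
      𝟙 _ ⊗≫ (A ≫ b) ◁ l.hom ⊗≫ A ◁ n₂.inv ⊗≫ k.hom ▷ a) :
    k.hom ▷ (a ≫ i) ≫ R ◁ (a ◁ s.hom ≫ (ρ_ a).hom) ≫ n₁.hom ≫ 𝟙 p ▷ R' =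
      ((α_ _ _ _).hom ≫ A ◁ ((α_ _ _ _).inv ≫ n₂.hom ▷ i ≫ (α_ _ _ _).hom ≫
        b ◁ (c ◁ s.hom ≫ (ρ_ c).hom ≫ l.inv) ≫ (α_ _ _ _).inv) ≫ (α_ _ _ _).inv ≫
        P.hom ▷ e ≫ (α_ _ _ _).hom) ≫ p ◁ m.hom := by
  simp [bicategoricalComp] at h
  have h' : k.hom ▷ a ≫ n₁.hom = (α_ _ _ _).hom ≫ A ◁ n₂.hom ≫ A ◁ b ◁ l.inv ≫ (α_ _ _ _).inv ≫
      (α_ _ _ _).inv ≫ (α_ A b d).hom ▷ e ≫ P.hom ▷ e ≫ (α_ _ _ _).hom ≫ p ◁ m.hom := by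
    rw [← cancel_mono n₁.inv]
    simp [h]
  have e₁ : k.hom ▷ (a ≫ i) ≫ R ◁ (a ◁ s.hom ≫ (ρ_ a).hom) =
      (A ≫ L) ◁ (a ◁ s.hom ≫ (ρ_ a).hom) ≫ k.hom ▷ a := by
    rw [whisker_exchange]
  have e₂ : (α_ L a i).inv ≫ n₂.hom ▷ i ≫ (α_ b c i).hom ≫ b ◁ (c ◁ s.hom ≫ (ρ_ c).hom) =
      L ◁ (a ◁ s.hom ≫ (ρ_ a).hom) ≫ n₂.hom := by
    calc _ = (α_ L a i).inv ≫ (n₂.hom ▷ i ≫ (b ≫ c) ◁ s.hom) ≫ (ρ_ (b ≫ c)).hom := by simp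
      _ = _ := by
        rw [← whisker_exchange]
        simp
  have e₃ := congrArg (fun t => A ◁ t) e₂
  simp only [whiskerLeft_comp] at e₃
  rw [reassoc_of% e₁, reassoc_of% h']
  simp only [whiskerLeft_comp, Category.assoc, reassoc_of% e₃]
  bicategory

namespace VArr

section

variable {B : Type u} [Bicategory.{w, v} B] [MonoidalBicategory B] {V : B}
  {X X' Y Y' Z : B} {M N P : VArr V}

theorem actHom_id_sq (k : X ⟶ X') (M : VArr V) :
    (k ⋆₁ 𝟙 M).sq = Sq.paste (f := (k ⊠ᵣ M.src) ⊠ᵣ V) (g := k ⊠ᵣ (M.src ⊠ V))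
      (assNat₁ k M.src V) (tSq (idSq k) (vid M.hom)) := by
  have e : tSq (idSq k) ((vid M.hom).precomp (tId M.src V)) =
      (tSq (idSq k) (vid M.hom)).precomp (tIso (Iso.refl k) (tId M.src V)) := by
    rw [← tSq_precomp, precomp_refl]
  change (assNat k (𝟙 M.src) (𝟙 V)).paste (tSq (idSq k) ((vid M.hom).precomp (tId M.src V))) = _
  rw [e, ← postcomp_paste_precomp]
  rfl

/-- The comparison of `ass X Y Z` with its composite with an identity. -/
abbrev assCompId (X Y Z : B) : ass X Y Z ≅ ass X Y Z ≫ X ⊠ₗ 𝟙 (Y ⊠ Z) :=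
  (ρ_ _).symm ≪≫ whiskerLeftIso _ (tId X (Y ⊠ Z)).symm

/-- The source half of `actMidUnit`, independent of the 1-cell `M.hom`. It is the left normalization
condition in the language of squares. -/
theorem cyl_midUnit_free (X Y Z : B) :
    Cyl ((pentSq X (unit B) Y Z).vcomp
        ((assNat (𝟙 X) (lun Y) (𝟙 Z)).paste (tSq (idSq (𝟙 X)) (leftUnitSq Y Z))))
      (Sq.cast (f := (run X ⊠ᵣ Y) ⊠ᵣ Z) (g := run X ⊠ᵣ (Y ⊠ Z)) (Iso.refl _) (assCompId X Y Z)
        (assNat₁ (run X) Y Z))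
      ((rComp _ _ Z).inv ≫ (rIso (midUnit X Y) Z).hom) (midUnit X (Y ⊠ Z)).hom := by
  have h := left_normalization X Y Z
  have e : (tSq (idSq (𝟙 X)) (leftUnitSq Y Z)).hom = _ ◁ (tId X (Y ⊠ Z)).hom ≫ (ρ_ _).hom ≫
      (lIso X (leftUnit Y Z)).inv ≫ (lComp X _ _).hom := by
    rw [← lComp_conj, lIso_trans, Iso.trans_hom, tLeft_rightUnitor]
    simp
    rfl
  have e₂ : assNat (𝟙 X) (lun Y) (𝟙 Z) = assNat₂ X (lun Y) Z := rfl
  simp only [Cyl, vcomp, Sq.paste, Sq.cast, e, e₂, Iso.trans_hom, Iso.symm_hom, whiskerLeftIso_hom,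
    whiskerRightIso_hom, Iso.refl_hom, Iso.trans_inv, Iso.symm_inv, whiskerLeftIso_inv]
  have := midUnit_cyl_aux (tId X (Y ⊠ Z)) (assNat₂ X (lun Y) Z)
    ((lComp X _ _).symm ≪≫ lIso X (leftUnit Y Z)) (pentSq X (unit B) Y Z) (midUnit X (Y ⊠ Z))
    (assNat₁ (run X) Y Z) ((rComp _ _ Z).symm ≪≫ rIso (midUnit X Y) Z) h
  simpa using this

theorem runNat_id_symm (X : B) : (runNat (𝟙 X)).symm = Sq.cast (f := run X) (g := run X)
    (tId X (unit B)).symm (Iso.refl _) (idSq (run X)) := by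
  have h : (runNat (𝟙 X)).hom ≫ run X ◁ 𝟙 _ =
      ((𝟙 (𝟙 X) ⊠₂ 𝟙 (𝟙 (unit B))) ≫ (tId X (unit B)).hom) ▷ run X ≫ (λ_ _).hom ≫ (ρ_ _).inv := by
    have h₀ := (MonoidalData.rUnit (B := B)).hom.naturality_id X
    exact h₀.trans (congrArg (fun t => t ▷ run X ≫ (λ_ (run X)).hom ≫ (ρ_ (run X)).inv)
      ((tensorRight_mapId X (unit B)).trans (by simp; rfl)))
  have h' : runNat (𝟙 X) =
      (Sq.cast (f := run X) (g := run X) (tId X (unit B)).symm (Iso.refl _) (idSq (run X))).symm := by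
    ext
    simpa [Sq.cast, idSq] using h
  rw [h']
  rfl

/-- The other half of `actMidUnit`: the modification axiom of the middle 2-unitor at an identity and
`m`, transposed and freed of unit constraints. -/
theorem cyl_midUnit_nat (X : B) {Y Y' : B} (m : Y ⟶ Y') :
    Cyl (Sq.vcomp (f := ass X (unit B) Y) (g := ass X (unit B) Y') (assNat₃ X (unit B) m).symm
        (tSq (idSq (𝟙 X)) (lunNat m).symm))
      (tSq (idSq (run X)) (vid m)) (midUnit X Y).hom (midUnit X Y').hom := by
  have h := (Cyl.of_symm (midUnit_naturality (𝟙 X) m)).cast (tIso (tId X (unit B)) (Iso.refl m))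
    (Iso.refl _)
  rw [paste_symm, ← vcomp_cast _ _ _ (Iso.refl _), cast_refl, ← assNat₃_symm] at h
  have e₁ : (tSq (idSq (𝟙 X)) (lunNat m)).symm = tSq (idSq (𝟙 X)) (lunNat m).symm :=
    (tSq_symm _ _).trans (by rw [idSq_symm, vid_eq_idSq])
  have e₂ : Sq.cast (tIso (tId X (unit B)) (Iso.refl m)) (Iso.refl _)
      (Iso.symm (tSq (runNat (𝟙 X)) (idSq m))) = tSq (idSq (run X)) (vid m) := by
    rw [tSq_symm, runNat_id_symm, ← cast_refl (Iso.symm (idSq m)), tSq_cast, Sq.cast_cast,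
      ← tIso_trans]
    simp [tIso_refl, cast_refl, idSq_symm]
  rw [e₁, e₂] at h
  exact h

/-- The middle 2-unitor of the action. -/
def actMidUnit (X : B) (M : VArr V) :
    actAss X (unit B) M ≫ (𝟙 X ⋆₁ actLun M) ≅ run X ⋆₁ 𝟙 M :=
  isoMk (midUnit X M.src) (midUnit X M.tgt) (by
    let κ : (ass X M.src V ≫ X ⊠ₗ 𝟙 (M.src ⊠ V)) ≫ X ⊠ₗ M.hom ≅ ass X M.src V ≫ X ⊠ₗ M.hom :=
      whiskerRightIso (assCompId X M.src V).symm _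
    have e : κ = α_ _ _ _ ≪≫ whiskerLeftIso _ ((lComp X (𝟙 _) M.hom).symm ≪≫
        lIso X (λ_ M.hom)) := by
      ext
      simp [κ, tLeft_leftUnitor]
    have e₁ : (𝟙 X ⋆₁ actLun M).sq = Sq.cast (regroup X (unit B) M) κ
        (((assNat (𝟙 X) (lun M.src) (𝟙 V)).paste (tSq (idSq (𝟙 X)) (leftUnitSq M.src V))).paste
          (tSq (idSq (𝟙 X)) (lunNat M.hom).symm)) := by
      dsimp only [actHom]
      rw [tSq_idSq_cast, tSq_idSq_paste, Sq.cast_cast, paste_cast_paste, e]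
      simp [lIso, tIso_refl]
    have e₂ : (run X ⋆₁ 𝟙 M).sq = Sq.cast (Iso.refl _) κ
        (Sq.paste (f := (run X ⊠ᵣ M.src) ⊠ᵣ V) (g := run X ⊠ᵣ (M.src ⊠ V))
        (Sq.cast (f := (run X ⊠ᵣ M.src) ⊠ᵣ V) (g := run X ⊠ᵣ (M.src ⊠ V)) (Iso.refl _)
          (assCompId X M.src V) (assNat₁ (run X) M.src V)) (tSq (idSq (run X)) (vid M.hom))) := by
      rw [actHom_id_sq, cast_paste, Sq.cast_cast]
      conv_lhs => rw [← cast_refl (Sq.paste _ _)]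
      congr 1 <;> ext <;> simp [κ]
    rw [comp_sq, e₁, e₂]
    have key := ((cyl_midUnit_free X M.src V).paste (cyl_midUnit_nat X M.hom)).cast (Iso.refl _) κ
    rw [← paste_vcomp_paste, ← vcomp_cast _ _ _ (regroup X (unit B) M)] at key
    exact Cyl.precomp_left key)

end

end VArr
end MonBicat

/-! ### The pentagonator of the action. -/

namespace MonBicat

open Sq MonoidalBicategory

namespace Sq

variable {B : Type u} [Bicategory.{w, v} B] {a a' a'' b b' b'' c c' : B}

theorem Cyl.symm_cast {f f' : a ⟶ a'} {g g' : b ⟶ b'} {p : a ⟶ b} {q : a' ⟶ b'}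
    {θ : Sq f g p q} {θ' : Sq f' g' p q} {l : f ≅ f'} {r : g ≅ g'} (h : Cyl θ θ' l.hom r.hom) :
    Sq.cast (f := p) (g := q) l r θ.symm = θ'.symm := by
  ext
  simp only [Cyl] at h
  simp only [Sq.cast, Iso.trans_hom, whiskerLeftIso_hom, Iso.symm_hom, whiskerRightIso_hom]
  rw [← cancel_mono θ'.hom, Category.assoc, Category.assoc, h]
  simp

theorem vcomp_symm {f : a ⟶ a'} {g : b ⟶ b'} {f' : a' ⟶ a''} {g' : b' ⟶ b''}
    {p : a ⟶ b} {q : a' ⟶ b'} {r : a'' ⟶ b''} (θ : Sq f g p q) (φ : Sq f' g' q r) :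
    (θ.vcomp φ).symm = Sq.paste (f := p) (g := q) (h := r) (p := f) (q := g) (r := f') (s := g')
      θ.symm φ.symm := by
  ext
  simp [vcomp, Sq.paste]

end Sq

section

variable {B : Type u} [Bicategory.{w, v} B] [MonoidalData B]
  {X X' X'' Y Y' Y'' Z Z' Z'' : B}

theorem tComp_naturality {f f' : X ⟶ X'} {g g' : X' ⟶ X''} {h h' : Y ⟶ Y'} {k k' : Y' ⟶ Y''}
    (a : f ⟶ f') (b : g ⟶ g') (c : h ⟶ h') (d : k ⟶ k') :
    ((a ▷ g ≫ f' ◁ b) ⊠₂ (c ▷ k ≫ h' ◁ d)) ≫ (tComp f' g' h' k').hom =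
      (tComp f g h k).hom ≫ (a ⊠₂ c) ▷ (g ⊠₁ k) ≫ (f' ⊠₁ h') ◁ (b ⊠₂ d) := by
  have h₁ : (a ▷ g) ⊠₂ (c ▷ k) = (tComp f g h k).hom ≫ (a ⊠₂ c) ▷ (g ⊠₁ k) ≫
      (tComp f' g h' k).inv :=
    (MonoidalData.tensor (B := B)).map₂_whisker_right (a := (X, Y)) (b := (X', Y'))
      (c := (X'', Y'')) (f := f ×ₘ h) (g := f' ×ₘ h') (a ×ₘ c) (g ×ₘ k)
  have h₂ : (f' ◁ b) ⊠₂ (h' ◁ d) = (tComp f' g h' k).hom ≫ (f' ⊠₁ h') ◁ (b ⊠₂ d) ≫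
      (tComp f' g' h' k').inv :=
    (MonoidalData.tensor (B := B)).map₂_whisker_left (a := (X, Y)) (b := (X', Y'))
      (c := (X'', Y'')) (f' ×ₘ h') (g := g ×ₘ k) (h := g' ×ₘ k') (b ×ₘ d)
  rw [tHom₂_comp, h₁, h₂]
  simp

theorem tId_leftUnitor_inv (X Y : B) :
    (tId X Y).hom ≫ (λ_ (𝟙 (X ⊠ Y))).inv ≫ (tId X Y).inv ▷ 𝟙 (X ⊠ Y) ≫
      (𝟙 X ⊠₁ 𝟙 Y) ◁ (tId X Y).inv =
    ((λ_ (𝟙 X)).inv ⊠₂ (λ_ (𝟙 Y)).inv) ≫ (tComp (𝟙 X) (𝟙 X) (𝟙 Y) (𝟙 Y)).hom := by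
  have h : (λ_ (𝟙 X)).hom ⊠₂ (λ_ (𝟙 Y)).hom = (tComp (𝟙 X) (𝟙 X) (𝟙 Y) (𝟙 Y)).hom ≫
      (tId X Y).hom ▷ _ ≫ (λ_ _).hom :=
    (MonoidalData.tensor (B := B)).map₂_left_unitor (a := (X, Y)) (b := (X, Y)) (𝟙 X ×ₘ 𝟙 Y)
  have h' : ((λ_ (𝟙 X)).inv ⊠₂ (λ_ (𝟙 Y)).inv) ≫ ((λ_ (𝟙 X)).hom ⊠₂ (λ_ (𝟙 Y)).hom) = 𝟙 _ := by
    rw [← tHom₂_comp]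
    simp
  rw [h] at h'
  rw [← cancel_mono ((tId X Y).hom ▷ (𝟙 X ⊠₁ 𝟙 Y) ≫ (λ_ (𝟙 X ⊠₁ 𝟙 Y)).hom), Category.assoc, Category.assoc,
    Category.assoc, Category.assoc, h']
  simp
  rw [whisker_exchange_assoc]
  simp [unitors_equal]

/-- Associativity constraints of a composite in the third variable. -/
theorem cyl_assNat₃_comp (X Y : B) (h : Z ⟶ Z') (h' : Z' ⟶ Z'') :
    Cyl (assNat₃ X Y (h ≫ h')) (Sq.vcomp (assNat₃ X Y h) (assNat₃ X Y h'))
      (lComp (X ⊠ Y) h h').hom (lIso X (lComp Y h h') ≪≫ lComp X _ _).hom := by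
  have e (Z Z' : B) (h : Z ⟶ Z') : assNat₃ X Y h =
      (assNat (𝟙 X) (𝟙 Y) h).precomp (tIso (tId X Y).symm (Iso.refl h)) := rfl
  rw [e, e, e, precomp_vcomp_left, precomp_vcomp_right, precomp_precomp]
  apply Cyl.precomp
  refine ((cyl_assNat (λ_ (𝟙 X)).inv (λ_ (𝟙 Y)).inv (𝟙 (h ≫ h'))).trans
    (cyl_assNat_comp (𝟙 X) (𝟙 X) (𝟙 Y) (𝟙 Y) h h')).congr ?_ ?_
  · have n := tComp_naturality (tId X Y).inv (tId X Y).inv (𝟙 h) (𝟙 h')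
    simp only [id_whiskerRight, whiskerLeft_id, Category.comp_id] at n
    rw [lComp_hom]
    simp only [Iso.trans_hom, whiskerRightIso_hom, whiskerLeftIso_hom, Category.assoc, tIso_hom,
      tIso_inv, Iso.symm_hom, Iso.refl_hom, Iso.symm_inv, Iso.refl_inv]
    rw [← n]
    simp only [← reassoc_of% tHom₂_comp, tId_leftUnitor_inv, Category.id_comp]
  · simp only [Iso.trans_hom, lIso, tIso_hom, lComp_hom, Iso.refl_hom, ← reassoc_of% tHom₂_comp]
    simp

/-- The 1-cell of an acted-on object is a composite of an associativity 1-cell and a tensored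
1-cell, so associativity of `W`, `X` with such an object has to be split accordingly. -/
theorem assNat₃_comp_symm (X Y : B) (h : Z ⟶ Z') (h' : Z' ⟶ Z'') :
    (assNat₃ X Y (h ≫ h')).symm = Sq.cast (f := ass X Y Z) (g := ass X Y Z'')
      (lComp (X ⊠ Y) h h').symm (lIso X (lComp Y h h') ≪≫ lComp X _ _).symm
      (Sq.paste (f := ass X Y Z) (g := ass X Y Z') (h := ass X Y Z'')
        (assNat₃ X Y h).symm (assNat₃ X Y h').symm) := by
  rw [← vcomp_symm]
  exact (Cyl.symm_cast (cyl_assNat₃_comp X Y h h').inv).symm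

end

section

variable {B : Type u} [Bicategory.{w, v} B] [MonoidalData B]
  {X X' X'' X₃ : B}

/-- Tensoring on the left with an object, as a pseudofunctor. -/
abbrev tensorLeft (V : B) : B ⥤ᵖ B :=
  (Bicategory.Prod.sectR V B).toPseudofunctor.comp (MonoidalData.tensor (B := B))

/-- Tensoring a 2-cell on the left with an object. -/
abbrev tLeft₂ (V : B) {f g : X ⟶ X'} (θ : f ⟶ g) : V ⊠ₗ f ⟶ V ⊠ₗ g := 𝟙 (𝟙 V) ⊠₂ θ

theorem lIso_hom (V : B) {f g : X ⟶ X'} (θ : f ≅ g) : (lIso V θ).hom = tLeft₂ V θ.hom := rfl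

theorem lIso_inv (V : B) {f g : X ⟶ X'} (θ : f ≅ g) : (lIso V θ).inv = tLeft₂ V θ.inv := rfl

theorem tLeft₂_comp (V : B) {f g h : X ⟶ X'} (θ : f ⟶ g) (ψ : g ⟶ h) :
    tLeft₂ V (θ ≫ ψ) = tLeft₂ V θ ≫ tLeft₂ V ψ :=
  (tensorLeft V).map₂_comp θ ψ

theorem tensorLeft_mapComp (V : B) (f : X ⟶ X') (g : X' ⟶ X'') :
    (tensorLeft V).mapComp f g = lComp V f g := by
  ext
  change ((ρ_ (𝟙 V)).inv ⊠₂ 𝟙 _) ≫ _ = _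
  rw [← unitors_inv_equal]
  rfl

theorem tLeft₂_whiskerLeft (V : B) (f : X ⟶ X') {g h : X' ⟶ X''} (θ : g ⟶ h) :
    tLeft₂ V (f ◁ θ) = (lComp V f g).hom ≫ (V ⊠ₗ f) ◁ tLeft₂ V θ ≫ (lComp V f h).inv := by
  have h := (tensorLeft V).map₂_whisker_left f θ
  rw [tensorLeft_mapComp, tensorLeft_mapComp] at h
  exact h

theorem tLeft₂_associator (V : B) (f : X ⟶ X') (g : X' ⟶ X'') (h : X'' ⟶ X₃) :
    tLeft₂ V (α_ f g h).hom = (lComp V (f ≫ g) h).hom ≫ (lComp V f g).hom ▷ (V ⊠ₗ h) ≫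
      (α_ _ _ _).hom ≫ (V ⊠ₗ f) ◁ (lComp V g h).inv ≫ (lComp V f (g ≫ h)).inv := by
  have h := (tensorLeft V).map₂_associator f g h
  rw [tensorLeft_mapComp, tensorLeft_mapComp, tensorLeft_mapComp, tensorLeft_mapComp] at h
  exact h

end

/-- The diagrammatic manipulation turning the cocycle condition into a compatibility of
squares. -/
theorem cocycle_cyl_aux {B : Type u} [Bicategory.{w, v} B]
    {x₀ x₁ x₂ x₃ y₁ z₀ z₁ z₂ z₃ w₁ u₂ u₃ v₃ t₁ : B}
    {a₁ : x₀ ⟶ x₁} {a₂ : x₁ ⟶ x₂} {a₃ : x₂ ⟶ x₃} {b₁ : x₀ ⟶ y₁} {b₂ : y₁ ⟶ x₃}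
    {c₁ : z₀ ⟶ z₁} {c₂ : z₁ ⟶ z₂} {c₃ : z₂ ⟶ z₃} {d₁ : z₀ ⟶ w₁} {d₂ : w₁ ⟶ z₃}
    {p₀ : x₀ ⟶ z₀} {p₁ : x₁ ⟶ z₁} {p₂ : x₂ ⟶ u₂} {p₂' : u₂ ⟶ z₂} {p₃ : x₃ ⟶ u₃} {q₃ : u₃ ⟶ z₃}
    {q₁ : u₃ ⟶ v₃} {q₂ : v₃ ⟶ z₃} {g : u₂ ⟶ u₃} {m₁ : y₁ ⟶ t₁} {m₂ : t₁ ⟶ w₁} {t : t₁ ⟶ v₃}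
    (k : a₁ ≫ a₂ ≫ a₃ ⟶ b₁ ≫ b₂) (π : c₁ ≫ c₂ ≫ c₃ ⟶ d₁ ≫ d₂) (κ : q₃ ≅ q₁ ≫ q₂)
    (n₁ : Sq a₁ c₁ p₀ p₁) (P₂ : Sq a₂ c₂ p₁ (p₂ ≫ p₂')) (n₂ : Sq a₃ g p₂ p₃) (l : Sq g c₃ p₂' q₃)
    (Q₁ : Sq b₁ d₁ p₀ (m₁ ≫ m₂)) (Q₂ : Sq b₂ t m₁ (p₃ ≫ q₁)) (n₃ : m₂ ≫ d₂ ≅ t ≫ q₂)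
    (h : k ▷ (p₃ ≫ q₁ ≫ q₂) ⊗≫ b₁ ◁ Q₂.hom ▷ q₂ ⊗≫ (b₁ ≫ m₁) ◁ n₃.inv ⊗≫ Q₁.hom ▷ d₂ =
      𝟙 _ ⊗≫ (a₁ ≫ a₂) ◁ n₂.hom ▷ (q₁ ≫ q₂) ⊗≫ (a₁ ≫ a₂ ≫ p₂) ◁ (g ◁ κ.inv ≫ l.hom) ⊗≫
        a₁ ◁ P₂.hom ▷ c₃ ⊗≫ n₁.hom ▷ (c₂ ≫ c₃) ⊗≫ p₀ ◁ π ⊗≫ 𝟙 _) :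
    Cyl (n₁.vcomp (P₂.vcomp (n₂.paste l)))
      ((Q₁.vcomp (Sq.paste (h := d₂) (r := m₂) (s := q₂) Q₂ n₃.symm)).cast (Iso.refl _)
        (α_ _ _ _ ≪≫ whiskerLeftIso _ κ.symm)) k π := by
  simp only [Cyl]
  calc _ = (k ▷ (p₃ ≫ q₃) ≫ (b₁ ≫ b₂) ◁ (p₃ ◁ κ.hom)) ⊗≫
        (b₁ ◁ Q₂.hom ▷ q₂ ⊗≫ (b₁ ≫ m₁) ◁ n₃.inv ⊗≫ Q₁.hom ▷ d₂) ⊗≫ 𝟙 _ := by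
        simp [Sq.cast, vcomp, Sq.paste, bicategoricalComp]
    _ = 𝟙 _ ⊗≫ (a₁ ≫ a₂ ≫ a₃ ≫ p₃) ◁ κ.hom ⊗≫
        (k ▷ (p₃ ≫ q₁ ≫ q₂) ⊗≫ b₁ ◁ Q₂.hom ▷ q₂ ⊗≫ (b₁ ≫ m₁) ◁ n₃.inv ⊗≫ Q₁.hom ▷ d₂) ⊗≫ 𝟙 _ := by
        -- The constraint `κ` is moved before `k`, which exposes the left side of the hypothesis.
        rw [← whisker_exchange]
        bicategory
    _ = 𝟙 _ ⊗≫ (a₁ ≫ a₂) ◁ ((a₃ ≫ p₃) ◁ κ.hom ≫ n₂.hom ▷ (q₁ ≫ q₂)) ⊗≫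
        (a₁ ≫ a₂ ≫ p₂) ◁ (g ◁ κ.inv ≫ l.hom) ⊗≫
        a₁ ◁ P₂.hom ▷ c₃ ⊗≫ n₁.hom ▷ (c₂ ≫ c₃) ⊗≫ p₀ ◁ π ⊗≫ 𝟙 _ := by
        rw [h]
        bicategory
    _ = _ := by
        rw [whisker_exchange]
        simp [vcomp, Sq.paste, bicategoricalComp]
        bicategory

namespace VArr

section

variable {B : Type u} [Bicategory.{w, v} B] [MonoidalBicategory B] {V : B}

/-- The source half of `actPent`: exactly the nonabelian 4-cocycle condition, with `V` as its last
object. -/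
theorem cyl_pent_free (W X Y Z V : B) :
    Cyl (Sq.vcomp (f := (ass W X Y ⊠ᵣ Z) ⊠ᵣ V) (g := ass W X Y ⊠ᵣ (Z ⊠ V)) (assNat₁ (ass W X Y) Z V)
        ((pentSq W (X ⊠ Y) Z V).vcomp
          ((assNat (𝟙 W) (ass X Y Z) (𝟙 V)).paste (tSq (idSq (𝟙 W)) (pentSq X Y Z V)))))
      (Sq.cast (Iso.refl _) (regroup W X (⟨Y ⊠ Z, Y ⊠ Z ⊠ V, ass Y Z V⟩ : VArr V))
        ((pentSq (W ⊠ X) Y Z V).vcomp ((pentSq W X (Y ⊠ Z) V).paste (assNat₃ W X (ass Y Z V)).symm)))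
      ((rComp₃ _ _ _ V).inv ≫ (rIso (pent W X Y Z) V).hom ≫ (rComp _ _ V).hom)
      (pent W X Y (Z ⊠ V)).hom := by
  have h := cocycle W X Y Z V
  refine cocycle_cyl_aux _ _ (lComp W (ass X (Y ⊠ Z) V) (X ⊠ₗ ass Y Z V)) (assNat₁ (ass W X Y) Z V)
    (pentSq W (X ⊠ Y) Z V) (assNat (𝟙 W) (ass X Y Z) (𝟙 V)) (tSq (idSq (𝟙 W)) (pentSq X Y Z V))
    (pentSq (W ⊠ X) Y Z V) (pentSq W X (Y ⊠ Z) V) (assNat₃ W X (ass Y Z V)) ?_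
  rw [← lComp_conj]
  simpa [lComp₃, assNat₂] using h

theorem assNat_id_symm (X Y Z : B) : (assNat (𝟙 X) (𝟙 Y) (𝟙 Z)).symm =
    Sq.cast (f := ass X Y Z) (g := ass X Y Z) (tIso (tId X Y) (Iso.refl _) ≪≫ tId _ _).symm
      (tIso (Iso.refl _) (tId Y Z) ≪≫ tId _ _).symm (idSq (ass X Y Z)) :=
  (Cyl.symm_cast (θ := vid _) (θ' := assNat (𝟙 X) (𝟙 Y) (𝟙 Z))
    (l := (tIso (tId X Y) (Iso.refl _) ≪≫ tId _ _).symm)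
    (r := (tIso (Iso.refl _) (tId Y Z) ≪≫ tId _ _).symm) (Cyl.inv (l := tIso (tId X Y) (Iso.refl _) ≪≫ tId _ _)
    (r := tIso (Iso.refl _) (tId Y Z) ≪≫ tId _ _) (cyl_assNat_id X Y Z))).symm

/-- The other half of `actPent`: the modification axiom of the pentagonator at three identities and
`m`, with the unit constraints absorbed. -/
theorem cyl_pent_nat (W X Y : B) {Z Z' : B} (m : Z ⟶ Z') :
    Cyl ((tSq (idSq (ass W X Y)) (vid m)).vcomp
        (Sq.vcomp (f := ass W (X ⊠ Y) Z) (g := ass W (X ⊠ Y) Z') (assNat₃ W (X ⊠ Y) m).symm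
          (tSq (idSq (𝟙 W)) (assNat₃ X Y m).symm)))
      (Sq.vcomp (f := ass (W ⊠ X) Y Z) (g := ass (W ⊠ X) Y Z') (f' := ass W X (Y ⊠ Z))
        (g' := ass W X (Y ⊠ Z')) (assNat₃ (W ⊠ X) Y m).symm (assNat₃ W X (Y ⊠ₗ m)).symm)
      (pent W X Y Z).hom (pent W X Y Z').hom := by
  let κ₀ := tIso (tIso (tId W X) (Iso.refl (𝟙 Y)) ≪≫ tId (W ⊠ X) Y) (Iso.refl m)
  let κ₁ := tIso (tIso (Iso.refl (𝟙 W)) (tId X Y) ≪≫ tId W (X ⊠ Y)) (Iso.refl m)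
  let κ₂ := tIso (Iso.refl (𝟙 W)) (tIso (tId X Y) (Iso.refl m))
  have h := (Cyl.of_symm (pent_naturality (𝟙 W) (𝟙 X) (𝟙 Y) m)).cast κ₀ (Iso.refl _)
  have e₁ : Sq.cast κ₀ κ₁ (tSq (assNat (𝟙 W) (𝟙 X) (𝟙 Y)) (idSq m)).symm =
      tSq (idSq (ass W X Y)) (vid m) := by
    rw [tSq_symm, assNat_id_symm, ← cast_refl (Iso.symm (idSq m)), tSq_cast, Sq.cast_cast,
      ← tIso_trans, ← tIso_trans]
    simp [tIso_refl, cast_refl, idSq_symm]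
  have e₂ : Sq.cast (f := ass W (X ⊠ Y) Z) (g := ass W (X ⊠ Y) Z') κ₁ κ₂
      (assNat (𝟙 W) (𝟙 X ⊠₁ 𝟙 Y) m).symm = (assNat₃ W (X ⊠ Y) m).symm := by
    rw [assNat₃_symm, ← Cyl.symm_cast (l := tIso (tIso (Iso.refl (𝟙 W)) (tId X Y)) (Iso.refl m))
      (r := κ₂) (cyl_assNat (𝟙 (𝟙 W)) (tId X Y).hom (𝟙 m)), Sq.cast_cast, ← tIso_trans]
    simp [κ₁]
  have e₃ : Sq.cast κ₂ (Iso.refl _) (tSq (idSq (𝟙 W)) (assNat (𝟙 X) (𝟙 Y) m)).symm =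
      tSq (idSq (𝟙 W)) (assNat₃ X Y m).symm := by
    rw [tSq_symm, idSq_symm, vid_eq_idSq, assNat₃_symm, tSq_idSq_cast]
    simp [lIso, tIso_refl, κ₂]
  have e₄ : Sq.cast (f := ass (W ⊠ X) Y Z) (g := ass (W ⊠ X) Y Z') κ₀ (tIso (tId W X) (Iso.refl _))
      (assNat (𝟙 W ⊠₁ 𝟙 X) (𝟙 Y) m).symm = (assNat₃ (W ⊠ X) Y m).symm := by
    rw [assNat₃_symm, ← Cyl.symm_cast (l := tIso (tIso (tId W X) (Iso.refl (𝟙 Y))) (Iso.refl m))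
      (r := tIso (tId W X) (Iso.refl _)) ((cyl_assNat (tId W X).hom (𝟙 (𝟙 Y)) (𝟙 m)).congr rfl
        (by simp [tIso_hom])), Sq.cast_cast, ← tIso_trans]
    simp [κ₀]
  rw [paste_symm, paste_symm, paste_symm, ← vcomp_cast _ _ _ κ₁, ← vcomp_cast _ _ _ κ₂,
    ← vcomp_cast _ _ _ (tIso (tId W X) (Iso.refl _)), e₁, e₂, e₃, e₄, ← assNat₃_symm] at h
  exact h

/-- The pentagonator of the action. -/
def actPent (W X Y : B) (M : VArr V) :
    (ass W X Y ⋆₁ 𝟙 M) ≫ actAss W (X ⊠ Y) M ≫ (𝟙 W ⋆₁ actAss X Y M) ≅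
      actAss (W ⊠ X) Y M ≫ actAss W X (Y ⋆ M) :=
  isoMk (pent W X Y M.src) (pent W X Y M.tgt) (by
    let K : (ass W (X ⊠ (Y ⊠ M.src)) V ≫ W ⊠ₗ (ass X (Y ⊠ M.src) V ≫ X ⊠ₗ ass Y M.src V)) ≫
        W ⊠ₗ X ⊠ₗ Y ⊠ₗ M.hom ≅ (W ⋆ X ⋆ Y ⋆ M).hom :=
      α_ _ _ _ ≪≫ whiskerLeftIso _ ((lComp W _ _).symm ≪≫ lIso W (regroup X Y M))
    let r : (ass W (X ⊠ (Y ⊠ M.src)) V ≫ W ⊠ₗ ass X (Y ⊠ M.src) V) ≫ W ⊠ₗ X ⊠ₗ ass Y M.src V ≅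
      ass W (X ⊠ (Y ⊠ M.src)) V ≫ W ⊠ₗ (ass X (Y ⊠ M.src) V ≫ X ⊠ₗ ass Y M.src V) :=
      α_ _ _ _ ≪≫ whiskerLeftIso _ (lComp W _ _).symm
    have e₁ : (𝟙 W ⋆₁ actAss X Y M).sq = Sq.cast (regroup W (X ⊠ Y) M) K
        (((assNat (𝟙 W) (ass X Y M.src) (𝟙 V)).paste
          (tSq (idSq (𝟙 W)) (pentSq X Y M.src V))).paste
          (tSq (idSq (𝟙 W)) (assNat₃ X Y M.hom).symm)) := by
      dsimp only [actHom]
      rw [tSq_idSq_cast, tSq_idSq_paste, Sq.cast_cast, paste_cast_paste]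
      simp [lIso, tIso_refl, K]
    have e₂ : (actAss W X (Y ⋆ M)).sq = Sq.cast (regroup (W ⊠ X) Y M)
        (whiskerRightIso r _ ≪≫ K)
        (((pentSq W X (Y ⊠ M.src) V).paste (assNat₃ W X (ass Y M.src V)).symm).paste
          (assNat₃ W X (Y ⊠ₗ M.hom)).symm) := by
      dsimp only [actAss]
      rw [assNat₃_comp_symm, paste_cast_paste, Sq.cast_cast]
      congr 1
      · simp
      · ext
        simp [K, r, lIso_hom, lIso_inv, tLeft₂_comp, tLeft₂_associator, tLeft₂_whiskerLeft]
    rw [comp_sq, comp_sq, comp_sq, precomp_vcomp_right, precomp_precomp, e₁, e₂, actHom_id_sq]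
    have key := ((cyl_pent_free W X Y M.src V).paste (cyl_pent_nat W X Y M.hom)).cast
      (Iso.refl _) K
    rw [← paste_vcomp_paste, ← paste_vcomp_paste, Sq.cast_paste, ← paste_vcomp_paste,
      Sq.cast_cast] at key
    have e₃ (f : ((W ⊠ X) ⊠ Y) ⊠ M.src ⊠ V ⟶ ((W ⊠ X) ⊠ Y) ⊠ M.tgt) :
        whiskerRightIso (Iso.refl (ass ((W ⊠ X) ⊠ Y) M.src V)) f ≪≫ Iso.refl _ = Iso.refl _ := by
      ext
      simp
    rw [e₃, ← vcomp_cast _ _ _ (Iso.refl _), ← vcomp_cast _ _ _ (regroup W (X ⊠ Y) M), cast_refl,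
      ← vcomp_cast _ _ _ (regroup (W ⊠ X) Y M)] at key
    refine Cyl.precomp (key.congr ?_ rfl)
    simp [rComp₃])

end

end VArr
end MonBicat

/-! ### The left 2-unitor of the action. -/

namespace MonBicat

open Sq MonoidalBicategory

namespace Sq

variable {B : Type u} [Bicategory.{w, v} B] {a a' a'' b b' b'' : B}

theorem Cyl.of_precomp {f f' g₁ g₂ : a ⟶ a'} {g g' : b ⟶ b'} {p : a ⟶ b} {q : a' ⟶ b'}
    {θ : Sq f g p q} {θ' : Sq f' g' p q} {κ : g₁ ≅ f} {κ' : g₂ ≅ f'} {l : g₁ ⟶ g₂}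
    {r : g ⟶ g'} (h : Cyl (θ.precomp κ) (θ'.precomp κ') l r) :
    Cyl θ θ' (κ.inv ≫ l ≫ κ'.hom) r := by
  unfold Cyl at *
  simp only [Sq.precomp, Iso.trans_hom, whiskerRightIso_hom, Category.assoc] at h
  simp [h]

/-- The invertible square `θ` cancels, leaving the compatibility of `x` and `y` whiskered by `f`.
When `f` is an equivalence the whiskering cancels too. -/
theorem Cyl.whiskerLeft_eq {f : a ⟶ a'} {g : b ⟶ b'} {f' f'' : a' ⟶ a''} {g' g'' : b' ⟶ b''}
    {p : a ⟶ b} {q : a' ⟶ b'} {r : a'' ⟶ b''} {θ : Sq f g p q} {φ : Sq f' g' q r}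
    {φ' : Sq f'' g'' q r} {x : f' ⟶ f''} {y : g' ⟶ g''}
    (h : Cyl (θ.vcomp φ) (θ.vcomp φ') (f ◁ x) (g ◁ y)) :
    f ◁ (x ▷ r ≫ φ'.hom) = f ◁ (φ.hom ≫ q ◁ y) := by
  have e : θ.hom ▷ g' ≫ (α_ p g g').hom ≫ p ◁ g ◁ y =
      (α_ f q g').hom ≫ f ◁ q ◁ y ≫ (α_ f q g'').inv ≫ θ.hom ▷ g'' ≫ (α_ p g g'').hom := by
    rw [← associator_naturality_right, ← whisker_exchange_assoc]
    simp
  simp only [Cyl, vcomp, Iso.trans_hom, whiskerLeftIso_hom, whiskerRightIso_hom, Iso.symm_hom,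
    Category.assoc, e, whisker_assoc, Iso.inv_hom_id_assoc] at h
  rw [← cancel_epi (α_ f f' r).hom,
    ← cancel_mono ((α_ f q g'').inv ≫ θ.hom ▷ g'' ≫ (α_ p g g'').hom)]
  simpa only [whiskerLeft_comp, Category.assoc] using h

end Sq

theorem whiskerLeft_injective_of_section {B : Type u} [Bicategory.{w, v} B] {a b c : B}
    {g : b ⟶ a} {f : a ⟶ b} (e : g ≫ f ≅ 𝟙 b) {h k : b ⟶ c} {x y : h ⟶ k}
    (hxy : f ◁ x = f ◁ y) : x = y := by
  have h₁ : (g ≫ f) ◁ x = (g ≫ f) ◁ y := by simp [hxy]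
  have h₂ : 𝟙 b ◁ x = 𝟙 b ◁ y := by
    rw [← cancel_epi (e.hom ▷ h), ← whisker_exchange, ← whisker_exchange, h₁]
  simpa using h₂

theorem whiskerLeft_injective_of_isIso {B : Type u} [Bicategory.{w, v} B] [MonoidalBicategory B]
    {a b c : B} (f : a ⟶ b) [IsIso (Ho.cls f)] {h k : b ⟶ c} {x y : h ⟶ k}
    (hxy : f ◁ x = f ◁ y) : x = y := by
  obtain ⟨g, hg⟩ := Ho.cls_surjective (inv (Ho.cls f))
  have e : Ho.cls (g ≫ f) = Ho.cls (𝟙 b) := by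
    rw [Ho.cls_comp, hg, IsIso.inv_hom_id, Ho.cls_id]
  exact whiskerLeft_injective_of_section (Ho.cls_eq.1 e).some hxy

/-- The diagrammatic manipulation isolating the left 2-unitor in the left normalization
condition. -/
theorem leftUnit_aux {B : Type u} [Bicategory.{w, v} B] {x₀ x₁ x₂ x₃ x₄ x₅ x₆ : B}
    {A : x₀ ⟶ x₁} {L : x₁ ⟶ x₂} {a : x₂ ⟶ x₃}
    {b : x₁ ⟶ x₄} {c : x₄ ⟶ x₃} {d : x₄ ⟶ x₅} {e : x₅ ⟶ x₃} {p : x₀ ⟶ x₆} {q : x₆ ⟶ x₅}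
    {R : x₀ ⟶ x₂} {R' : x₆ ⟶ x₃}
    (n₂ : L ≫ a ≅ b ≫ c) (l : d ≫ e ⟶ c) (P : A ≫ b ≫ d ≅ p ≫ q) (m : q ≫ e ≅ R')
    (n₁ : R ≫ a ≅ p ≫ R') (k : A ≫ L ≅ R)
    (h : P.hom ▷ e ⊗≫ p ◁ m.hom ⊗≫ n₁.inv =
      𝟙 _ ⊗≫ (A ≫ b) ◁ l ⊗≫ A ◁ n₂.inv ⊗≫ k.hom ▷ a) :
    𝟙 _ ⊗≫ P.hom ▷ e ⊗≫ p ◁ m.hom ⊗≫ n₁.inv ⊗≫ k.inv ▷ a ⊗≫ A ◁ n₂.hom ⊗≫ 𝟙 _ =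
      (A ≫ b) ◁ l := by
  calc _ = 𝟙 _ ⊗≫ (P.hom ▷ e ⊗≫ p ◁ m.hom ⊗≫ n₁.inv) ⊗≫ k.inv ▷ a ⊗≫ A ◁ n₂.hom ⊗≫ 𝟙 _ := by
        simp [bicategoricalComp]
    _ = 𝟙 _ ⊗≫ (A ≫ b) ◁ l ⊗≫ A ◁ n₂.inv ⊗≫ (k.hom ≫ k.inv) ▷ a ⊗≫ A ◁ n₂.hom ⊗≫ 𝟙 _ := by
        rw [h]
        bicategory
    _ = 𝟙 _ ⊗≫ (A ≫ b) ◁ l ⊗≫ A ◁ (n₂.inv ≫ n₂.hom) ⊗≫ 𝟙 _ := by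
        rw [Iso.hom_inv_id]
        bicategory
    _ = _ := by
        rw [Iso.inv_hom_id]
        bicategory

namespace VArr

section

variable {B : Type u} [Bicategory.{w, v} B] [MonoidalBicategory B] {V : B}
  {X X' X'' Y Y' Z : B} {M N P : VArr V}

/-- The action of `X` on invertible 2-cells. -/
abbrev actLIso (X : B) {F G : M ⟶ N} (Ψ : F ≅ G) : 𝟙 X ⋆₁ F ≅ 𝟙 X ⋆₁ G :=
  actIso (Iso.refl _) Ψ

/-- The action of invertible 2-cells on an object. -/
abbrev actRIso {f g : X ⟶ X'} (θ : f ≅ g) (M : VArr V) : f ⋆₁ 𝟙 M ≅ g ⋆₁ 𝟙 M :=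
  actIso θ (Iso.refl _)

/-- The action of an object preserves composition. -/
abbrev actLComp (X : B) (F : M ⟶ N) (G : N ⟶ P) : 𝟙 X ⋆₁ (F ≫ G) ≅ (𝟙 X ⋆₁ F) ≫ (𝟙 X ⋆₁ G) :=
  actIso (λ_ (𝟙 X)).symm (Iso.refl _) ≪≫ actComp _ _ _ _

/-- The action on an object preserves composition. -/
abbrev actRComp (f : X ⟶ X') (g : X' ⟶ X'') (M : VArr V) :
    (f ≫ g) ⋆₁ 𝟙 M ≅ (f ⋆₁ 𝟙 M) ≫ (g ⋆₁ 𝟙 M) :=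
  actIso (Iso.refl _) (λ_ (𝟙 M)).symm ≪≫ actComp _ _ _ _

/-- Naturality of the associativity constraint of the action in the first variable. -/
abbrev actAssNat₁ (f : X ⟶ X') (Y : B) (M : VArr V) :
    ((f ⊠ᵣ Y) ⋆₁ 𝟙 M) ≫ actAss X' Y M ≅ actAss X Y M ≫ (f ⋆₁ 𝟙 (Y ⋆ M)) :=
  actAssNat f (𝟙 Y) (𝟙 M) ≪≫ whiskerLeftIso _ (actIso (Iso.refl f) (actId Y M))

/-- Compatibility can be tested after composition with a 1-cell whose first component is
an equivalence. -/
theorem comm_of_whiskerLeft (H : M ⟶ N) [IsIso (Ho.cls H.fst)] {F G : N ⟶ P}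
    {l : F.fst ⟶ G.fst} {r : F.snd ⟶ G.snd} (η : H ≫ F ⟶ H ≫ G) (hl : η.l = H.fst ◁ l)
    (hr : η.r = H.snd ◁ r) : Cyl F.sq G.sq (tRight₂ l V) r := by
  have : IsIso (Ho.cls (H.fst ⊠ᵣ V)) := by
    rw [Ho.cls_tRight]
    infer_instance
  apply whiskerLeft_injective_of_isIso (H.fst ⊠ᵣ V)
  have h := η.comm
  rw [hl, hr, tRight₂_whiskerLeft, comp_sq, comp_sq] at h
  exact ((Cyl.of_precomp h).congr (by simp) rfl).whiskerLeft_eq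

/-- Compatibility can be tested after the action of the unit object. -/
theorem comm_of_unit_act {F G : M ⟶ N} {l : F.fst ⟶ G.fst} {r : F.snd ⟶ G.snd}
    (η : 𝟙 (unit B) ⋆₁ F ⟶ 𝟙 (unit B) ⋆₁ G) (hl : η.l = tLeft₂ (unit B) l)
    (hr : η.r = tLeft₂ (unit B) r) : Cyl F.sq G.sq (tRight₂ l V) r := by
  have : IsIso (Ho.cls (actLun M).fst) := by
    change IsIso (Ho.cls (lun M.src))
    rw [Ho.cls_lun]
    infer_instance
  have e {x y : B} {f g : x ⟶ y} (θ : f ⟶ g) :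
      (lunNat f).inv ≫ tLeft₂ (unit B) θ ▷ lun y ≫ (lunNat g).hom = lun x ◁ θ := by
    rw [Iso.inv_comp_eq]
    exact (MonoidalData.lUnit (B := B)).hom.naturality_naturality θ
  refine comm_of_whiskerLeft (actLun M)
    ((actLunNat F).inv ≫ η ▷ actLun N ≫ (actLunNat G).hom) ?_ ?_
  · simp only [comp_l, whiskerRight_l, hl]
    exact e l
  · simp only [comp_r, whiskerRight_r, hr]
    exact e r

/-- The left normalization condition solved for the tensored left 2-unitor, expressing it through
the pentagonator, the middle 2-unitor and naturality, which are available for the action. -/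
theorem leftUnit_eq (X N Z : B) :
    ((ass X (unit B) N ⊠ᵣ Z) ≫ ass X (unit B ⊠ N) Z) ◁
        (lComp X (ass (unit B) N Z) (lun (N ⊠ Z))).hom ≫
      (𝟙 _ ⊗≫ (pent X (unit B) N Z).hom ▷ (X ⊠ₗ lun (N ⊠ Z)) ⊗≫
        ass (X ⊠ unit B) N Z ◁ (midUnit X (N ⊠ Z)).hom ⊗≫ (assNat₁ (run X) N Z).inv ⊗≫
        ((rIso (midUnit X N) Z).inv ≫ (rComp (ass X (unit B) N) (X ⊠ₗ lun N) Z).hom) ▷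
          ass X N Z ⊗≫
        (ass X (unit B) N ⊠ᵣ Z) ◁ (assNat₂ X (lun N) Z).hom ⊗≫ 𝟙 _) =
    ((ass X (unit B) N ⊠ᵣ Z) ≫ ass X (unit B ⊠ N) Z) ◁ tLeft₂ X (leftUnit N Z).hom := by
  have h := leftUnit_aux (assNat₂ X (lun N) Z) _ (pent X (unit B) N Z) (midUnit X (N ⊠ Z))
    (assNat₁ (run X) N Z) ((rComp _ _ Z).symm ≪≫ rIso (midUnit X N) Z)
    (left_normalization X N Z)
  refine (congrArg (fun t => _ ◁ (lComp X _ _).hom ≫ t) h).trans ?_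
  rw [← whiskerLeft_comp, Iso.hom_inv_id_assoc, lIso_hom]

/-- The 2-cell of the action whose components are the images of the left 2-unitor. -/
def actLeftNorm (X N : B) (M : VArr V) :
    ((ass X (unit B) N ⋆₁ 𝟙 M) ≫ actAss X (unit B ⊠ N) M) ≫
        (𝟙 X ⋆₁ (actAss (unit B) N M ≫ actLun (N ⋆ M))) ⟶
      ((ass X (unit B) N ⋆₁ 𝟙 M) ≫ actAss X (unit B ⊠ N) M) ≫ (𝟙 X ⋆₁ lun N ⋆₁ 𝟙 M) :=
  _ ◁ (actLComp X (actAss (unit B) N M) (actLun (N ⋆ M))).hom ≫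
    (𝟙 _ ⊗≫ (actPent X (unit B) N M).hom ▷ (𝟙 X ⋆₁ actLun (N ⋆ M)) ⊗≫
      actAss (X ⊠ unit B) N M ◁ (actMidUnit X (N ⋆ M)).hom ⊗≫ (actAssNat₁ (run X) N M).inv ⊗≫
      ((actRIso (midUnit X N) M).inv ≫ (actRComp (ass X (unit B) N) (X ⊠ₗ lun N) M).hom) ▷
        actAss X N M ⊗≫
      (ass X (unit B) N ⋆₁ 𝟙 M) ◁ (actAssNat (𝟙 X) (lun N) (𝟙 M)).hom ⊗≫ 𝟙 _)

/-- The left 2-unitor of the action. -/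
def actLeftUnit (N : B) (M : VArr V) :
    actAss (unit B) N M ≫ actLun (N ⋆ M) ≅ lun N ⋆₁ 𝟙 M :=
  isoMk (leftUnit N M.src) (leftUnit N M.tgt) (by
    -- No axiom gives the compatibility directly. As in Kelly's redundancy argument, it is tested
    -- after acting by the unit object and precomposing with the equivalence `H`. There both
    -- components are those of `actLeftNorm`, which is already a 2-cell of `VArr V`.
    let H : (((unit B ⊠ unit B) ⊠ N) ⋆ M : VArr V) ⟶ _ :=
      (ass (unit B) (unit B) N ⋆₁ 𝟙 M) ≫ actAss (unit B) (unit B ⊠ N) M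
    have : IsIso (Ho.cls H.fst) := by
      change IsIso (Ho.cls (ass (unit B) (unit B) N ⊠ᵣ M.src ≫ ass (unit B) (unit B ⊠ N) M.src))
      rw [Ho.cls_comp, Ho.cls_tRight, Ho.cls_ass, Ho.cls_ass]
      infer_instance
    have key := comm_of_whiskerLeft H (l := tLeft₂ (unit B) (leftUnit N M.src).hom)
      (r := tLeft₂ (unit B) (leftUnit N M.tgt).hom) (actLeftNorm (unit B) N M) ?_ ?_
    · exact comm_of_unit_act (l := (leftUnit N M.src).hom) (r := (leftUnit N M.tgt).hom)
        ⟨_, _, key⟩ rfl rfl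
    · exact leftUnit_eq (unit B) N M.src
    · exact leftUnit_eq (unit B) N M.tgt)

end

end VArr
end MonBicat

/-! ### Whiskering by equivalences, and universal morphisms. -/

namespace MonBicat

open Sq MonoidalBicategory

section Whiskering

variable {B : Type u} [Bicategory.{w, v} B] {a b : B}

/-- Precomposition with an equivalence. -/
def precompEquiv (f : a ⟶ b) (g : b ⟶ a) (u : f ≫ g ≅ 𝟙 a) (c : g ≫ f ≅ 𝟙 b) (x : B) :
    (b ⟶ x) ≌ (a ⟶ x) :=
  CategoryTheory.Equivalence.mk (Bicategory.precomp x f) (Bicategory.precomp x g)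
    (NatIso.ofComponents (fun h => (λ_ h).symm ≪≫ whiskerRightIso c.symm h ≪≫ α_ g f h)
      fun {h k} θ => by
        have e : θ ≫ (λ_ k).inv ≫ c.inv ▷ k ≫ (α_ g f k).hom =
            ((λ_ h).inv ≫ c.inv ▷ h ≫ (α_ g f h).hom) ≫ g ◁ f ◁ θ := by
          simpa using congrArg (fun t => (λ_ h).inv ≫ t ≫ (α_ g f k).hom) (whisker_exchange c.inv θ)
        exact e)
    (NatIso.ofComponents (fun h => (α_ f g h).symm ≪≫ whiskerRightIso u h ≪≫ λ_ h)
      fun {h k} θ => by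
        have e : f ◁ g ◁ θ ≫ (α_ f g k).inv ≫ u.hom ▷ k ≫ (λ_ k).hom =
            ((α_ f g h).inv ≫ u.hom ▷ h ≫ (λ_ h).hom) ≫ θ := by
          simpa using congrArg (fun t => (α_ f g h).inv ≫ t ≫ (λ_ k).hom) (whisker_exchange u.hom θ)
        exact e)

/-- Postcomposition with an equivalence. -/
def postcompEquiv (f : a ⟶ b) (g : b ⟶ a) (u : f ≫ g ≅ 𝟙 a) (c : g ≫ f ≅ 𝟙 b) (x : B) :
    (x ⟶ a) ≌ (x ⟶ b) :=
  CategoryTheory.Equivalence.mk (Bicategory.postcomp x f) (Bicategory.postcomp x g)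
    (NatIso.ofComponents (fun h => (ρ_ h).symm ≪≫ whiskerLeftIso h u.symm ≪≫ (α_ h f g).symm)
      fun {h k} θ => by
        have e : θ ≫ (ρ_ k).inv ≫ k ◁ u.inv ≫ (α_ k f g).inv =
            ((ρ_ h).inv ≫ h ◁ u.inv ≫ (α_ h f g).inv) ≫ θ ▷ f ▷ g := by
          simpa using
            congrArg (fun t => (ρ_ h).inv ≫ t ≫ (α_ k f g).inv) (whisker_exchange θ u.inv).symm
        exact e)
    (NatIso.ofComponents (fun h => α_ h g f ≪≫ whiskerLeftIso h c ≪≫ ρ_ h)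
      fun {h k} θ => by
        have e : θ ▷ g ▷ f ≫ (α_ k g f).hom ≫ k ◁ c.hom ≫ (ρ_ k).hom =
            ((α_ h g f).hom ≫ h ◁ c.hom ≫ (ρ_ h).hom) ≫ θ := by
          simpa using
            congrArg (fun t => (α_ h g f).hom ≫ t ≫ (ρ_ k).hom) (whisker_exchange θ c.hom).symm
        exact e)

theorem Ho.exists_inverse (f : a ⟶ b) [IsIso (Ho.cls f)] :
    ∃ g : b ⟶ a, Nonempty (f ≫ g ≅ 𝟙 a) ∧ Nonempty (g ≫ f ≅ 𝟙 b) := by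
  obtain ⟨g, hg⟩ := Ho.cls_surjective (inv (Ho.cls f))
  exact ⟨g, Ho.cls_eq.1 (by rw [Ho.cls_comp, hg, IsIso.hom_inv_id, Ho.cls_id]),
    Ho.cls_eq.1 (by rw [Ho.cls_comp, hg, IsIso.inv_hom_id, Ho.cls_id])⟩

theorem whiskerLeft_bijective_of_isIso (f : a ⟶ b) [IsIso (Ho.cls f)] {c : B} (h k : b ⟶ c) :
    Function.Bijective (fun x : h ⟶ k => f ◁ x) := by
  obtain ⟨g, ⟨u⟩, ⟨c'⟩⟩ := Ho.exists_inverse f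
  exact (precompEquiv f g u c' c).fullyFaithfulFunctor.map_bijective h k

theorem whiskerRight_bijective_of_isIso (f : a ⟶ b) [IsIso (Ho.cls f)] {c : B} (h k : c ⟶ a) :
    Function.Bijective (fun x : h ⟶ k => x ▷ f) := by
  obtain ⟨g, ⟨u⟩, ⟨c'⟩⟩ := Ho.exists_inverse f
  exact (postcompEquiv f g u c' c).fullyFaithfulFunctor.map_bijective h k

end Whiskering

section Universal

open MonoidalCategory

variable {C : Type*} [Category C] [MonoidalCategory C] {A : C}

/-- The unit `Z ⟶ (Z ⊗ A) ⊗ A` induced by a coevaluation. -/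
def pairingUnit (c : 𝟙_ C ⟶ A ⊗ A) (Z : C) : Z ⟶ (Z ⊗ A) ⊗ A :=
  (ρ_ Z).inv ≫ Z ◁ c ≫ (α_ Z A A).inv

/-- The counit `(K ⊗ A) ⊗ A ⟶ K` induced by an evaluation. -/
def pairingCounit (s : A ⊗ A ⟶ 𝟙_ C) (K : C) : (K ⊗ A) ⊗ A ⟶ K :=
  (α_ K A A).hom ≫ K ◁ s ≫ (ρ_ K).hom

/-- The map `t` exhibits `N` as a representing object for maps out of `- ⊗ A` into `K`. -/
def IsUniversal (s : A ⊗ A ⟶ 𝟙_ C) (c : 𝟙_ C ⟶ A ⊗ A) {N K : C} (t : N ⊗ A ⟶ K) : Prop :=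
  ∃ d : K ⊗ A ⟶ N, pairingUnit c N ≫ t ▷ A ≫ d = 𝟙 N ∧ d ▷ A ≫ t = pairingCounit s K

variable {s : A ⊗ A ⟶ 𝟙_ C} {c : 𝟙_ C ⟶ A ⊗ A}

/-- One triangle identity for tensoring on the right with `A` as its own adjoint: the zig-zag at the
second variable, tensored with `Z`. -/
theorem IsPairing.pairingUnit_counit (h : IsPairing s c) (Z : C) :
    pairingUnit c Z ▷ A ≫ pairingCounit s (Z ⊗ A) = 𝟙 (Z ⊗ A) := by
  have := h.right
  calc _ = Z ◁ ((λ_ A).inv ≫ c ▷ A ≫ (α_ A A A).hom ≫ A ◁ s ≫ (ρ_ A).hom) := by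
        simp [pairingUnit, pairingCounit]
    _ = _ := by simp [this]

/-- With the unit object as target, the left unit constraint is the required `d`; the first equation
is then the zig-zag at the first variable. -/
theorem IsPairing.isUniversal (h : IsPairing s c) : IsUniversal s c s := by
  refine ⟨(λ_ A).hom, ?_, ?_⟩
  · simpa [pairingUnit] using h.left
  · simp [pairingCounit, ← MonoidalCategory.unitors_equal]

/-- The unit and the counit for `X ⊗ N` and `X ⊗ K` are those for `N` and `K` tensored with `X`, so
`X ◁ d` works after rebracketing. -/
theorem IsUniversal.tensor {N K : C} {t : N ⊗ A ⟶ K} (h : IsUniversal s c t) (X : C) :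
    IsUniversal s c ((α_ X N A).hom ≫ X ◁ t) := by
  obtain ⟨d, h₁, h₂⟩ := h
  refine ⟨(α_ X K A).hom ≫ X ◁ d, ?_, ?_⟩
  · calc _ = X ◁ (pairingUnit c N ≫ t ▷ A ≫ d) := by simp [pairingUnit]
      _ = _ := by simp [h₁]
  · calc _ = (α_ X K A).hom ▷ A ≫ (α_ X (K ⊗ A) A).hom ≫ X ◁ (d ▷ A ≫ t) := by simp
      _ = _ := by simp [h₂, pairingCounit]

end Universal
end MonBicat

/-! ### Universal 1-cells represent categories of 1-cells. -/

namespace MonBicat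

open Sq MonoidalBicategory

section Representing

variable {B : Type u} [Bicategory.{w, v} B] [MonoidalBicategory B] {A : B}

/-- Pseudonaturality of the inverse right unit constraint. -/
def runInvNat {X X' : B} (f : X ⟶ X') : Sq f (f ⊠ᵣ unit B) (runInv X) (runInv X') :=
  (MonoidalData.rUnit (B := B)).inv.naturality f

/-- Pseudonaturality of the inverse associativity constraint in the first variable. -/
def assInvNat₁ {X X' : B} (f : X ⟶ X') (Y Z : B) :
    Sq (f ⊠ᵣ (Y ⊠ Z)) ((f ⊠ᵣ Y) ⊠ᵣ Z) (assInv X Y Z) (assInv X' Y Z) :=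
  Sq.precomp (tIso (Iso.refl f) (tId Y Z).symm)
    ((MonoidalData.assoc (B := B)).inv.naturality (a := ((X, Y), Z)) (b := ((X', Y), Z))
      ((f ×ₘ 𝟙 Y) ×ₘ 𝟙 Z))

variable (c : unit B ⟶ A ⊠ A) (s : A ⊠ A ⟶ unit B)

/-- The 1-cell `Z ⟶ (Z ⊗ A) ⊗ A` induced by a coevaluation. -/
abbrev dualUnit (Z : B) : Z ⟶ (Z ⊠ A) ⊠ A := runInv Z ≫ Z ⊠ₗ c ≫ assInv Z A A

/-- The 1-cell `(K ⊗ A) ⊗ A ⟶ K` induced by an evaluation. -/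
abbrev dualCounit (K : B) : (K ⊠ A) ⊠ A ⟶ K := ass K A A ≫ K ⊠ₗ s ≫ run K

/-- Pseudonaturality of `dualUnit`. -/
def dualUnitNat {X X' : B} (f : X ⟶ X') : Sq f ((f ⊠ᵣ A) ⊠ᵣ A) (dualUnit c X) (dualUnit c X') :=
  (runInvNat f).paste (Sq.paste (f := f ⊠ᵣ unit B) (p := X ⊠ₗ c) (q := X' ⊠ₗ c)
    (interchange f c) (assInvNat₁ f A A))

/-- Pseudonaturality of `dualCounit`. -/
def dualCounitNat {X X' : B} (f : X ⟶ X') :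
    Sq ((f ⊠ᵣ A) ⊠ᵣ A) f (dualCounit s X) (dualCounit s X') :=
  Sq.paste (f := (f ⊠ᵣ A) ⊠ᵣ A) (p := ass X A A) (q := ass X' A A) (assNat₁ f A A)
    (Sq.paste (f := f ⊠ᵣ (A ⊠ A)) (p := X ⊠ₗ s) (q := X' ⊠ₗ s) (interchange f s) (runNat f))

variable {X X' : B} {f g : X ⟶ X'} (θ : f ⟶ g)

theorem cyl_interchange {Y Y' : B} (h : Y ⟶ Y') :
    Cyl (f := f ⊠ᵣ Y) (g := f ⊠ᵣ Y') (p := X ⊠ₗ h) (q := X' ⊠ₗ h) (interchange f h)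
      (interchange g h) (tRight₂ θ Y) (tRight₂ θ Y') :=
  Cyl.tSq (cyl_idSq θ) (Cyl.refl _)

theorem cyl_assNat₁ (Y Z : B) :
    Cyl (f := (f ⊠ᵣ Y) ⊠ᵣ Z) (g := f ⊠ᵣ (Y ⊠ Z)) (assNat₁ f Y Z) (assNat₁ g Y Z)
      (tRight₂ (tRight₂ θ Y) Z) (tRight₂ θ (Y ⊠ Z)) := by
  have h := cyl_assNat θ (𝟙 (𝟙 Y)) (𝟙 (𝟙 Z))
  have e : (θ ⊠₂ 𝟙 (𝟙 Y) ⊠₂ 𝟙 (𝟙 Z)) ≫ (tIso (Iso.refl g) (tId Y Z)).hom =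
      (tIso (Iso.refl f) (tId Y Z)).hom ≫ tRight₂ θ (Y ⊠ Z) := by
    simp [tIso_hom, ← tHom₂_comp]
  simp only [Cyl, assNat₁, Iso.trans_hom, whiskerLeftIso_hom, Category.assoc] at h ⊢
  rw [reassoc_of% h, ← whiskerLeft_comp, e, whiskerLeft_comp]

theorem cyl_runNat : Cyl (runNat f) (runNat g) (tRight₂ θ (unit B)) θ :=
  (MonoidalData.rUnit (B := B)).hom.naturality_naturality θ

theorem cyl_dualUnitNat : Cyl (dualUnitNat c f) (dualUnitNat c g) θ (tRight₂ (tRight₂ θ A) A) := by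
  have h₁ : Cyl (runInvNat f) (runInvNat g) θ (tRight₂ θ (unit B)) :=
    (MonoidalData.rUnit (B := B)).inv.naturality_naturality θ
  have h₂ : Cyl (assInvNat₁ f A A) (assInvNat₁ g A A) (tRight₂ θ (A ⊠ A))
      (tRight₂ (tRight₂ θ A) A) := by
    apply Cyl.precomp
    have h := (MonoidalData.assoc (B := B)).inv.naturality_naturality (a := ((X, A), A))
      (b := ((X', A), A)) (f := (f ×ₘ 𝟙 A) ×ₘ 𝟙 A) (g := (g ×ₘ 𝟙 A) ×ₘ 𝟙 A)
      ((θ ×ₘ 𝟙 (𝟙 A)) ×ₘ 𝟙 (𝟙 A))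
    refine Cyl.congr (l := θ ⊠₂ 𝟙 (𝟙 A) ⊠₂ 𝟙 (𝟙 A)) h ?_ rfl
    simp [tIso_hom, tIso_inv, ← tHom₂_comp]
  exact h₁.paste ((cyl_interchange θ c).paste h₂)

theorem cyl_dualCounitNat :
    Cyl (dualCounitNat s f) (dualCounitNat s g) (tRight₂ (tRight₂ θ A) A) θ :=
  (cyl_assNat₁ θ A A).paste ((cyl_interchange θ s).paste (cyl_runNat θ))

variable {c s}

/-- Naturality of the unit of `representingEquiv`: the 2-cell is first slid along `dualUnit` by `h`,
then exchanged with `e`. -/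
theorem representing_unit_aux {C : Type u} [Bicategory.{w, v} C] {z n x y k : C} {f g : z ⟶ n}
    (ψ : f ⟶ g) {U : z ⟶ x} {U' : n ⟶ y} {F G : x ⟶ y} (ψ' : F ⟶ G) {t : y ⟶ k} {d : k ⟶ n}
    {Ft Gt : x ⟶ k} (rf : Ft ≅ F ≫ t) (rg : Gt ≅ G ≫ t) (nf : f ≫ U' ≅ U ≫ F) (ng : g ≫ U' ≅ U ≫ G)
    (e : U' ≫ t ≫ d ≅ 𝟙 n) (h : ψ ▷ U' ≫ ng.hom = nf.hom ≫ U ◁ ψ') :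
    U ◁ (rf.hom ≫ ψ' ▷ t ≫ rg.inv) ▷ d ≫ U ◁ (rg.hom ▷ d ≫ (α_ G t d).hom) ≫ (α_ U G _).inv ≫
        ng.inv ▷ (t ≫ d) ≫ (α_ g U' _).hom ≫ g ◁ e.hom ≫ (ρ_ g).hom =
      (U ◁ (rf.hom ▷ d ≫ (α_ F t d).hom) ≫ (α_ U F _).inv ≫ nf.inv ▷ (t ≫ d) ≫
        (α_ f U' _).hom ≫ f ◁ e.hom ≫ (ρ_ f).hom) ≫ ψ := by
  have h' : U ◁ ψ' ≫ ng.inv = nf.inv ≫ ψ ▷ U' := by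
    rw [Iso.eq_inv_comp, ← reassoc_of% h, Iso.hom_inv_id, Category.comp_id]
  calc _ = U ◁ rf.hom ▷ d ⊗≫ (U ◁ ψ' ≫ ng.inv) ▷ (t ≫ d) ⊗≫ g ◁ e.hom ⊗≫ 𝟙 _ := by
        simp [bicategoricalComp]
    _ = U ◁ rf.hom ▷ d ⊗≫ nf.inv ▷ (t ≫ d) ⊗≫ (ψ ▷ (U' ≫ t ≫ d) ≫ g ◁ e.hom) ⊗≫ 𝟙 _ := by
        rw [h']
        simp [bicategoricalComp]
    _ = _ := by
        rw [← whisker_exchange]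
        simp [bicategoricalComp]

/-- Naturality of the counit of `representingEquiv`: the 2-cell is exchanged with `e`, slid along
`dualCounit` by `h`, and exchanged with `i`. -/
theorem representing_counit_aux {C : Type u} [Bicategory.{w, v} C] {z k x y n : C} {f g : z ⟶ k}
    (ψ : f ⟶ g) {U : z ⟶ x} {W : x ⟶ z} {W' : y ⟶ k} {F G : x ⟶ y} (ψ' : F ⟶ G) {d : y ⟶ n}
    {t : n ⟶ k} (e : d ≫ t ≅ W') (nf : F ≫ W' ≅ W ≫ f) (ng : G ≫ W' ≅ W ≫ g)
    (i : U ≫ W ≅ 𝟙 z) {Ft Gt : z ⟶ n} (rf : Ft ≅ U ≫ F ≫ d) (rg : Gt ≅ U ≫ G ≫ d)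
    (h : ψ' ▷ W' ≫ ng.hom = nf.hom ≫ W ◁ ψ) :
    (rf.hom ≫ U ◁ ψ' ▷ d ≫ rg.inv) ▷ t ≫ rg.hom ▷ t ≫ (α_ U _ t).hom ≫
        U ◁ ((α_ G d t).hom ≫ G ◁ e.hom ≫ ng.hom) ≫ (α_ U W g).inv ≫ i.hom ▷ g ≫ (λ_ g).hom =
      (rf.hom ▷ t ≫ (α_ U _ t).hom ≫ U ◁ ((α_ F d t).hom ≫ F ◁ e.hom ≫ nf.hom) ≫
        (α_ U W f).inv ≫ i.hom ▷ f ≫ (λ_ f).hom) ≫ ψ := by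
  calc _ = rf.hom ▷ t ⊗≫ U ◁ (ψ' ▷ (d ≫ t) ≫ G ◁ e.hom) ⊗≫ U ◁ ng.hom ⊗≫ i.hom ▷ g ⊗≫ 𝟙 _ := by
        simp [bicategoricalComp]
    _ = rf.hom ▷ t ⊗≫ U ◁ F ◁ e.hom ⊗≫ U ◁ (ψ' ▷ W' ≫ ng.hom) ⊗≫ i.hom ▷ g ⊗≫ 𝟙 _ := by
        rw [← whisker_exchange]
        simp [bicategoricalComp]
    _ = rf.hom ▷ t ⊗≫ U ◁ F ◁ e.hom ⊗≫ U ◁ nf.hom ⊗≫ ((U ≫ W) ◁ ψ ≫ i.hom ▷ g) ⊗≫ 𝟙 _ := by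
        rw [h]
        simp [bicategoricalComp]
    _ = _ := by
        rw [whisker_exchange]
        simp [bicategoricalComp]

/-- A universal 1-cell `t : N ⊗ A ⟶ K` induces equivalences of categories of 1-cells. -/
def representingEquiv {N K : B} (t : N ⊠ A ⟶ K) (d : K ⊠ A ⟶ N)
    (e : dualUnit c N ≫ t ⊠ᵣ A ≫ d ≅ 𝟙 N) (e' : d ⊠ᵣ A ≫ t ≅ dualCounit s K) (Z : B)
    (z : dualUnit c Z ⊠ᵣ A ≫ dualCounit s (Z ⊠ A) ≅ 𝟙 (Z ⊠ A)) : (Z ⟶ N) ≌ (Z ⊠ A ⟶ K) :=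
  CategoryTheory.Equivalence.mk
    { obj f := f ⊠ᵣ A ≫ t
      map ψ := tRight₂ ψ A ▷ t
      map_comp ψ χ := by rw [tRight₂_comp, comp_whiskerRight] }
    { obj h := dualUnit c Z ≫ h ⊠ᵣ A ≫ d
      map ψ := dualUnit c Z ◁ (tRight₂ ψ A ▷ d)
      map_comp ψ χ := by rw [tRight₂_comp, comp_whiskerRight, whiskerLeft_comp] }
    (Iso.symm <| NatIso.ofComponents (fun f =>
      whiskerLeftIso _ (whiskerRightIso (rComp (f ⊠ᵣ A) t A) d ≪≫ α_ _ _ _) ≪≫ (α_ _ _ _).symm ≪≫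
        whiskerRightIso (dualUnitNat c f).symm _ ≪≫ α_ _ _ _ ≪≫ whiskerLeftIso f e ≪≫ ρ_ f) (by
      intro f g ψ
      have key := representing_unit_aux ψ (tRight₂ (tRight₂ ψ A) A) (rComp (f ⊠ᵣ A) t A)
        (rComp (g ⊠ᵣ A) t A) (dualUnitNat c f) (dualUnitNat c g) e (cyl_dualUnitNat c ψ)
      rw [← tRight₂_whiskerRight] at key
      exact key))
    (NatIso.ofComponents (fun h =>
      whiskerRightIso (rComp₃ (dualUnit c Z) (h ⊠ᵣ A) d A) t ≪≫ α_ _ _ _ ≪≫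
        whiskerLeftIso _ (α_ _ _ _ ≪≫ whiskerLeftIso _ e' ≪≫ dualCounitNat s h) ≪≫
        (α_ _ _ _).symm ≪≫ whiskerRightIso z h ≪≫ λ_ h) (by
      intro f g ψ
      have key := representing_counit_aux ψ (tRight₂ (tRight₂ ψ A) A) e' (dualCounitNat s f)
        (dualCounitNat s g) z (rComp₃ (dualUnit c Z) (f ⊠ᵣ A) d A)
        (rComp₃ (dualUnit c Z) (g ⊠ᵣ A) d A) (cyl_dualCounitNat s ψ)
      have e₁ : tRight₂ (dualUnit c Z ◁ (tRight₂ ψ A ▷ d)) A =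
          (rComp₃ (dualUnit c Z) (f ⊠ᵣ A) d A).hom ≫
            (dualUnit c Z ⊠ᵣ A) ◁ (tRight₂ (tRight₂ ψ A) A ▷ (d ⊠ᵣ A)) ≫
            (rComp₃ (dualUnit c Z) (g ⊠ᵣ A) d A).inv := by
        rw [tRight₂_whiskerLeft, tRight₂_whiskerRight]
        simp [rComp₃]
      rw [← e₁] at key
      exact key))

/-- A universal 1-cell tests equality and existence of 2-cells. -/
theorem universal_bijective (hp : IsPairing (C := Ho B) (X := ⟨A⟩) (Y := ⟨A⟩) (Ho.cls s) (Ho.cls c))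
    {N K : B} {t : N ⊠ A ⟶ K} (ht : IsUniversal (C := Ho B) (A := ⟨A⟩) (N := ⟨N⟩) (K := ⟨K⟩)
      (Ho.cls s) (Ho.cls c) (Ho.cls t)) {Z : B} (f g : Z ⟶ N) :
    Function.Bijective (fun ψ : f ⟶ g => tRight₂ ψ A ▷ t) := by
  obtain ⟨d', h₁, h₂⟩ := ht
  obtain ⟨d, rfl⟩ := Ho.cls_surjective d'
  -- The equations in `Ho B` yield arbitrary isomorphisms. That suffices: naturality is automatic,
  -- and an equivalence of categories can be corrected to an adjoint one, so the functor is fully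
  -- faithful.
  exact (representingEquiv t d
    (Ho.cls_eq.1 h₁).some (Ho.cls_eq.1 h₂).some Z
    (Ho.cls_eq.1 (hp.pairingUnit_counit ⟨Z⟩)).some).fullyFaithfulFunctor.map_bijective f g

/-- Tensoring with the unit object is full on 2-cells. -/
theorem tRight₂_unit_surjective {X X' : B} {f g : X ⟶ X'} (y : f ⊠ᵣ unit B ⟶ g ⊠ᵣ unit B) :
    ∃ θ : f ⟶ g, tRight₂ θ (unit B) = y := by
  have (X : B) : IsIso (Ho.cls (run X)) := by
    rw [Ho.cls_run]
    infer_instance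
  obtain ⟨θ, hθ⟩ := (whiskerLeft_bijective_of_isIso (run X) f g).2
    ((runNat f).inv ≫ y ▷ run X' ≫ (runNat g).hom)
  refine ⟨θ, (whiskerRight_bijective_of_isIso (run X') _ _).1 ?_⟩
  have h : _ = _ := cyl_runNat θ
  dsimp only at hθ ⊢
  rw [← cancel_mono (runNat g).hom, h, hθ]
  simp

end Representing
end MonBicat

/-! ### Algebras over a pseudomonoid and their morphisms. -/

namespace MonBicat

open Sq MonoidalBicategory VArr

section Pentagon

variable {C : Type u} [Bicategory.{w, v} C]

/-- The diagrammatic manipulation turning the pentagon axiom into a compatibility of squares. -/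
theorem cyl_mul_aux {x x₁ x₂ x₃ x₄ y y₃ y₃' z : C} {m : y ⟶ z} {mr : y₃ ⟶ y} {mrr : x ⟶ y₃}
    {a : y₃ ⟶ y₃'} {ml : y₃' ⟶ y} {aR : x ⟶ x₁} {mlR : x₁ ⟶ y₃} {b : x₁ ⟶ x₂} {lr : x₂ ⟶ y₃'}
    {la : x₂ ⟶ x₃} {mll : x₃ ⟶ y₃'} {c : x ⟶ x₄} {d : x₄ ⟶ x₃} {mr' : x₄ ⟶ y₃'} {ml' : x₄ ⟶ y₃}
    (t : mr ≫ m ≅ a ≫ ml ≫ m) (n₂ : Sq mlR lr b a) (P : Sq aR d c (b ≫ la)) (n₁ : Sq mrr mr' c a)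
    (I : Sq mr' mr ml' ml) (n₃ : ml' ≫ a ≅ d ≫ mll) {u u' : x ⟶ y} {w : x ⟶ y₃} {v : x₂ ⟶ y₃'}
    (tasc : u ⟶ u') (rc : u ≅ mrr ≫ mr) (rc₁ : u' ≅ w ≫ mr) (rc₂ : w ≅ aR ≫ mlR)
    (tl : Sq lr ml v ml) (lc : v ≅ la ≫ mll) {K₁ : mrr ≫ mr ⟶ aR ≫ mlR ≫ mr}
    {K₂ : lr ≫ ml ⟶ la ≫ mll ≫ ml}
    (h₁ : tasc ≫ rc₁.hom ≫ rc₂.hom ▷ mr = rc.hom ≫ K₁ ≫ (α_ _ _ _).inv)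
    (h₂ : tl.hom ≫ lc.hom ▷ ml = K₂ ≫ (α_ _ _ _).inv)
    (h : K₁ ▷ m ⊗≫ (aR ≫ mlR) ◁ t.hom ⊗≫ aR ◁ n₂.hom ▷ (ml ≫ m) ⊗≫ (aR ≫ b) ◁ K₂ ▷ m ⊗≫
        P.hom ▷ (mll ≫ ml ≫ m) =
      𝟙 _ ⊗≫ mrr ◁ t.hom ⊗≫ n₁.hom ▷ (ml ≫ m) ⊗≫ c ◁ I.hom ▷ m ⊗≫ (c ≫ ml') ◁ t.hom ⊗≫
        c ◁ n₃.hom ▷ (ml ≫ m) ⊗≫ 𝟙 _) :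
    Cyl (((n₁.paste I).vcomp (t ≪≫ (α_ _ _ _).symm)).precomp rc)
      (Sq.precomp rc₁ (Sq.vcomp (Sq.precomp rc₂ (Sq.vcomp
        (Sq.cast (Iso.refl _) (α_ b la mll ≪≫ whiskerLeftIso b lc.symm) (P.paste n₃.symm))
        (n₂.paste tl))) (t ≪≫ (α_ _ _ _).symm))) tasc (t ≪≫ (α_ _ _ _).symm).hom := by
  simp only [Cyl]
  calc _ = (tasc ≫ rc₁.hom) ▷ m ⊗≫ (w ◁ t.hom ≫ rc₂.hom ▷ (a ≫ ml ≫ m)) ⊗≫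
        aR ◁ n₂.hom ▷ (ml ≫ m) ⊗≫ (aR ≫ b) ◁ (tl.hom ≫ lc.hom ▷ ml) ▷ m ⊗≫
        P.hom ▷ (mll ≫ ml ≫ m) ⊗≫ c ◁ n₃.inv ▷ (ml ≫ m) ⊗≫ 𝟙 _ := by
        simp only [Sq.precomp, vcomp, Sq.cast, Sq.paste, Iso.trans_hom, Iso.symm_hom,
          whiskerLeftIso_hom, whiskerRightIso_hom, Iso.refl_hom, Iso.trans_inv, Iso.symm_inv,
          whiskerLeftIso_inv]
        bicategory
    _ = (tasc ≫ rc₁.hom ≫ rc₂.hom ▷ mr) ▷ m ⊗≫ (aR ≫ mlR) ◁ t.hom ⊗≫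
        aR ◁ n₂.hom ▷ (ml ≫ m) ⊗≫ (aR ≫ b) ◁ (tl.hom ≫ lc.hom ▷ ml) ▷ m ⊗≫
        P.hom ▷ (mll ≫ ml ≫ m) ⊗≫ c ◁ n₃.inv ▷ (ml ≫ m) ⊗≫ 𝟙 _ := by
        rw [whisker_exchange]
        bicategory
    _ = rc.hom ▷ m ⊗≫ (K₁ ▷ m ⊗≫ (aR ≫ mlR) ◁ t.hom ⊗≫ aR ◁ n₂.hom ▷ (ml ≫ m) ⊗≫
        (aR ≫ b) ◁ K₂ ▷ m ⊗≫ P.hom ▷ (mll ≫ ml ≫ m)) ⊗≫ c ◁ n₃.inv ▷ (ml ≫ m) ⊗≫ 𝟙 _ := by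
        rw [h₁, h₂]
        bicategory
    _ = rc.hom ▷ m ⊗≫ mrr ◁ t.hom ⊗≫ n₁.hom ▷ (ml ≫ m) ⊗≫ c ◁ I.hom ▷ m ⊗≫ (c ≫ ml') ◁ t.hom ⊗≫
        c ◁ (n₃.hom ≫ n₃.inv) ▷ (ml ≫ m) ⊗≫ 𝟙 _ := by
        rw [h]
        simp [bicategoricalComp]
    _ = _ := by
        rw [Iso.hom_inv_id]
        simp [Sq.precomp, vcomp, Sq.paste, bicategoricalComp]

end Pentagon

section Algebras

variable {B : Type u} [Bicategory.{w, v} B] [MonoidalBicategory B] {A : B}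

/-- The multiplication of a pseudomonoid, as an object of `VArr A`. -/
abbrev Pseudomonoid.arr (M : Pseudomonoid A) : VArr A := ⟨A, A, M.mul⟩

/-- A 1-cell `N ⊗ A ⟶ N` with an associativity 2-cell. -/
structure Alg (M : Pseudomonoid A) where
  /-- The underlying object. -/
  carrier : B
  /-- The action of `A`. -/
  act : carrier ⊠ A ⟶ carrier
  /-- The associativity of the action. -/
  asc : Sq (act ⊠ᵣ A) act (ass carrier A A ≫ carrier ⊠ₗ M.mul) act

variable {M : Pseudomonoid A}

/-- The action, as an object of `VArr A`. -/
abbrev Alg.arr (N : Alg M) : VArr A := ⟨N.carrier, N.carrier, N.act⟩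

/-- The associativity of the action, as a 1-cell of `VArr A`. -/
abbrev Alg.ascHom (N : Alg M) : N.carrier ⋆ M.arr ⟶ N.arr := ⟨N.act, N.act, N.asc⟩

/-- A morphism of algebras up to an invertible 2-cell. -/
structure AlgMap (N N' : Alg M) where
  /-- The underlying 1-cell. -/
  hom : N.carrier ⟶ N'.carrier
  /-- The compatibility with the actions. -/
  sq : Sq (hom ⊠ᵣ A) hom N.act N'.act
  /-- The compatibility with associativity. -/
  comm : Cyl ((hom ⋆₁ 𝟙 M.arr) ≫ N'.ascHom).sq
    (N.ascHom ≫ (⟨hom, hom, sq⟩ : N.arr ⟶ N'.arr)).sq (tRight₂ sq.hom A) sq.hom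

namespace AlgMap

variable {N N' N'' : Alg M} {X X' Y : B}

/-- The 1-cell of `VArr A` underlying a morphism of algebras. -/
abbrev arr (f : AlgMap N N') : N.arr ⟶ N'.arr := ⟨f.hom, f.hom, f.sq⟩

/-- The compatibility with associativity, as a 2-cell of `VArr A`. -/
def ascNat (f : AlgMap N N') : (f.hom ⋆₁ 𝟙 M.arr) ≫ N'.ascHom ≅ N.ascHom ≫ f.arr :=
  isoMk f.sq f.sq f.comm

/-- Construction of a morphism of algebras from a 2-cell of `VArr A`. -/
abbrev ofHom₂ (hom : N.carrier ⟶ N'.carrier) (sq : Sq (hom ⊠ᵣ A) hom N.act N'.act)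
    (η : (hom ⋆₁ 𝟙 M.arr) ≫ N'.ascHom ⟶ N.ascHom ≫ (⟨hom, hom, sq⟩ : N.arr ⟶ N'.arr))
    (hl : η.l = sq.hom) (hr : η.r = sq.hom) : AlgMap N N' :=
  ⟨hom, sq, η.comm.congr (congrArg (fun t => tRight₂ t A) hl.symm) hr.symm⟩

/-- The identity of an algebra. -/
def id (N : Alg M) : AlgMap N N :=
  ofHom₂ (𝟙 _) (𝟙 N.arr : N.arr ⟶ N.arr).sq
    ((actId N.carrier M.arr).hom ▷ N.ascHom ≫ (λ_ _).hom ≫ (ρ_ N.ascHom).inv) rfl rfl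

/-- The compatibility of a composite with associativity. -/
abbrev compHom₂ (f : AlgMap N N') (g : AlgMap N' N'') :
    ((f.hom ≫ g.hom) ⋆₁ 𝟙 M.arr) ≫ N''.ascHom ⟶ N.ascHom ≫ f.arr ≫ g.arr :=
  (actRComp f.hom g.hom M.arr).hom ▷ N''.ascHom ≫ (α_ _ _ _).hom ≫
    (f.hom ⋆₁ 𝟙 M.arr) ◁ g.ascNat.hom ≫ (α_ _ _ _).inv ≫ f.ascNat.hom ▷ g.arr ≫ (α_ _ _ _).hom

/-- Composition of morphisms of algebras. -/
def comp (f : AlgMap N N') (g : AlgMap N' N'') : AlgMap N N'' :=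
  have e : (f.arr ≫ g.arr).sq.hom = (rComp f.hom g.hom A).hom ▷ N''.act ≫ (α_ _ _ _).hom ≫
      (f.hom ⊠ᵣ A) ◁ g.sq.hom ≫ (α_ _ _ _).inv ≫ f.sq.hom ▷ g.hom ≫ (α_ _ _ _).hom := by
    simp [comp_sq, Sq.precomp, vcomp]
  ofHom₂ (f.hom ≫ g.hom) (f.arr ≫ g.arr).sq (compHom₂ f g) e.symm e.symm

end AlgMap

namespace Alg

/-- A pseudomonoid as an algebra over itself. -/
abbrev self (M : Pseudomonoid A) : Alg M := ⟨A, M.mul, M.α ≪≫ (α_ _ _ _).symm⟩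

/-- The tensor product of an object with an algebra. -/
abbrev tensor (X : B) (N : Alg M) : Alg M :=
  ⟨X ⊠ N.carrier, ass X N.carrier A ≫ X ⊠ₗ N.act,
    (actAss X N.carrier M.arr ≫ (𝟙 X ⋆₁ N.ascHom)).sq⟩

end Alg

namespace AlgMap

variable {N N' N'' : Alg M} {X X' Y : B}

/-- The compatibility of a tensor product with associativity. -/
abbrev tensorHom₂ (k : X ⟶ X') (f : AlgMap N N') :
    ((k ⊠₁ f.hom) ⋆₁ 𝟙 M.arr) ≫ actAss X' N'.carrier M.arr ≫ (𝟙 X' ⋆₁ N'.ascHom) ⟶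
      (actAss X N.carrier M.arr ≫ (𝟙 X ⋆₁ N.ascHom)) ≫ (k ⋆₁ f.arr) :=
  (α_ _ _ _).inv ≫ (actAssNat k f.hom (𝟙 M.arr)).hom ▷ (𝟙 X' ⋆₁ N'.ascHom) ≫
    (α_ _ _ _).hom ≫ actAss X N.carrier M.arr ◁ ((actComp _ _ _ _).inv ≫
      (actIso (idSq k) f.ascNat).hom ≫ (actComp _ _ _ _).hom) ≫ (α_ _ _ _).inv

/-- The tensor product of a 1-cell with a morphism of algebras. -/
def tensorMap (k : X ⟶ X') (f : AlgMap N N') : AlgMap (N.tensor X) (N'.tensor X') :=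
  have e : (k ⋆₁ f.arr).sq.hom = (α_ _ _ _).inv ≫ (assNat k f.hom (𝟙 A)).hom ▷ (𝟙 X' ⊠₁ N'.act) ≫
      (α_ _ _ _).hom ≫ ass X N.carrier A ◁ (tSq (idSq k) f.sq).hom ≫ (α_ _ _ _).inv := by
    simp [Sq.paste]
  ofHom₂ (k ⊠₁ f.hom) (k ⋆₁ f.arr).sq (tensorHom₂ k f) e.symm e.symm

/-- The compatibility of the associativity constraint with associativity of algebras. -/
abbrev assHom₂ (X Y : B) (N : Alg M) :
    (ass X Y N.carrier ⋆₁ 𝟙 M.arr) ≫ actAss X (Y ⊠ N.carrier) M.arr ≫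
        (𝟙 X ⋆₁ (actAss Y N.carrier M.arr ≫ (𝟙 Y ⋆₁ N.ascHom))) ⟶
      (actAss (X ⊠ Y) N.carrier M.arr ≫ (𝟙 (X ⊠ Y) ⋆₁ N.ascHom)) ≫ actAss X Y N.arr :=
  𝟙 _ ⊗≫ ((ass X Y N.carrier ⋆₁ 𝟙 M.arr) ≫ actAss X (Y ⊠ N.carrier) M.arr) ◁
      (actLComp X (actAss Y N.carrier M.arr) (𝟙 Y ⋆₁ N.ascHom)).hom ⊗≫
    (actPent X Y N.carrier M.arr).hom ▷ (𝟙 X ⋆₁ 𝟙 Y ⋆₁ N.ascHom) ⊗≫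
    actAss (X ⊠ Y) N.carrier M.arr ◁ ((actAssNat (𝟙 X) (𝟙 Y) N.ascHom).inv ≫
      (actIso (tId X Y) (Iso.refl N.ascHom)).hom ▷ actAss X Y N.arr) ⊗≫ 𝟙 _

/-- This matches the square carried by the associativity constraint with the pasting in `assHom₂`,
so both components of that 2-cell are the square itself. -/
theorem actAss_sq_hom (X Y : B) (N : Alg M) : (actAss X Y N.arr).sq.hom =
    𝟙 _ ⊗≫ ((ass X Y N.carrier ⊠ᵣ A) ≫ ass X (Y ⊠ N.carrier) A) ◁
        (lComp X (ass Y N.carrier A) (Y ⊠ₗ N.act)).hom ⊗≫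
      (pent X Y N.carrier A).hom ▷ (X ⊠ₗ Y ⊠ₗ N.act) ⊗≫
      ass (X ⊠ Y) N.carrier A ◁ ((assNat (𝟙 X) (𝟙 Y) N.act).inv ≫
        (tIso (tId X Y) (Iso.refl N.act)).hom ▷ ass X Y N.carrier) ⊗≫ 𝟙 _ := by
  simp [Sq.cast, Sq.paste, assNat₃, bicategoricalComp, tIso_hom, tIso_inv]

/-- The associativity constraint as a morphism of algebras. -/
def assMap (X Y : B) (N : Alg M) : AlgMap (N.tensor (X ⊠ Y)) ((N.tensor Y).tensor X) :=
  ofHom₂ (ass X Y N.carrier) (actAss X Y N.arr).sq (assHom₂ X Y N) (actAss_sq_hom X Y N).symm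
    (actAss_sq_hom X Y N).symm

/-- The compatibility of the left unit constraint with associativity of algebras. -/
abbrev lunHom₂ (N : Alg M) :
    (lun N.carrier ⋆₁ 𝟙 M.arr) ≫ N.ascHom ⟶
      (actAss (unit B) N.carrier M.arr ≫ (𝟙 (unit B) ⋆₁ N.ascHom)) ≫ actLun N.arr :=
  (actLeftUnit N.carrier M.arr).inv ▷ N.ascHom ≫ (α_ _ _ _).hom ≫
    actAss (unit B) N.carrier M.arr ◁ (actLunNat N.ascHom).inv ≫ (α_ _ _ _).inv

theorem actLun_sq_hom (N : Alg M) : (actLun N.arr).sq.hom =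
    (leftUnit N.carrier A).inv ▷ N.act ≫ (α_ _ _ _).hom ≫
      ass (unit B) N.carrier A ◁ (lunNat N.act).inv ≫ (α_ _ _ _).inv := by
  simp [Sq.cast, Sq.paste]

/-- The left unit constraint as a morphism of algebras. -/
def lunMap (N : Alg M) : AlgMap (N.tensor (unit B)) N :=
  ofHom₂ (lun N.carrier) (actLun N.arr).sq (lunHom₂ N) (actLun_sq_hom N).symm
    (actLun_sq_hom N).symm

/-- The multiplication as a morphism of algebras. -/
def mulMap (M : Pseudomonoid A) : AlgMap ((Alg.self M).tensor A) (Alg.self M) :=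
  ⟨M.mul, (Alg.self M).asc, by
    have h₁ : tRight₂ (Alg.self M).asc.hom A ≫ (rComp (ass A A A ≫ A ⊠ₗ M.mul) M.mul A).hom ≫
        (rComp (ass A A A) (A ⊠ₗ M.mul) A).hom ▷ (M.mul ⊠ᵣ A) =
        (rComp (M.mul ⊠ᵣ A) M.mul A).hom ≫ ((rComp (M.mul ⊠ᵣ A) M.mul A).inv ≫ (rIso M.α A).hom ≫
          (rComp₃ (ass A A A) (A ⊠ₗ M.mul) M.mul A).hom) ≫ (α_ _ _ _).inv := by
      have e := tRight₂_associator (ass A A A) (A ⊠ₗ M.mul) M.mul A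
      rw [← rIso_hom] at e
      have e' : tRight₂ (Alg.self M).asc.hom A = (rIso M.α A).hom ≫ (rIso (α_ _ _ _) A).inv :=
        tRight₂_comp _ _ _
      have e'' := congrArg Iso.inv (Iso.ext (α := rIso (α_ _ _ _) A) (β := rComp _ _ _ ≪≫
        whiskerRightIso (rComp _ _ A) _ ≪≫ α_ _ _ _ ≪≫ whiskerLeftIso _ (rComp _ _ A).symm ≪≫
        (rComp _ _ A).symm) e)
      rw [e', e'']
      simp [rComp₃]
    have h₂ : (tSq (idSq (𝟙 A)) (Alg.self M).asc).hom ≫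
        (lComp A (ass A A A) (A ⊠ₗ M.mul)).hom ▷ (A ⊠ₗ M.mul) =
        ((lComp A (M.mul ⊠ᵣ A) M.mul).inv ≫ (lIso A M.α).hom ≫
          (lComp₃ A (ass A A A) (A ⊠ₗ M.mul) M.mul).hom) ≫ (α_ _ _ _).inv := by
      have e := tLeft₂_associator A (ass A A A) (A ⊠ₗ M.mul) M.mul
      rw [← lIso_hom] at e
      have e' : (lIso A (Alg.self M).asc).hom = (lIso A M.α).hom ≫ (lIso A (α_ _ _ _)).inv :=
        tLeft₂_comp _ _ _
      have e'' := congrArg Iso.inv (Iso.ext (α := lIso A (α_ _ _ _)) (β := lComp _ _ _ ≪≫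
        whiskerRightIso (lComp A _ _) _ ≪≫ α_ _ _ _ ≪≫ whiskerLeftIso _ (lComp A _ _).symm ≪≫
        (lComp A _ _).symm) e)
      rw [← lComp_conj, e', e'']
      simp [lComp₃]
    -- Linearity of the multiplication is the pentagon axiom of the pseudomonoid; `h₁` and `h₂` only
    -- account for rebracketing the tensored associators.
    have key := cyl_mul_aux M.α (assNat₂ A M.mul A) (pentSq A A A A) (assNat₁ M.mul A A)
      (interchange M.mul M.mul) (assNat₃ A A M.mul) (tRight₂ (Alg.self M).asc.hom A)
      (rComp (M.mul ⊠ᵣ A) M.mul A) (rComp _ _ A) (rComp _ _ A) (tSq (idSq (𝟙 A)) (Alg.self M).asc)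
      (lComp A _ _) h₁ h₂ M.pentagon
    rw [comp_sq, actHom_id_sq]
    have e : interchange M.mul M.mul = tSq (idSq M.mul) (vid M.mul) := by
      rw [interchange, idSq_symm]
    rw [e] at key
    exact Cyl.congr key rfl rfl⟩

end AlgMap

end Algebras
end MonBicat

/-! ### Descent along equivalences, and linearity of the comultiplication. -/

namespace MonBicat

open Sq MonoidalBicategory VArr

section Descent

variable {B : Type u} [Bicategory.{w, v} B]

theorem exists_iso_whiskerLeft {a b c : B} (f : a ⟶ b) [IsIso (Ho.cls f)] {h k : b ⟶ c}
    (Θ : f ≫ h ≅ f ≫ k) : ∃ θ : h ≅ k, f ◁ θ.hom = Θ.hom := by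
  obtain ⟨x, hx⟩ := (whiskerLeft_bijective_of_isIso f h k).2 Θ.hom
  obtain ⟨y, hy⟩ := (whiskerLeft_bijective_of_isIso f k h).2 Θ.inv
  dsimp only at hx hy
  exact ⟨⟨x, y, (whiskerLeft_bijective_of_isIso f h h).1 (by simp [hx, hy]),
    (whiskerLeft_bijective_of_isIso f k k).1 (by simp [hx, hy])⟩, hx⟩

end Descent

section Algebras

variable {B : Type u} [Bicategory.{w, v} B] [MonoidalBicategory B]
  {A : B} {M : Pseudomonoid A} {P N N' : Alg M}

/-- Morphisms of algebras descend along equivalences. -/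
theorem AlgMap.exists_descend (p : AlgMap P N) [IsIso (Ho.cls p.hom)] (g : AlgMap P N') :
    ∃ F : AlgMap N N', Ho.cls F.hom = inv (Ho.cls p.hom) ≫ Ho.cls g.hom := by
  obtain ⟨f, hf⟩ := Ho.cls_surjective (inv (Ho.cls p.hom) ≫ Ho.cls g.hom)
  have κ : p.hom ≫ f ≅ g.hom := (Ho.cls_eq.1 (by rw [Ho.cls_comp, hf]; simp)).some
  have : IsIso (Ho.cls (p.hom ⊠ᵣ A)) := by
    rw [Ho.cls_tRight]
    infer_instance
  -- The square of the descended morphism is the one that pastes with `p.sq` to `g.sq`, up to `κ`;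
  -- it exists because whiskering by an equivalence is bijective.
  obtain ⟨θ, hθ⟩ := exists_iso_whiskerLeft (p.hom ⊠ᵣ A) ((α_ _ _ _).symm ≪≫
    whiskerRightIso ((rComp p.hom f A).symm ≪≫ rIso κ A) N'.act ≪≫ g.sq ≪≫
    whiskerLeftIso P.act κ.symm ≪≫ (α_ _ _ _).symm ≪≫ whiskerRightIso p.sq.symm f ≪≫
    α_ (p.hom ⊠ᵣ A) N.act f)
  let F : N.arr ⟶ N'.arr := ⟨f, f, θ⟩
  have hF : Cyl (p.arr ≫ F).sq g.arr.sq (rIso κ A).hom κ.hom := by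
    change _ = ((rComp p.hom f A).hom ▷ N'.act ≫ (p.sq.vcomp θ).hom) ≫ P.act ◁ κ.hom
    simp [vcomp, hθ]
  let K : p.arr ≫ F ≅ g.arr := isoMk κ κ hF
  -- Compatibility of `θ` with associativity is tested after the equivalence `p.hom ⋆₁ 𝟙`, where it
  -- is pasted from those of `g` and `p`.
  let η : (p.hom ⋆₁ 𝟙 M.arr) ≫ (f ⋆₁ 𝟙 M.arr) ≫ N'.ascHom ⟶
      (p.hom ⋆₁ 𝟙 M.arr) ≫ N.ascHom ≫ F :=
    (α_ _ _ _).inv ≫ ((actRComp p.hom f M.arr).inv ≫ (actRIso κ M.arr).hom) ▷ N'.ascHom ≫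
      g.ascNat.hom ≫ P.ascHom ◁ K.inv ≫ (α_ _ _ _).inv ≫ p.ascNat.inv ▷ F ≫ (α_ _ _ _).hom
  exact ⟨⟨f, θ, comm_of_whiskerLeft (p.hom ⋆₁ 𝟙 M.arr) η hθ.symm hθ.symm⟩, hf⟩

end Algebras

section Comultiplication

variable {B : Type u} [Bicategory.{w, v} B] [MonoidalBicategory B] {A : B}

/-- The comultiplication induced by a coevaluation is a morphism of algebras. -/
theorem AlgMap.exists_comul (M : Pseudomonoid A) (c : unit B ⟶ A ⊠ A) :
    ∃ D : AlgMap (Alg.self M) ((Alg.self M).tensor A),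
      Ho.cls D.hom = comulOf (C := Ho B) (A := ⟨A⟩) (Ho.cls M.mul) (Ho.cls c) := by
  have : IsIso (Ho.cls (AlgMap.lunMap (Alg.self M)).hom) := by
    change IsIso (Ho.cls (lun A))
    rw [Ho.cls_lun]
    infer_instance
  -- The comultiplication starts with the inverse left unit constraint. Instead of making that
  -- inverse linear directly, the rest of the composite is descended along `lunMap`.
  obtain ⟨F, hF⟩ := AlgMap.exists_descend (AlgMap.lunMap (Alg.self M))
    (((AlgMap.tensorMap c (AlgMap.id (Alg.self M))).comp (AlgMap.assMap A A (Alg.self M))).comp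
      (AlgMap.tensorMap (𝟙 A) (AlgMap.mulMap M)))
  refine ⟨F, ?_⟩
  rw [hF, IsIso.inv_comp_eq]
  change Ho.cls ((c ⊠ᵣ A ≫ ass A A A) ≫ A ⊠ₗ M.mul) = Ho.cls (lun A) ≫ _
  rw [Ho.cls_comp, Ho.cls_comp, Ho.cls_tRight, Ho.cls_ass, Ho.cls_tLeft, Ho.cls_lun]
  simp [comulOf]

end Comultiplication
end MonBicat

/-! ### Linear 2-cells out of `A` are determined by a test. -/

namespace MonBicat

open Sq MonoidalBicategory VArr

section Testing

variable {C : Type u} [Bicategory.{w, v} C]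

/-- Linearity solved for the tensored 2-cell: after whiskering with `p` it depends only on `l ▷ p`.
-/
theorem algebra_unique_aux {x y z k : C} {f g : x ⟶ y} {F G : z ⟶ y} {m : z ⟶ x} {p : y ⟶ k}
    (l : f ⟶ g) (L : F ⟶ G) (φ : F ≅ m ≫ f) (γ : G ≅ m ≫ g) (h : L ≫ γ.hom = φ.hom ≫ m ◁ l) :
    L ▷ p = φ.hom ▷ p ≫ (α_ m f p).hom ≫ m ◁ (l ▷ p) ≫ (α_ m g p).inv ≫ γ.inv ▷ p := by
  have h' : L = φ.hom ≫ m ◁ l ≫ γ.inv := by rw [← reassoc_of% h]; simp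
  simp [h']

/-- The diagrammatic part of the proof that a 2-cell is compatible with the actions. -/
theorem algebra_aux {x y z k z' : C} {f g : x ⟶ y} {F G : z ⟶ y} {m : z ⟶ x}
    {p : y ⟶ k} (χ : f ≫ p ⟶ g ≫ p) (L : F ⟶ G) (φ : F ≅ m ≫ f) (γ : G ≅ m ≫ g)
    (h : L ▷ p = φ.hom ▷ p ≫ (α_ m f p).hom ≫ m ◁ χ ≫ (α_ m g p).inv ≫ γ.inv ▷ p)
    {m' q : z' ⟶ z} (t : m' ≫ m ≅ q ≫ m) {U V : z' ⟶ y} (rf : U ≅ m' ≫ F) (rg : V ≅ m' ≫ G)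
    (Y : U ⟶ V) {v : m ≫ f ⟶ m ≫ g} (hv : v = φ.inv ≫ L ≫ γ.hom)
    (hY : Y ≫ rg.hom ≫ m' ◁ γ.hom ≫ (α_ m' m g).inv ≫ t.hom ▷ g ≫ (α_ q m g).hom =
      (rf.hom ≫ m' ◁ φ.hom ≫ (α_ m' m f).inv ≫ t.hom ▷ f ≫ (α_ q m f).hom) ≫
        q ◁ v) :
    Y ▷ p = (rf.hom ≫ m' ◁ L ≫ rg.inv) ▷ p := by
  subst hv
  have h₁ : (φ.inv ≫ L ≫ γ.hom) ▷ p = (α_ m f p).hom ≫ m ◁ χ ≫ (α_ m g p).inv := by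
    simp [h]
  rw [← cancel_mono ((rg.hom ≫ m' ◁ γ.hom ≫ (α_ m' m g).inv ≫ t.hom ▷ g ≫ (α_ q m g).hom) ▷ p),
    ← comp_whiskerRight, hY]
  calc _ = rf.hom ▷ p ⊗≫ m' ◁ φ.hom ▷ p ⊗≫ t.hom ▷ (f ≫ p) ⊗≫ q ◁ ((φ.inv ≫ L ≫ γ.hom) ▷ p) ⊗≫ 𝟙 _ := by
        simp only [comp_whiskerRight]; bicategory
    _ = rf.hom ▷ p ⊗≫ m' ◁ φ.hom ▷ p ⊗≫ (t.hom ▷ (f ≫ p) ≫ (q ≫ m) ◁ χ) ⊗≫ 𝟙 _ := by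
        rw [h₁]; bicategory
    _ = rf.hom ▷ p ⊗≫ m' ◁ (φ.hom ▷ p ≫ (α_ m f p).hom ≫ m ◁ χ ≫ (α_ m g p).inv ≫ γ.inv ▷ p) ⊗≫
        m' ◁ γ.hom ▷ p ⊗≫ t.hom ▷ (g ≫ p) ⊗≫ 𝟙 _ := by
        rw [← whisker_exchange]
        simp [bicategoricalComp]
    _ = _ := by
        rw [← h]
        simp only [comp_whiskerRight]
        simp [bicategoricalComp]

end Testing

section Uniqueness

variable {B : Type u} [Bicategory.{w, v} B] [MonoidalBicategory B] {A : B} {M : Pseudomonoid A}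
  {e : A ⟶ unit B} {c : unit B ⟶ A ⊠ A}

theorem Pseudomonoid.nonempty_section (M : Pseudomonoid A) :
    Nonempty ((lunInv A ≫ M.one ⊠ᵣ A) ≫ M.mul ≅ 𝟙 A) := by
  rw [← Ho.cls_eq]
  have h := Ho.cls_eq.2 ⟨M.lam⟩
  rw [Ho.cls_comp, Ho.cls_comp, Category.assoc, ← Ho.cls_comp, h, Ho.cls_lunInv, Ho.cls_lun,
    Iso.inv_hom_id, Ho.cls_id]

variable {N : Alg M} {K : B}

/-- A 2-cell between morphisms of algebras out of `A` is determined by its composite with a 1-cell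
`ε` for which `act ≫ ε` is universal. -/
theorem AlgMap.hom₂_unique
    (hp : IsPairing (C := Ho B) (X := ⟨A⟩) (Y := ⟨A⟩) (Ho.cls (M.mul ≫ e)) (Ho.cls c))
    {p : N.carrier ⟶ K} (ht : IsUniversal (C := Ho B) (A := ⟨A⟩) (N := ⟨N.carrier⟩) (K := ⟨K⟩)
      (Ho.cls (M.mul ≫ e)) (Ho.cls c) (Ho.cls (N.act ≫ p)))
    {f g : A ⟶ N.carrier} {φ : Sq (f ⊠ᵣ A) f M.mul N.act} {γ : Sq (g ⊠ᵣ A) g M.mul N.act}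
    {l l' : f ⟶ g} (hl : Cyl φ γ (tRight₂ l A) l) (hl' : Cyl φ γ (tRight₂ l' A) l')
    (h : l ▷ p = l' ▷ p) : l = l' := by
  apply (universal_bijective hp ht f g).1
  have h₁ := algebra_unique_aux (p := p) l (tRight₂ l A ▷ N.act) φ γ hl
  have h₂ := algebra_unique_aux (p := p) l' (tRight₂ l' A ▷ N.act) φ γ hl'
  rw [h, ← h₂] at h₁
  simpa using h₁

/-- Universality gives a 2-cell whose tensor with `A` has the value that linearity would force. That
it is indeed linear is checked by a second use of universality, on 2-cells out of `A ⊗ A`. -/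
theorem AlgMap.exists_hom₂
    (hp : IsPairing (C := Ho B) (X := ⟨A⟩) (Y := ⟨A⟩) (Ho.cls (M.mul ≫ e)) (Ho.cls c))
    {p : N.carrier ⟶ K} (ht : IsUniversal (C := Ho B) (A := ⟨A⟩) (N := ⟨N.carrier⟩) (K := ⟨K⟩)
      (Ho.cls (M.mul ≫ e)) (Ho.cls c) (Ho.cls (N.act ≫ p)))
    (f g : AlgMap (Alg.self M) N) (χ : f.hom ≫ p ⟶ g.hom ≫ p) :
    ∃ l : f.hom ⟶ g.hom, Cyl f.sq g.sq (tRight₂ l A) l ∧ l ▷ p = χ := by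
  obtain ⟨ψ, hψ⟩ := (universal_bijective hp ht f.hom g.hom).2 ((α_ _ _ _).inv ≫ f.sq.hom ▷ p ≫
    (α_ _ _ _).hom ≫ M.mul ◁ χ ≫ (α_ _ _ _).inv ≫ g.sq.inv ▷ p ≫ (α_ _ _ _).hom)
  have h : (tRight₂ ψ A ▷ N.act) ▷ p = f.sq.hom ▷ p ≫ (α_ M.mul f.hom p).hom ≫ M.mul ◁ χ ≫
      (α_ M.mul g.hom p).inv ≫ g.sq.inv ▷ p := by
    rw [← cancel_epi (α_ (f.hom ⊠ᵣ A) N.act p).inv, ← cancel_mono (α_ (g.hom ⊠ᵣ A) N.act p).hom]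
    simpa using hψ
  -- Linearity of `ψ` says precisely that `y` is `M.mul ◁ ψ`.
  let y : M.mul ≫ f.hom ⟶ M.mul ≫ g.hom := f.sq.inv ≫ tRight₂ ψ A ▷ N.act ≫ g.sq.hom
  let Ψ : (f.hom ⋆₁ 𝟙 M.arr) ⟶ (g.hom ⋆₁ 𝟙 M.arr) :=
    ⟨ψ ⊠₂ 𝟙 _, ψ ⊠₂ 𝟙 _, (cyl_assNat ψ (𝟙 _) (𝟙 (𝟙 A))).paste
      (Cyl.tSq (cyl_idSq ψ) (Hom₂.comm (𝟙 (𝟙 M.arr))))⟩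
  -- Both components of `η` are `y`, so `y` is itself linear; this uses the compatibility of `f` and
  -- `g` with associativity.
  let η : (Alg.self M).ascHom ≫ f.arr ⟶ (Alg.self M).ascHom ≫ g.arr :=
    f.ascNat.inv ≫ Ψ ▷ N.ascHom ≫ g.ascNat.hom
  have hη : Cyl ((Alg.self M).ascHom ≫ f.arr).sq ((Alg.self M).ascHom ≫ g.arr).sq
    (tRight₂ y A) y := η.comm
  have hy₀ : y = f.sq.inv ≫ tRight₂ ψ A ▷ N.act ≫ g.sq.hom := rfl
  clear_value y
  have hy : y = M.mul ◁ ψ := by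
    apply (universal_bijective hp ht _ _).1
    have key := algebra_aux χ (tRight₂ ψ A ▷ N.act) f.sq g.sq h (Alg.self M).asc
      (whiskerRightIso (rComp M.mul f.hom A) N.act ≪≫ α_ _ _ _)
      (whiskerRightIso (rComp M.mul g.hom A) N.act ≪≫ α_ _ _ _) (tRight₂ y A ▷ N.act) hy₀ (by
        simpa [Cyl, comp_sq, Sq.precomp, vcomp] using hη)
    dsimp only
    rw [tRight₂_whiskerLeft, ← cancel_epi (α_ _ N.act p).hom]
    simpa using key =≫ (α_ _ N.act p).hom
  have hψ' : Cyl f.sq g.sq (tRight₂ ψ A) ψ := by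
    change _ = f.sq.hom ≫ M.mul ◁ ψ
    rw [← hy]
    simp [hy₀]
  refine ⟨ψ, hψ', ?_⟩
  -- The construction only controls `M.mul ◁ χ`. The multiplication has a section by the left unit
  -- law, so whiskering by it is injective.
  apply whiskerLeft_injective_of_section M.nonempty_section.some
  have h₂ := algebra_unique_aux (p := p) ψ (tRight₂ ψ A ▷ N.act) f.sq g.sq hψ'
  rw [h, cancel_epi, cancel_epi, ← Category.assoc, ← Category.assoc, cancel_mono, cancel_mono] at h₂
  exact h₂.symm

end Uniqueness
end MonBicat

/-! ### Tests expressed through 1-cells of `VArr (unit B)`. -/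

namespace MonBicat

open Sq MonoidalBicategory VArr

section

open MonoidalCategory

theorem tensor_test_aux {C : Type*} [Category C] [MonoidalCategory C] {X N A K : C}
    (m : N ⊗ A ⟶ N) (t : N ⊗ 𝟙_ C ⟶ K) :
    ((α_ X N A).hom ≫ X ◁ m) ≫ (ρ_ (X ⊗ N)).inv ≫ (α_ X N (𝟙_ C)).hom ≫ X ◁ t =
      (α_ X N A).hom ≫ X ◁ (m ≫ (ρ_ N).inv ≫ t) := by
  simp

theorem unit_test_aux {C : Type*} [Category C] [MonoidalCategory C] {X A : C} (m : X ⟶ A)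
    (e : A ⟶ 𝟙_ C) : m ≫ (ρ_ A).inv ≫ e ▷ 𝟙_ C ≫ (λ_ (𝟙_ C)).hom = m ≫ e := by
  simp [MonoidalCategory.unitors_equal]

end

section TestArrows

variable {B : Type u} [Bicategory.{w, v} B] [MonoidalBicategory B]

section

variable {Y N K L : B} {f g : Y ⟶ N} {a b : K ⟶ L} {p : Y ⊠ unit B ⟶ K} {τ : N ⊠ unit B ⟶ L}

/-- The 2-cell between composites with `runInv ≫ τ` induced by a 2-cell between the targets of
1-cells of `VArr (unit B)`. -/
def unitTransport (θ : Sq (f ⊠ᵣ unit B) a p τ) (θ' : Sq (g ⊠ᵣ unit B) b p τ) (r : a ⟶ b) :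
    f ≫ runInv N ≫ τ ⟶ g ≫ runInv N ≫ τ :=
  (α_ _ _ _).inv ≫ (runInvNat f).hom ▷ τ ≫ (α_ _ _ _).hom ≫
    runInv Y ◁ (θ.hom ≫ p ◁ r ≫ θ'.inv) ≫ (α_ _ _ _).inv ≫ (runInvNat g).inv ▷ τ ≫ (α_ _ _ _).hom

/-- Since `runInv` is a pseudonatural equivalence, tensoring with the unit object loses nothing:
being compatible with `r` amounts to having a prescribed whiskering with `runInv N ≫ τ`. -/
theorem cyl_iff_unitTransport (θ : Sq (f ⊠ᵣ unit B) a p τ) (θ' : Sq (g ⊠ᵣ unit B) b p τ)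
    (l : f ⟶ g) (r : a ⟶ b) :
    Cyl θ θ' (tRight₂ l (unit B)) r ↔ l ▷ (runInv N ≫ τ) = unitTransport θ θ' r := by
  have hn : l ▷ runInv N ≫ (runInvNat g).hom = (runInvNat f).hom ≫ runInv Y ◁ tRight₂ l (unit B) :=
    (MonoidalData.rUnit (B := B)).inv.naturality_naturality l
  have hl : l ▷ (runInv N ≫ τ) = (α_ _ _ _).inv ≫ (runInvNat f).hom ▷ τ ≫ (α_ _ _ _).hom ≫
      runInv Y ◁ (tRight₂ l (unit B) ▷ τ) ≫ (α_ _ _ _).inv ≫ (runInvNat g).inv ▷ τ ≫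
      (α_ _ _ _).hom := by
    have hn' : l ▷ runInv N = (runInvNat f).hom ≫ runInv Y ◁ tRight₂ l (unit B) ≫
        (runInvNat g).inv := by
      rw [← reassoc_of% hn]; simp
    rw [whiskerRight_comp, hn']
    simp
  have : IsIso (Ho.cls (runInv Y)) := by
    rw [Ho.cls_runInv]
    infer_instance
  rw [hl, unitTransport, cancel_epi, cancel_epi, cancel_epi, cancel_mono,
    (whiskerLeft_bijective_of_isIso (runInv Y) _ _).1.eq_iff, Cyl, ← Category.assoc,
    Iso.eq_comp_inv]

end

variable {A : B} {M : Pseudomonoid A} {N : Alg M} {K : B} (e : A ⟶ unit B)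
  (c : unit B ⟶ A ⊠ A)

/-- The 1-cell `τ` tests 2-cells between morphisms of algebras from `A` to `N`. -/
def IsTest (N : Alg M) (τ : N.carrier ⊠ unit B ⟶ K) : Prop :=
  IsUniversal (C := Ho B) (A := ⟨A⟩) (N := ⟨N.carrier⟩) (K := ⟨K⟩)
    (Ho.cls (M.mul ≫ e)) (Ho.cls c) (Ho.cls (N.act ≫ runInv N.carrier ≫ τ))

variable {e c}

theorem IsTest.self
    (hp : IsPairing (C := Ho B) (X := ⟨A⟩) (Y := ⟨A⟩) (Ho.cls (M.mul ≫ e)) (Ho.cls c)) :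
    IsTest e c (Alg.self M) (e ⊠ᵣ unit B ≫ lun (unit B)) := by
  have h : Ho.cls (M.mul ≫ runInv A ≫ e ⊠ᵣ unit B ≫ lun (unit B)) = Ho.cls (M.mul ≫ e) := by
    exact unit_test_aux (C := Ho B) (A := ⟨A⟩) (X := ⟨A ⊠ A⟩) (Ho.cls M.mul) (Ho.cls e)
  unfold IsTest
  exact h ▸ hp.isUniversal

theorem IsTest.tensor {τ : N.carrier ⊠ unit B ⟶ K} (h : IsTest e c N τ) (X : B) :
    IsTest e c (N.tensor X) (ass X N.carrier (unit B) ≫ X ⊠ₗ τ) := by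
  have e : Ho.cls ((ass X N.carrier A ≫ X ⊠ₗ N.act) ≫ runInv (X ⊠ N.carrier) ≫
      ass X N.carrier (unit B) ≫ X ⊠ₗ τ) =
      Ho.cls (ass X N.carrier A ≫ X ⊠ₗ (N.act ≫ runInv N.carrier ≫ τ)) :=
    tensor_test_aux (C := Ho B) (X := ⟨X⟩) (N := ⟨N.carrier⟩) (A := ⟨A⟩) (K := ⟨K⟩)
      (Ho.cls N.act) (Ho.cls τ)
  unfold IsTest
  rw [e]
  exact IsUniversal.tensor h ⟨X⟩

variable {τ : N.carrier ⊠ unit B ⟶ K}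

/-- This is how the pentagon and the triangle are proved: two linear 2-cells over the same `r` have
the same whiskering with the testing 1-cell. -/
theorem IsTest.unique (ht : IsTest e c N τ)
    (hp : IsPairing (C := Ho B) (X := ⟨A⟩) (Y := ⟨A⟩) (Ho.cls (M.mul ≫ e)) (Ho.cls c)) {L : B} {p : A ⊠ unit B ⟶ L} {f g : A ⟶ N.carrier}
    {φ : Sq (f ⊠ᵣ A) f M.mul N.act}
    {γ : Sq (g ⊠ᵣ A) g M.mul N.act} {a b : L ⟶ K} {θ : Sq (f ⊠ᵣ unit B) a p τ}
    {θ' : Sq (g ⊠ᵣ unit B) b p τ} {l l' : f ⟶ g} {r : a ⟶ b} (hl : Cyl φ γ (tRight₂ l A) l)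
    (hl' : Cyl φ γ (tRight₂ l' A) l') (h : Cyl θ θ' (tRight₂ l (unit B)) r)
    (h' : Cyl θ θ' (tRight₂ l' (unit B)) r) : l = l' :=
  AlgMap.hom₂_unique hp ht hl hl' (((cyl_iff_unitTransport θ θ' l r).1 h).trans
    ((cyl_iff_unitTransport θ θ' l' r).1 h').symm)

theorem IsTest.exists_hom (ht : IsTest e c N τ)
    (hp : IsPairing (C := Ho B) (X := ⟨A⟩) (Y := ⟨A⟩) (Ho.cls (M.mul ≫ e)) (Ho.cls c)) {L : B} {p : A ⊠ unit B ⟶ L} (f g : AlgMap (Alg.self M) N) {a b : L ⟶ K}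
    (θ : Sq (f.hom ⊠ᵣ unit B) a p τ) (θ' : Sq (g.hom ⊠ᵣ unit B) b p τ) (r : a ⟶ b) :
    ∃ l : f.hom ⟶ g.hom, Cyl f.sq g.sq (tRight₂ l A) l ∧ Cyl θ θ' (tRight₂ l (unit B)) r := by
  obtain ⟨l, h₁, h₂⟩ := AlgMap.exists_hom₂ hp ht f g (unitTransport θ θ' r)
  exact ⟨l, h₁, (cyl_iff_unitTransport θ θ' l r).2 h₂⟩

/-- The inverse is the linear 2-cell over `r.inv`; the two composites lie over identities and are
identities by uniqueness. -/
theorem IsTest.exists_iso (ht : IsTest e c N τ)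
    (hp : IsPairing (C := Ho B) (X := ⟨A⟩) (Y := ⟨A⟩) (Ho.cls (M.mul ≫ e)) (Ho.cls c)) {L : B} {p : A ⊠ unit B ⟶ L} (f g : AlgMap (Alg.self M) N) {a b : L ⟶ K}
    (θ : Sq (f.hom ⊠ᵣ unit B) a p τ) (θ' : Sq (g.hom ⊠ᵣ unit B) b p τ) (r : a ≅ b) :
    ∃ l : f.hom ≅ g.hom, Cyl f.sq g.sq (tRight₂ l.hom A) l.hom ∧
      Cyl θ θ' (tRight₂ l.hom (unit B)) r.hom := by
  obtain ⟨l, h₁, h₂⟩ := ht.exists_hom hp f g θ θ' r.hom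
  obtain ⟨l', h₁', h₂'⟩ := ht.exists_hom hp g f θ' θ r.inv
  refine ⟨⟨l, l', ?_, ?_⟩, h₁, h₂⟩
  · exact ht.unique hp ((h₁.trans h₁').congr (tRight₂_comp _ _ _) rfl)
      ((Cyl.refl f.sq).congr (tHom₂_id _ _) rfl)
      ((h₂.trans h₂').congr (tRight₂_comp _ _ _) r.hom_inv_id.symm)
      ((Cyl.refl θ).congr (tHom₂_id _ _) rfl)
  · exact ht.unique hp ((h₁'.trans h₁).congr (tRight₂_comp _ _ _) rfl)
      ((Cyl.refl g.sq).congr (tHom₂_id _ _) rfl)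
      ((h₂'.trans h₂).congr (tRight₂_comp _ _ _) r.inv_hom_id.symm)
      ((Cyl.refl θ').congr (tHom₂_id _ _) rfl)

end TestArrows
end MonBicat

/-! ### The two sides of the pentagon and the triangle for coactions. -/

namespace MonBicat

open Sq MonoidalBicategory

namespace VArr

section Coherence

variable {B : Type u} [Bicategory.{w, v} B] [MonoidalBicategory B] {V : B}
  {X X' X'' X₃ Y Z : B} {M N P Q : VArr V}

/-- The interchange 2-cell of the action. -/
abbrev actInterchange (k : X ⟶ X') (F : M ⟶ N) :
    (k ⋆₁ 𝟙 M) ≫ (𝟙 X' ⋆₁ F) ≅ (𝟙 X ⋆₁ F) ≫ (k ⋆₁ 𝟙 N) :=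
  (actComp _ _ _ _).symm ≪≫ actIso (idSq k) (idSq F).symm ≪≫ actComp _ _ _ _

/-- Naturality of the associativity constraint of the action in the last variable. -/
abbrev actAssNat₃ (X Y : B) (F : M ⟶ N) :
    (𝟙 (X ⊠ Y) ⋆₁ F) ≫ actAss X Y N ≅ actAss X Y M ≫ (𝟙 X ⋆₁ 𝟙 Y ⋆₁ F) :=
  whiskerRightIso (actIso (tId X Y).symm (Iso.refl F)) _ ≪≫ actAssNat (𝟙 X) (𝟙 Y) F

/-- The action on an object preserves threefold composition. -/
abbrev actRComp₃ (f : X ⟶ X') (g : X' ⟶ X'') (h : X'' ⟶ X₃) (M : VArr V) :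
    (f ≫ g ≫ h) ⋆₁ 𝟙 M ≅ (f ⋆₁ 𝟙 M) ≫ (g ⋆₁ 𝟙 M) ≫ (h ⋆₁ 𝟙 M) :=
  actRComp f (g ≫ h) M ≪≫ whiskerLeftIso _ (actRComp g h M)

/-- The action of an object preserves threefold composition. -/
abbrev actLComp₃ (X : B) (F : M ⟶ N) (G : N ⟶ P) (H : P ⟶ Q) :
    𝟙 X ⋆₁ (F ≫ G ≫ H) ≅ (𝟙 X ⋆₁ F) ≫ (𝟙 X ⋆₁ G) ≫ (𝟙 X ⋆₁ H) :=
  actLComp X F (G ≫ H) ≪≫ whiskerLeftIso _ (actLComp X G H)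

variable {A : B} {δ : A ⟶ A ⊠ A} (α : δ ≫ (δ ⊠ᵣ A) ≫ ass A A A ≅ δ ≫ (A ⊠ₗ δ))
  {δ₁ : P ⟶ A ⋆ Q} {δ₂ : P ⟶ A ⋆ P}
  (α₁ : δ₁ ≫ (δ ⋆₁ 𝟙 Q) ≫ actAss A A Q ≅ δ₂ ≫ (𝟙 A ⋆₁ δ₁))
  (α₂ : δ₂ ≫ (δ ⋆₁ 𝟙 P) ≫ actAss A A P ≅ δ₂ ≫ (𝟙 A ⋆₁ δ₂))

/-- The left-hand side of the pentagon for a coaction. -/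
abbrev pentagonLeft :
    δ₁ ≫ ((δ ⋆₁ 𝟙 Q) ≫ ((δ ⊠ᵣ A) ⋆₁ 𝟙 Q) ≫ (ass A A A ⋆₁ 𝟙 Q)) ≫ actAss A (A ⊠ A) Q ≫
        (𝟙 A ⋆₁ actAss A A Q) ⟶
      δ₂ ≫ (𝟙 A ⋆₁ δ₂) ≫ (𝟙 A ⋆₁ 𝟙 A ⋆₁ δ₁) :=
  δ₁ ◁ ((actRComp₃ δ (δ ⊠ᵣ A) (ass A A A) Q).inv ≫ (actRIso α Q).hom ≫
        (actRComp δ (A ⊠ₗ δ) Q).hom) ▷ (actAss A (A ⊠ A) Q ≫ (𝟙 A ⋆₁ actAss A A Q)) ⊗≫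
    (δ₁ ≫ (δ ⋆₁ 𝟙 Q)) ◁ (actAssNat (𝟙 A) δ (𝟙 Q)).hom ▷ (𝟙 A ⋆₁ actAss A A Q) ⊗≫
    α₁.hom ▷ ((𝟙 A ⋆₁ δ ⋆₁ 𝟙 Q) ≫ (𝟙 A ⋆₁ actAss A A Q)) ⊗≫
    δ₂ ◁ ((actLComp₃ A δ₁ (δ ⋆₁ 𝟙 Q) (actAss A A Q)).inv ≫ (actLIso A α₁).hom ≫
        (actLComp A δ₂ (𝟙 A ⋆₁ δ₁)).hom)

/-- The right-hand side of the pentagon for a coaction. -/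
abbrev pentagonRight :
    δ₁ ≫ ((δ ⋆₁ 𝟙 Q) ≫ ((δ ⊠ᵣ A) ⋆₁ 𝟙 Q) ≫ (ass A A A ⋆₁ 𝟙 Q)) ≫ actAss A (A ⊠ A) Q ≫
        (𝟙 A ⋆₁ actAss A A Q) ⟶
      δ₂ ≫ (𝟙 A ⋆₁ δ₂) ≫ (𝟙 A ⋆₁ 𝟙 A ⋆₁ δ₁) :=
  𝟙 _ ⊗≫
    (δ₁ ≫ (δ ⋆₁ 𝟙 Q) ≫ ((δ ⊠ᵣ A) ⋆₁ 𝟙 Q)) ◁ (actPent A A A Q).hom ⊗≫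
    (δ₁ ≫ (δ ⋆₁ 𝟙 Q)) ◁ (actAssNat₁ δ A Q).hom ▷ actAss A A (A ⋆ Q) ⊗≫
    α₁.hom ▷ ((δ ⋆₁ 𝟙 (A ⋆ Q)) ≫ actAss A A (A ⋆ Q)) ⊗≫
    δ₂ ◁ (actInterchange δ δ₁).inv ▷ actAss A A (A ⋆ Q) ⊗≫
    (δ₂ ≫ (δ ⋆₁ 𝟙 P)) ◁ (actAssNat₃ A A δ₁).hom ⊗≫
    α₂.hom ▷ (𝟙 A ⋆₁ 𝟙 A ⋆₁ δ₁) ⊗≫ 𝟙 _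

variable {e : A ⟶ unit B} (rho : δ ≫ (A ⊠ₗ e) ≫ run A ≅ 𝟙 A) {ι : P ⟶ Q}
  (lam₁ : δ₁ ≫ (e ⋆₁ 𝟙 Q) ≫ actLun Q ≅ ι) (κ : δ₂ ≫ (𝟙 A ⋆₁ ι) ≅ δ₁ ≫ 𝟙 (A ⋆ Q))

/-- The left-hand side of the counit axiom for a coaction. -/
abbrev triangleLeft :
    (δ₁ ≫ (δ ⋆₁ 𝟙 Q) ≫ ((A ⊠ₗ e) ⋆₁ 𝟙 Q)) ≫ (run A ⋆₁ 𝟙 Q) ⟶ δ₁ ≫ 𝟙 (A ⋆ Q) :=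
  (δ₁ ≫ (δ ⋆₁ 𝟙 Q) ≫ ((A ⊠ₗ e) ⋆₁ 𝟙 Q)) ◁ (actMidUnit A Q).inv ⊗≫
    (δ₁ ≫ (δ ⋆₁ 𝟙 Q)) ◁ (actAssNat (𝟙 A) e (𝟙 Q)).hom ▷ (𝟙 A ⋆₁ actLun Q) ⊗≫
    α₁.hom ▷ ((𝟙 A ⋆₁ e ⋆₁ 𝟙 Q) ≫ (𝟙 A ⋆₁ actLun Q)) ⊗≫
    (δ₂ ◁ ((actLComp₃ A δ₁ (e ⋆₁ 𝟙 Q) (actLun Q)).inv ≫ (actLIso A lam₁).hom) ≫ κ.hom)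

/-- The right-hand side of the counit axiom for a coaction. -/
abbrev triangleRight :
    (δ₁ ≫ (δ ⋆₁ 𝟙 Q) ≫ ((A ⊠ₗ e) ⋆₁ 𝟙 Q)) ≫ (run A ⋆₁ 𝟙 Q) ⟶ δ₁ ≫ 𝟙 (A ⋆ Q) :=
  𝟙 _ ⊗≫
    δ₁ ◁ ((actRComp₃ δ (A ⊠ₗ e) (run A) Q).inv ≫ (actRIso rho Q).hom ≫ (actId A Q).hom) ⊗≫ 𝟙 _

end Coherence

end VArr

end MonBicat

/-! ### Diagram calculus for the free coaction. -/

namespace MonBicat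

open Sq

section Coherence

variable {C : Type u} [Bicategory.{w, v} C] {T U W U₃ U₃' W₂ W₃ U₄ : C} {g : T ⟶ U} {a : U ⟶ W}
  {j₁ : W ⟶ W} (ι₁ : j₁ ≅ 𝟙 W) {h : U ⟶ U₃} {b : U₃ ⟶ U₃'} {c : U₃' ⟶ W₂} {a' : W₂ ⟶ W₃}
  {k : U ⟶ U₃'} {g' : W ⟶ W₂} {c₂ : U₃ ⟶ U₄} {a₂ : U₄ ⟶ W₃} {h' : W ⟶ U₄} {j₂ : U₄ ⟶ U₄}
  (ι₂ : j₂ ≅ 𝟙 U₄) {j₃ : W₃ ⟶ W₃} (ι₃ : j₃ ≅ 𝟙 W₃) {d' : W ⟶ W₃} (lc : d' ≅ g' ≫ a')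
  (n₂ : k ≫ c ≅ a ≫ g') (P : b ≫ c ≫ a' ≅ c₂ ≫ a₂) (n₁ : h ≫ c₂ ≅ a ≫ h')

/-- The pentagon for the free coaction. -/
abbrev freePentagon (K : g ≫ h ≫ b ⟶ g ≫ k) : (g ≫ a) ≫ h' ≫ a₂ ⟶ (g ≫ a) ≫ d' :=
  𝟙 _ ⊗≫ g ◁ n₁.inv ▷ a₂ ⊗≫ (g ≫ h) ◁ P.inv ⊗≫ K ▷ (c ≫ a') ⊗≫ g ◁ n₂.hom ▷ a' ⊗≫
    (g ≫ a) ◁ lc.inv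

/-- Interchange and naturality at an identity 1-cell consist of unit constraints only; those of the
middle object, `ι₂`, cancel. -/
theorem interchange_assNat₃_aux {x : h' ≫ j₂ ≅ j₁ ≫ h'} {n₃ : j₂ ≫ a₂ ≅ a₂ ≫ j₃}
    (hx : x = whiskerLeftIso h' ι₂ ≪≫ ρ_ h' ≪≫ (λ_ h').symm ≪≫ whiskerRightIso ι₁.symm h')
    (h₃ : n₃ = whiskerRightIso ι₂ a₂ ≪≫ λ_ a₂ ≪≫ (ρ_ a₂).symm ≪≫ whiskerLeftIso a₂ ι₃.symm) :
    (whiskerRightIso x.symm a₂ ≪≫ α_ _ _ _ ≪≫ whiskerLeftIso h' n₃).hom =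
      𝟙 _ ⊗≫ ι₁.hom ▷ h' ▷ a₂ ⊗≫ (h' ≫ a₂) ◁ ι₃.inv ⊗≫ 𝟙 (h' ≫ a₂ ≫ j₃) := by
  subst hx h₃
  calc _ = 𝟙 _ ⊗≫ ι₁.hom ▷ (h' ≫ a₂) ⊗≫ h' ◁ (ι₂.inv ≫ ι₂.hom) ▷ a₂ ⊗≫
        (h' ≫ a₂) ◁ ι₃.inv ⊗≫ 𝟙 (h' ≫ a₂ ≫ j₃) := by
        simp [bicategoricalComp]
    _ = _ := by
        rw [Iso.inv_hom_id]
        bicategory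

/-- Since `γ` is `K` conjugated by `P`, `n₁` and `n₂`, the factors `P` and `n₁` on the right cancel.
Unit constraints apart, both sides are then `K` followed by `n₂`. -/
theorem pentagon_eq_aux {x : h' ≫ j₂ ≅ j₁ ≫ h'} {n₃ : j₂ ≫ a₂ ≅ a₂ ≫ j₃} {i : T ⟶ T} (ι₀ : i ≅ 𝟙 T)
    (hx : x = whiskerLeftIso h' ι₂ ≪≫ ρ_ h' ≪≫ (λ_ h').symm ≪≫ whiskerRightIso ι₁.symm h')
    (h₃ : n₃ = whiskerRightIso ι₂ a₂ ≪≫ λ_ a₂ ≪≫ (ρ_ a₂).symm ≪≫ whiskerLeftIso a₂ ι₃.symm)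
    (K : g ≫ h ≫ b ⟶ g ≫ k) {β : i ≫ g ≫ a ⟶ (g ≫ a) ≫ j₁}
    (hβ : β = ι₀.hom ▷ (g ≫ a) ≫ (λ_ _).hom ≫ (ρ_ _).inv ≫ (g ≫ a) ◁ ι₁.inv)
    {β' : j₁ ≫ g' ≫ a' ⟶ d' ≫ j₃}
    (hβ' : β' = ι₁.hom ▷ (g' ≫ a') ≫ (λ_ _).hom ≫ lc.inv ≫ (ρ_ _).inv ≫ d' ◁ ι₃.inv)
    {γ : (g ≫ a) ≫ h' ≫ a₂ ⟶ (g ≫ a) ≫ d'} (hγ : γ = freePentagon lc n₂ P n₁ K) :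
    i ◁ K ▷ (c ≫ a') ⊗≫ (i ≫ g) ◁ n₂.hom ▷ a' ⊗≫ β ▷ (g' ≫ a') ⊗≫ (g ≫ a) ◁ β' =
      𝟙 _ ⊗≫ (i ≫ g ≫ h) ◁ P.hom ⊗≫ (i ≫ g) ◁ n₁.hom ▷ a₂ ⊗≫ β ▷ (h' ≫ a₂) ⊗≫
        (g ≫ a) ◁ x.inv ▷ a₂ ⊗≫ ((g ≫ a) ≫ h') ◁ n₃.hom ⊗≫ γ ▷ j₃ ⊗≫ 𝟙 ((g ≫ a) ≫ d' ≫ j₃) := by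
  have e₁ := interchange_assNat₃_aux (a₂ := a₂) ι₁ ι₂ ι₃ hx h₃
  have lhs : i ◁ K ▷ (c ≫ a') ⊗≫ (i ≫ g) ◁ n₂.hom ▷ a' ⊗≫ β ▷ (g' ≫ a') ⊗≫ (g ≫ a) ◁ β' =
      ι₀.hom ▷ ((g ≫ h ≫ b) ≫ c ≫ a') ⊗≫ K ▷ (c ≫ a') ⊗≫ g ◁ n₂.hom ▷ a' ⊗≫
        (g ≫ a) ◁ (lc.inv ≫ (ρ_ _).inv ≫ d' ◁ ι₃.inv) := by
    subst hβ hβ'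
    calc _ = i ◁ K ▷ (c ≫ a') ⊗≫ ((i ≫ g) ◁ n₂.hom ▷ a' ≫ 𝟙 _) ⊗≫ ι₀.hom ▷ (g ≫ a ≫ g' ≫ a') ⊗≫
          (g ≫ a) ◁ (ι₁.inv ≫ ι₁.hom) ▷ (g' ≫ a') ⊗≫
          (g ≫ a) ◁ (lc.inv ≫ (ρ_ _).inv ≫ d' ◁ ι₃.inv) := by
          bicategory
      _ = 𝟙 _ ⊗≫ (i ◁ (K ▷ (c ≫ a') ⊗≫ g ◁ n₂.hom ▷ a' ⊗≫ 𝟙 (g ≫ a ≫ g' ≫ a')) ≫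
            ι₀.hom ▷ (g ≫ a ≫ g' ≫ a')) ⊗≫
          (g ≫ a) ◁ (lc.inv ≫ (ρ_ _).inv ≫ d' ◁ ι₃.inv) := by
          rw [Iso.inv_hom_id]
          bicategory
      _ = _ := by
          rw [whisker_exchange]
          bicategory
  have rhs : 𝟙 _ ⊗≫ (i ≫ g ≫ h) ◁ P.hom ⊗≫ (i ≫ g) ◁ n₁.hom ▷ a₂ ⊗≫ β ▷ (h' ≫ a₂) ⊗≫
        (g ≫ a) ◁ x.inv ▷ a₂ ⊗≫ ((g ≫ a) ≫ h') ◁ n₃.hom ⊗≫ γ ▷ j₃ ⊗≫ 𝟙 ((g ≫ a) ≫ d' ≫ j₃) =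
      ι₀.hom ▷ ((g ≫ h ≫ b) ≫ c ≫ a') ⊗≫ (g ≫ h) ◁ P.hom ⊗≫ g ◁ n₁.hom ▷ a₂ ⊗≫ γ ⊗≫
        ((g ≫ a) ≫ d') ◁ ι₃.inv ⊗≫ 𝟙 ((g ≫ a) ≫ d' ≫ j₃) := by
    subst hβ
    calc _ = 𝟙 _ ⊗≫ (i ≫ g ≫ h) ◁ P.hom ⊗≫ (i ≫ g) ◁ n₁.hom ▷ a₂ ⊗≫
          ι₀.hom ▷ (g ≫ a ≫ h' ≫ a₂) ⊗≫ (g ≫ a) ◁ ι₁.inv ▷ (h' ≫ a₂) ⊗≫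
        (g ≫ a) ◁ (whiskerRightIso x.symm a₂ ≪≫ α_ _ _ _ ≪≫ whiskerLeftIso h' n₃).hom ⊗≫
        γ ▷ j₃ ⊗≫ 𝟙 ((g ≫ a) ≫ d' ≫ j₃) := by
          simp only [Iso.trans_hom, Iso.symm_hom, whiskerLeftIso_hom, whiskerRightIso_hom]
          bicategory
      _ = 𝟙 _ ⊗≫ (i ◁ ((g ≫ h) ◁ P.hom ⊗≫ g ◁ n₁.hom ▷ a₂ ⊗≫ 𝟙 (g ≫ a ≫ h' ≫ a₂)) ≫
          ι₀.hom ▷ (g ≫ a ≫ h' ≫ a₂)) ⊗≫ (g ≫ a) ◁ (ι₁.inv ≫ ι₁.hom) ▷ (h' ≫ a₂) ⊗≫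
          (((g ≫ a) ≫ h' ≫ a₂) ◁ ι₃.inv ≫ γ ▷ j₃) ⊗≫ 𝟙 ((g ≫ a) ≫ d' ≫ j₃) := by
          rw [e₁]
          bicategory
      _ = _ := by
          rw [Iso.inv_hom_id, whisker_exchange, whisker_exchange]
          bicategory
  rw [lhs, rhs, hγ]
  calc _ = ι₀.hom ▷ ((g ≫ h ≫ b) ≫ c ≫ a') ⊗≫ K ▷ (c ≫ a') ⊗≫ g ◁ n₂.hom ▷ a' ⊗≫
        (g ≫ a) ◁ lc.inv ⊗≫ ((g ≫ a) ≫ d') ◁ ι₃.inv ⊗≫ 𝟙 ((g ≫ a) ≫ d' ≫ j₃) := by bicategory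
    _ = ι₀.hom ▷ ((g ≫ h ≫ b) ≫ c ≫ a') ⊗≫ (g ≫ h) ◁ (P.hom ≫ P.inv) ⊗≫ K ▷ (c ≫ a') ⊗≫
        g ◁ n₂.hom ▷ a' ⊗≫ (g ≫ a) ◁ lc.inv ⊗≫ ((g ≫ a) ≫ d') ◁ ι₃.inv ⊗≫ 𝟙 ((g ≫ a) ≫ d' ≫ j₃) := by
        rw [Iso.hom_inv_id]; bicategory
    _ = ι₀.hom ▷ ((g ≫ h ≫ b) ≫ c ≫ a') ⊗≫ (g ≫ h) ◁ P.hom ⊗≫ g ◁ (n₁.hom ≫ n₁.inv) ▷ a₂ ⊗≫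
        (g ≫ h) ◁ P.inv ⊗≫ K ▷ (c ≫ a') ⊗≫
        g ◁ n₂.hom ▷ a' ⊗≫ (g ≫ a) ◁ lc.inv ⊗≫ ((g ≫ a) ≫ d') ◁ ι₃.inv ⊗≫ 𝟙 ((g ≫ a) ≫ d' ≫ j₃) := by
        rw [Iso.hom_inv_id n₁]; bicategory
    _ = _ := by bicategory

/-- A normal form for the square of the first iterated coaction, in which all unit constraints are
collected at the target. -/
theorem freeCoact_source_aux {x : h' ≫ j₂ ≅ j₁ ≫ h'} {n₃ : j₂ ≫ a₂ ≅ a₂ ≫ j₃}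
    (hx : x = whiskerLeftIso h' ι₂ ≪≫ ρ_ h' ≪≫ (λ_ h').symm ≪≫ whiskerRightIso ι₁.symm h')
    (h₃ : n₃ = whiskerRightIso ι₂ a₂ ≪≫ λ_ a₂ ≪≫ (ρ_ a₂).symm ≪≫ whiskerLeftIso a₂ ι₃.symm)
    {v' : W₂ ⟶ W₃} (lv : v' ≅ a' ≫ j₃) {s : Sq g (g ≫ a) (𝟙 T) (a ≫ j₁)}
    (hs : s.hom = g ◁ (a ◁ ι₁.hom ≫ (ρ_ a).hom) ≫ (λ_ (g ≫ a)).inv)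
    {z : T ⟶ U₃'} {y : U ⟶ U₃'} (r₁ : z ≅ g ≫ y) (r₂ : y ≅ h ≫ b) :
    (Sq.precomp r₁ (s.vcomp (Sq.precomp r₂ (Sq.vcomp
      (Sq.paste (f := h) (p := a) (q := c₂) n₁ x)
      (Sq.cast (Iso.refl _) (α_ c a' j₃ ≪≫ whiskerLeftIso c lv.symm)
        (Sq.paste (f := b) (p := c₂) (q := c ≫ a') P n₃.symm)))))).hom ≫ (λ_ _).hom =
      (r₁ ≪≫ whiskerLeftIso g r₂).hom ▷ (c ≫ v') ⊗≫
        (g ≫ h ≫ b ≫ c) ◁ (lv ≪≫ whiskerLeftIso a' ι₃ ≪≫ ρ_ a').hom ⊗≫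
        (g ≫ h) ◁ P.hom ⊗≫ g ◁ n₁.hom ▷ a₂ ⊗≫ 𝟙 ((g ≫ a) ≫ h' ≫ a₂) := by
  have e₁ : h' ◁ n₃.inv ⊗≫ x.hom ▷ a₂ ⊗≫ ι₁.hom ▷ h' ▷ a₂ ⊗≫ 𝟙 (h' ≫ a₂) =
      h' ◁ a₂ ◁ ι₃.hom ⊗≫ 𝟙 (h' ≫ a₂) := by
    subst hx h₃
    calc _ = h' ◁ a₂ ◁ ι₃.hom ⊗≫ h' ◁ (ι₂.inv ≫ ι₂.hom) ▷ a₂ ⊗≫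
          (ι₁.inv ≫ ι₁.hom) ▷ h' ▷ a₂ ⊗≫ 𝟙 (h' ≫ a₂) := by
          simp only [Iso.trans_hom, Iso.trans_inv, Iso.symm_hom, Iso.symm_inv, whiskerLeftIso_hom,
            whiskerLeftIso_inv, whiskerRightIso_hom, whiskerRightIso_inv]
          bicategory
      _ = _ := by
          rw [Iso.inv_hom_id, Iso.inv_hom_id]
          bicategory
  simp only [Sq.precomp, vcomp, Sq.cast, Sq.paste, Iso.trans_hom, whiskerLeftIso_hom,
    whiskerRightIso_hom, Iso.symm_hom, hs]
  calc _ = (r₁ ≪≫ whiskerLeftIso g r₂).hom ▷ (c ≫ v') ⊗≫ (g ≫ h ≫ b ≫ c) ◁ lv.hom ⊗≫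
        (g ≫ h) ◁ P.hom ▷ j₃ ⊗≫ g ◁ (h ◁ (c₂ ◁ n₃.inv) ⊗≫ n₁.hom ▷ (j₂ ≫ a₂)) ⊗≫
        (g ≫ a) ◁ x.hom ▷ a₂ ⊗≫ g ◁ (a ◁ ι₁.hom) ▷ (h' ≫ a₂) ⊗≫ 𝟙 ((g ≫ a) ≫ h' ≫ a₂) := by
        simp only [Iso.trans_hom, Iso.trans_inv, Iso.symm_inv, whiskerLeftIso_hom,
            whiskerLeftIso_inv, Iso.refl_hom]
        bicategory
    _ = (r₁ ≪≫ whiskerLeftIso g r₂).hom ▷ (c ≫ v') ⊗≫ (g ≫ h ≫ b ≫ c) ◁ lv.hom ⊗≫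
        (g ≫ h) ◁ P.hom ▷ j₃ ⊗≫ g ◁ ((h ≫ c₂) ◁ n₃.inv ≫ n₁.hom ▷ (j₂ ≫ a₂)) ⊗≫
        (g ≫ a) ◁ x.hom ▷ a₂ ⊗≫ g ◁ (a ◁ ι₁.hom) ▷ (h' ≫ a₂) ⊗≫ 𝟙 ((g ≫ a) ≫ h' ≫ a₂) := by
        simp only [Iso.trans_hom, whiskerLeftIso_hom]
        bicategory
    _ = (r₁ ≪≫ whiskerLeftIso g r₂).hom ▷ (c ≫ v') ⊗≫ (g ≫ h ≫ b ≫ c) ◁ lv.hom ⊗≫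
        (g ≫ h) ◁ P.hom ▷ j₃ ⊗≫ g ◁ n₁.hom ▷ (a₂ ≫ j₃) ⊗≫
        (g ≫ a) ◁ (h' ◁ n₃.inv ⊗≫ x.hom ▷ a₂ ⊗≫ ι₁.hom ▷ h' ▷ a₂ ⊗≫ 𝟙 (h' ≫ a₂)) ⊗≫
        𝟙 ((g ≫ a) ≫ h' ≫ a₂) := by
        rw [whisker_exchange]
        simp only [Iso.trans_hom, whiskerLeftIso_hom]
        bicategory
    _ = (r₁ ≪≫ whiskerLeftIso g r₂).hom ▷ (c ≫ v') ⊗≫ (g ≫ h ≫ b ≫ c) ◁ lv.hom ⊗≫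
        ((g ◁ (h ◁ P.hom ⊗≫ n₁.hom ▷ a₂ ⊗≫ 𝟙 (a ≫ h' ≫ a₂))) ▷ j₃ ≫
          (g ≫ a ≫ h' ≫ a₂) ◁ ι₃.hom) ⊗≫
        𝟙 ((g ≫ a) ≫ h' ≫ a₂) := by
        rw [e₁]
        simp only [Iso.trans_hom, whiskerLeftIso_hom]
        bicategory
    _ = _ := by
        rw [← whisker_exchange]
        simp only [Iso.trans_hom, whiskerLeftIso_hom]
        bicategory

theorem freeCoact_target_aux {v' : W₂ ⟶ W₃} (lv : v' ≅ a' ≫ j₃) {s : Sq g (g ≫ a) (𝟙 T) (a ≫ j₁)}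
    (hs : s.hom = g ◁ (a ◁ ι₁.hom ≫ (ρ_ a).hom) ≫ (λ_ (g ≫ a)).inv) {s' : Sq g' d' j₁ v'}
    (hs' : s'.hom = g' ◁ lv.hom ≫ g' ◁ (a' ◁ ι₃.hom ≫ (ρ_ a').hom) ≫ lc.inv ≫ (λ_ d').inv ≫
      ι₁.inv ▷ d') {z : T ⟶ U₃'} (r : z ≅ g ≫ k) :
    (Sq.precomp r (s.vcomp (Sq.paste (f := k) (g := g') (p := a) (q := c) n₂ s'))).hom ≫
      (λ_ _).hom =
      r.hom ▷ (c ≫ v') ⊗≫ (g ≫ k ≫ c) ◁ (lv ≪≫ whiskerLeftIso a' ι₃ ≪≫ ρ_ a').hom ⊗≫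
        g ◁ n₂.hom ▷ a' ⊗≫ (g ≫ a) ◁ lc.inv := by
  simp only [Sq.precomp, vcomp, Sq.paste, Iso.trans_hom, whiskerLeftIso_hom,
    whiskerRightIso_hom, Iso.symm_hom, hs, hs']
  calc _ = r.hom ▷ (c ≫ v') ⊗≫ (g ◁ n₂.hom ▷ v' ⊗≫
        (g ≫ a ≫ g') ◁ (lv.hom ≫ a' ◁ ι₃.hom ≫ (ρ_ a').hom)) ⊗≫ (g ≫ a) ◁ lc.inv ⊗≫
        (g ◁ a ◁ (ι₁.inv ≫ ι₁.hom)) ▷ d' ⊗≫ 𝟙 ((g ≫ a) ≫ d') := by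
        bicategory
    _ = r.hom ▷ (c ≫ v') ⊗≫ g ◁ (n₂.hom ▷ v' ≫
        (a ≫ g') ◁ (lv.hom ≫ a' ◁ ι₃.hom ≫ (ρ_ a').hom)) ⊗≫ (g ≫ a) ◁ lc.inv := by
        rw [Iso.inv_hom_id]
        bicategory
    _ = _ := by
        rw [← whisker_exchange]
        bicategory

/-- The left side is the second component that `freeIso` forces on a coassociator. With both squares
in normal form, their common unit constraint `ω` passes through `K` and drops out. -/
theorem freePentagon_eq {x : h' ≫ j₂ ≅ j₁ ≫ h'} {n₃ : j₂ ≫ a₂ ≅ a₂ ≫ j₃}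
    (hx : x = whiskerLeftIso h' ι₂ ≪≫ ρ_ h' ≪≫ (λ_ h').symm ≪≫ whiskerRightIso ι₁.symm h')
    (h₃ : n₃ = whiskerRightIso ι₂ a₂ ≪≫ λ_ a₂ ≪≫ (ρ_ a₂).symm ≪≫ whiskerLeftIso a₂ ι₃.symm)
    {v' : W₂ ⟶ W₃} (lv : v' ≅ a' ≫ j₃) {s : Sq g (g ≫ a) (𝟙 T) (a ≫ j₁)}
    (hs : s.hom = g ◁ (a ◁ ι₁.hom ≫ (ρ_ a).hom) ≫ (λ_ (g ≫ a)).inv) {s' : Sq g' d' j₁ v'}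
    (hs' : s'.hom = g' ◁ lv.hom ≫ g' ◁ (a' ◁ ι₃.hom ≫ (ρ_ a').hom) ≫ lc.inv ≫ (λ_ d').inv ≫
      ι₁.inv ▷ d')
    {z z' : T ⟶ U₃'} {y : U ⟶ U₃'} (r₁ : z ≅ g ≫ y) (r₂ : y ≅ h ≫ b) (r₃ : z' ≅ g ≫ k)
    (t : z ≅ z') :
    (λ_ _).inv ≫ (Sq.precomp r₁ (s.vcomp (Sq.precomp r₂ (Sq.vcomp
      (Sq.paste (f := h) (p := a) (q := c₂) n₁ x)
      (Sq.cast (Iso.refl _) (α_ c a' j₃ ≪≫ whiskerLeftIso c lv.symm)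
        (Sq.paste (f := b) (p := c₂) (q := c ≫ a') P n₃.symm)))))).inv ≫ t.hom ▷ (c ≫ v') ≫
      (Sq.precomp r₃ (s.vcomp (Sq.paste (f := k) (g := g') (p := a) (q := c) n₂ s'))).hom ≫
      (λ_ _).hom =
    freePentagon lc n₂ P n₁ ((r₁ ≪≫ whiskerLeftIso g r₂).inv ≫ t.hom ≫ r₃.hom) := by
  rw [Iso.inv_comp_eq, Iso.inv_comp_eq, freeCoact_target_aux ι₁ ι₃ lc n₂ lv hs hs',
    ← Category.assoc, freeCoact_source_aux ι₁ ι₂ ι₃ P n₁ hx h₃ lv hs]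
  generalize lv ≪≫ whiskerLeftIso a' ι₃ ≪≫ ρ_ a' = ω
  have hr : t.hom ≫ r₃.hom = (r₁ ≪≫ whiskerLeftIso g r₂).hom ≫
      ((r₁ ≪≫ whiskerLeftIso g r₂).inv ≫ t.hom ≫ r₃.hom) := by
    rw [Iso.hom_inv_id_assoc]
  generalize (r₁ ≪≫ whiskerLeftIso g r₂).inv ≫ t.hom ≫ r₃.hom = K at *
  generalize (r₁ ≪≫ whiskerLeftIso g r₂).hom = R at *
  symm
  calc _ = R ▷ (c ≫ v') ⊗≫ (g ≫ h ≫ b ≫ c) ◁ ω.hom ⊗≫ (g ≫ h) ◁ P.hom ⊗≫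
        g ◁ (n₁.hom ≫ n₁.inv) ▷ a₂ ⊗≫ (g ≫ h) ◁ P.inv ⊗≫ K ▷ (c ≫ a') ⊗≫ g ◁ n₂.hom ▷ a' ⊗≫
        (g ≫ a) ◁ lc.inv := by
        bicategory
    _ = R ▷ (c ≫ v') ⊗≫ (g ≫ h ≫ b ≫ c) ◁ ω.hom ⊗≫ (g ≫ h) ◁ (P.hom ≫ P.inv) ⊗≫
        K ▷ (c ≫ a') ⊗≫ g ◁ n₂.hom ▷ a' ⊗≫ (g ≫ a) ◁ lc.inv := by
        rw [Iso.hom_inv_id]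
        bicategory
    _ = R ▷ (c ≫ v') ⊗≫ (((g ≫ h ≫ b) ≫ c) ◁ ω.hom ≫ (K ▷ c) ▷ a') ⊗≫
        g ◁ n₂.hom ▷ a' ⊗≫ (g ≫ a) ◁ lc.inv := by
        rw [Iso.hom_inv_id]
        bicategory
    _ = (R ≫ K) ▷ (c ≫ v') ⊗≫ (g ≫ k ≫ c) ◁ ω.hom ⊗≫ g ◁ n₂.hom ▷ a' ⊗≫
        (g ≫ a) ◁ lc.inv := by
        rw [whisker_exchange]
        bicategory
    _ = _ := by
        rw [← hr]
        bicategory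

end Coherence
end MonBicat
-- Free objects of `VArr V` and the free coaction.
namespace MonBicat

open Sq MonoidalBicategory VArr

namespace VArr

section Free

variable {B : Type u} [Bicategory.{w, v} B] [MonoidalBicategory B] {V : B}

/-- The free object of `VArr V` on an object. -/
abbrev free (V X : B) : VArr V := ⟨X, X ⊠ V, 𝟙 _⟩

/-- The 2-cell out of a free object determined by its first component. -/
def freeIso {X : B} {M : VArr V} {F G : free V X ⟶ M} (l : F.fst ≅ G.fst) : F ≅ G :=
  isoMk l ((λ_ _).symm ≪≫ F.sq.symm ≪≫ whiskerRightIso (rIso l V) M.hom ≪≫ G.sq ≪≫ λ_ _) (by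
    simp [Cyl])

variable {A : B} (δ : A ⟶ A ⊠ A)

/-- The square underlying the free coaction. -/
abbrev freeCoactSq : Sq (δ ⊠ᵣ V) (δ ⊠ᵣ V ≫ ass A A V) (𝟙 (A ⊠ V))
    (ass A A V ≫ A ⊠ₗ 𝟙 (A ⊠ V)) :=
  whiskerLeftIso _ (whiskerLeftIso _ (tId A (A ⊠ V)) ≪≫ ρ_ _) ≪≫ (λ_ _).symm

/-- The free coaction. -/
abbrev freeCoact : free V A ⟶ A ⋆ free V A :=
  ⟨δ, δ ⊠ᵣ V ≫ ass A A V, freeCoactSq δ⟩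

/-- The canonical 2-cell between the targets of the two iterated coactions. -/
abbrev coactCoherence : 𝟙 (A ⊠ V) ≫ (δ ⊠ᵣ V) ≫ ass A A V ≅
    ((δ ⊠ᵣ V) ≫ ass A A V) ≫ A ⊠ₗ 𝟙 (A ⊠ V) :=
  λ_ _ ≪≫ (ρ_ _).symm ≪≫ whiskerLeftIso _ (tId A (A ⊠ V)).symm

end Free

end VArr

end MonBicat
-- Constraints at identity 1-cells.
namespace MonBicat

open Sq MonoidalBicategory VArr

section Identities

variable {B : Type u} [Bicategory.{w, v} B] [MonoidalBicategory B] {V A : B}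

theorem tRight₂_leftUnitor_inv {X X' : B} (f : X ⟶ X') (V : B) :
    tRight₂ (λ_ f).inv V = (λ_ _).inv ≫ (tId X V).inv ▷ (f ⊠ᵣ V) ≫ (rComp (𝟙 X) f V).inv := by
  have h : rIso (λ_ f) V = rComp (𝟙 X) f V ≪≫ whiskerRightIso (tId X V) _ ≪≫ λ_ _ :=
    Iso.ext (tRight₂_leftUnitor f V)
  exact (congrArg Iso.inv h).trans (by simp)

theorem tLeft₂_leftUnitor_inv (X : B) {Y Y' : B} (f : Y ⟶ Y') :
    tLeft₂ X (λ_ f).inv = (λ_ _).inv ≫ (tId X Y).inv ▷ (X ⊠ₗ f) ≫ (lComp X (𝟙 Y) f).inv := by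
  have h : lIso X (λ_ f) = lComp X (𝟙 Y) f ≪≫ whiskerRightIso (tId X Y) _ ≪≫ λ_ _ :=
    Iso.ext (tLeft_leftUnitor X f)
  exact (congrArg Iso.inv h).trans (by simp)

theorem tLeft₂_rightUnitor_inv (X : B) {Y Y' : B} (f : Y ⟶ Y') :
    tLeft₂ X (ρ_ f).inv = (ρ_ _).inv ≫ (X ⊠ₗ f) ◁ (tId X Y').inv ≫ (lComp X f (𝟙 Y')).inv := by
  have h : lIso X (ρ_ f) = lComp X f (𝟙 Y') ≪≫ whiskerLeftIso _ (tId X Y') ≪≫ ρ_ _ :=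
    Iso.ext (tLeft_rightUnitor X f)
  exact (congrArg Iso.inv h).trans (by simp)

theorem interchange_id {X X' : B} (f : X ⟶ X') (Y : B) :
    interchange f (𝟙 Y) = whiskerLeftIso (f ⊠ᵣ Y) (tId X' Y) ≪≫ ρ_ _ ≪≫ (λ_ _).symm ≪≫
      whiskerRightIso (tId X Y).symm (f ⊠ᵣ Y) := by
  ext
  have h := rComp_conj (idSq f) Y
  rw [← vid_eq_idSq] at h
  change (tSq (idSq f) (vid (𝟙 Y))).hom = _
  rw [← h, rIso_hom]
  simp [idSq, tRight₂_comp, tRight₂_rightUnitor, tRight₂_leftUnitor_inv]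

theorem assNat₃_id (X Y Z : B) :
    assNat₃ X Y (𝟙 Z) = whiskerRightIso (tId (X ⊠ Y) Z) _ ≪≫ λ_ _ ≪≫ (ρ_ _).symm ≪≫
      whiskerLeftIso _ (lIso X (tId Y Z) ≪≫ tId X (Y ⊠ Z)).symm := by
  ext
  have h : _ = _ := cyl_assNat_id X Y Z
  have e : (assNat (𝟙 X) (𝟙 Y) (𝟙 Z)).hom = (((tId X Y).hom ⊠₂ 𝟙 (𝟙 Z)) ≫ (tId (X ⊠ Y) Z).hom) ▷
      ass X Y Z ≫ (vid (ass X Y Z)).hom ≫ ass X Y Z ◁ ((tId X (Y ⊠ Z)).inv ≫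
        (𝟙 (𝟙 X) ⊠₂ (tId Y Z).inv)) := by
    rw [reassoc_of% h, ← whiskerLeft_comp]
    simp [← tHom₂_comp]
  have e' : ((tId X Y).inv ⊠₂ 𝟙 (𝟙 Z)) ▷ ass X Y Z ≫ ((tId X Y).hom ⊠₂ 𝟙 (𝟙 Z)) ▷ ass X Y Z =
      𝟙 _ := by
    rw [← comp_whiskerRight, ← tHom₂_comp]
    simp
  simp only [assNat₃, Iso.trans_hom, whiskerRightIso_hom, tIso_hom, Iso.symm_hom, Iso.refl_hom, e,
    comp_whiskerRight, Category.assoc, reassoc_of% e']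
  simp [vid, lIso, tIso_inv]

/-- The action of an object on the square underlying the free coaction. -/
theorem tSq_freeCoactSq (δ : A ⟶ A ⊠ A) :
    (tSq (idSq (𝟙 A)) (freeCoactSq (V := V) δ)).hom =
      (A ⊠ₗ δ ⊠ᵣ V) ◁ (lComp A (ass A A V) (A ⊠ₗ 𝟙 (A ⊠ V))).hom ≫
      (A ⊠ₗ δ ⊠ᵣ V) ◁ ((A ⊠ₗ ass A A V) ◁ (lIso A (tId A (A ⊠ V)) ≪≫ tId A (A ⊠ A ⊠ V)).hom ≫
        (ρ_ _).hom) ≫ (lComp A (δ ⊠ᵣ V) (ass A A V)).inv ≫ (λ_ _).inv ≫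
      (tId A (A ⊠ V)).inv ▷ (A ⊠ₗ (δ ⊠ᵣ V ≫ ass A A V)) := by
  have h := tLeft_rightUnitor A (ass A A V)
  rw [lIso_hom] at h
  rw [← lComp_conj, lIso_hom]
  simp only [Iso.trans_hom, whiskerLeftIso_hom, Iso.symm_hom, tLeft₂_comp, tLeft₂_whiskerLeft,
    tLeft₂_leftUnitor_inv, h, lIso_hom]
  simp

theorem tLeft_coactCoherence (δ : A ⟶ A ⊠ A) :
    (lComp₃ A (𝟙 (A ⊠ V)) (δ ⊠ᵣ V) (ass A A V)).inv ≫ (lIso A (coactCoherence δ)).hom ≫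
      (lComp A (δ ⊠ᵣ V ≫ ass A A V) (A ⊠ₗ 𝟙 (A ⊠ V))).hom =
      (tId A (A ⊠ V)).hom ▷ ((A ⊠ₗ δ ⊠ᵣ V) ≫ A ⊠ₗ ass A A V) ≫ (λ_ _).hom ≫
      (lComp A (δ ⊠ᵣ V) (ass A A V)).inv ≫ (ρ_ _).inv ≫
      (A ⊠ₗ (δ ⊠ᵣ V ≫ ass A A V)) ◁
        (lIso A (tId A (A ⊠ V)) ≪≫ tId A (A ⊠ A ⊠ V)).inv := by
  have h := tLeft_leftUnitor A (δ ⊠ᵣ V ≫ ass A A V)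
  have h' := tLeft₂_rightUnitor_inv A (δ ⊠ᵣ V ≫ ass A A V)
  rw [lIso_hom] at h
  have h₁ := tLeft₂_whiskerLeft A (δ ⊠ᵣ V ≫ ass A A V) (tId A (A ⊠ V)).inv
  rw [lIso_hom]
  simp only [Iso.trans_hom, whiskerLeftIso_hom, Iso.symm_hom, tLeft₂_comp, h₁, h, h', lComp₃,
    Iso.trans_inv, whiskerLeftIso_inv, lIso_inv]
  have h₂ := whisker_exchange (tId A (A ⊠ V)).hom (lComp A (δ ⊠ᵣ V) (ass A A V)).inv
  simp only [Category.assoc, whiskerLeft_comp, Iso.inv_hom_id_assoc, Iso.inv_hom_id,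
    Category.comp_id, reassoc_of% h₂]
  simp

end Identities
end MonBicat

/-! ### The pentagon on second components. -/

namespace MonBicat

open Sq MonoidalBicategory VArr

/-- The variable `d`, equal to `g ≫ a`, keeps the second component of the free coaction opaque, so
that the bracketing of the formal composites matches that of `pentagonLeft` and `pentagonRight`. -/
theorem pentagon_eq {C : Type u} [Bicategory.{w, v} C] {T U W U₃ U₃' W₂ W₃ U₄ : C}
    {g : T ⟶ U} {a : U ⟶ W}
    {j₁ : W ⟶ W} (ι₁ : j₁ ≅ 𝟙 W) {h : U ⟶ U₃} {b : U₃ ⟶ U₃'} {c : U₃' ⟶ W₂} {a' : W₂ ⟶ W₃}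
    {k : U ⟶ U₃'} {g' : W ⟶ W₂} {c₂ : U₃ ⟶ U₄} {a₂ : U₄ ⟶ W₃} {h' : W ⟶ U₄} {j₂ : U₄ ⟶ U₄}
    (ι₂ : j₂ ≅ 𝟙 U₄) {j₃ : W₃ ⟶ W₃} (ι₃ : j₃ ≅ 𝟙 W₃) {d' : W ⟶ W₃} (lc : d' ≅ g' ≫ a')
    (n₂ : k ≫ c ≅ a ≫ g') (P : b ≫ c ≫ a' ≅ c₂ ≫ a₂) (n₁ : h ≫ c₂ ≅ a ≫ h')
    {x : h' ≫ j₂ ≅ j₁ ≫ h'} {n₃ : j₂ ≫ a₂ ≅ a₂ ≫ j₃} {i : T ⟶ T} (ι₀ : i ≅ 𝟙 T)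
    (hx : x = whiskerLeftIso h' ι₂ ≪≫ ρ_ h' ≪≫ (λ_ h').symm ≪≫ whiskerRightIso ι₁.symm h')
    (h₃ : n₃ = whiskerRightIso ι₂ a₂ ≪≫ λ_ a₂ ≪≫ (ρ_ a₂).symm ≪≫ whiskerLeftIso a₂ ι₃.symm)
    (K : g ≫ h ≫ b ⟶ g ≫ k) {d : T ⟶ W} (hd : d = g ≫ a) {β : i ≫ g ≫ a ⟶ d ≫ j₁}
    (hβ : β = ι₀.hom ▷ (g ≫ a) ≫ (λ_ _).hom ≫ (ρ_ _).inv ≫ (g ≫ a) ◁ ι₁.inv ≫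
      eqToHom hd.symm ▷ j₁)
    {β' : j₁ ≫ g' ≫ a' ⟶ d' ≫ j₃}
    (hβ' : β' = ι₁.hom ▷ (g' ≫ a') ≫ (λ_ _).hom ≫ lc.inv ≫ (ρ_ _).inv ≫ d' ◁ ι₃.inv)
    {γ : d ≫ h' ≫ a₂ ⟶ d ≫ d'} (hγ : γ = eqToHom hd ▷ (h' ≫ a₂) ≫ freePentagon lc n₂ P n₁ K ≫
      eqToHom hd.symm ▷ d') :
    i ◁ K ▷ (c ≫ a') ⊗≫ (i ≫ g) ◁ n₂.hom ▷ a' ⊗≫ β ▷ (g' ≫ a') ⊗≫ d ◁ β' =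
      𝟙 _ ⊗≫ (i ≫ g ≫ h) ◁ P.hom ⊗≫ (i ≫ g) ◁ n₁.hom ▷ a₂ ⊗≫ β ▷ (h' ≫ a₂) ⊗≫
        d ◁ x.inv ▷ a₂ ⊗≫ (d ≫ h') ◁ n₃.hom ⊗≫ γ ▷ j₃ ⊗≫ 𝟙 (d ≫ d' ≫ j₃) := by
  subst hd
  have key := pentagon_eq_aux ι₁ ι₂ ι₃ lc n₂ P n₁ ι₀ hx h₃ K (β := β) (by simpa using hβ) hβ'
    (γ := γ) (by simpa using hγ)
  calc _ = _ := by bicategory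
    _ = _ := key
    _ = _ := by bicategory

namespace VArr

section Free

variable {B : Type u} [Bicategory.{w, v} B] [MonoidalBicategory B] {V A : B} (δ : A ⟶ A ⊠ A)

theorem freeCoact_comp_sq : (freeCoact δ ≫ (δ ⋆₁ 𝟙 (free V A)) ≫ actAss A A (free V A)).sq =
    Sq.precomp (rComp δ _ V) ((freeCoactSq δ).vcomp (Sq.precomp (rComp (δ ⊠ᵣ A) (ass A A A) V)
      (Sq.vcomp (Sq.paste (f := (δ ⊠ᵣ A) ⊠ᵣ V) (p := ass A A V) (q := ass (A ⊠ A) A V)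
        (assNat₁ δ A V) (interchange δ (𝟙 (A ⊠ V))))
      (Sq.cast (Iso.refl _) (α_ _ _ _ ≪≫ whiskerLeftIso _
        (lComp A (ass A A V) (A ⊠ₗ 𝟙 (A ⊠ V))).symm)
        (Sq.paste (f := ass A A A ⊠ᵣ V) (p := ass (A ⊠ A) A V)
          (q := ass A (A ⊠ A) V ≫ A ⊠ₗ ass A A V) (pent A A A V)
          (assNat₃ A A (𝟙 (A ⊠ V))).symm))))) := by
  rw [comp_sq, comp_sq, actHom_id_sq]
  rfl

/-- A 2-cell out of a free object is determined by its first component; here the second is α ⊗ V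
conjugated by the associativity constraints. -/
theorem freeIso_r (α : δ ≫ (δ ⊠ᵣ A) ≫ ass A A A ≅ δ ≫ (A ⊠ₗ δ)) :
    (freeIso α : freeCoact δ ≫ (δ ⋆₁ 𝟙 (free V A)) ≫ actAss A A _ ≅
        freeCoact δ ≫ (𝟙 A ⋆₁ freeCoact δ)).hom.r =
      freePentagon (lComp A (δ ⊠ᵣ V) (ass A A V)) (assNat₂ A δ V) (pent A A A V) (assNat₁ δ A V)
        ((rComp₃ δ (δ ⊠ᵣ A) (ass A A A) V).inv ≫ (rIso α V).hom ≫
          (rComp δ (A ⊠ₗ δ) V).hom) := by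
  have h := freePentagon_eq (tId A (A ⊠ V)) (tId (A ⊠ A) (A ⊠ V))
    (lIso A (tId A (A ⊠ V)) ≪≫ tId A (A ⊠ A ⊠ V)) (lComp A (δ ⊠ᵣ V) (ass A A V))
    (assNat₂ A δ V) (pent A A A V) (assNat₁ δ A V) (interchange_id δ (A ⊠ V))
    (assNat₃_id A A (A ⊠ V)) (lComp A (ass A A V) (A ⊠ₗ 𝟙 (A ⊠ V))) (s := freeCoactSq δ)
    (s' := tSq (idSq (𝟙 A)) (freeCoactSq δ))
    (by simp) (tSq_freeCoactSq δ) (rComp δ _ V) (rComp (δ ⊠ᵣ A) (ass A A A) V)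
    (rComp δ (A ⊠ₗ δ) V) (rIso α V)
  refine Eq.trans ?_ h
  rw [← freeCoact_comp_sq]
  rfl

/-- After the test the two occurrences of `α₁` become canonical. What remains is α ⊗ V on the left
and, through `freeIso`, its conjugate on the right, so the equation holds for every `α`. -/
theorem pentagon_r {q : A ⊠ V ⟶ V} (θ : Sq (δ ⊠ᵣ V) (𝟙 (A ⊠ V)) (𝟙 (A ⊠ V)) (ass A A V ≫ A ⊠ₗ q))
    (α : δ ≫ (δ ⊠ᵣ A) ≫ ass A A A ≅ δ ≫ (A ⊠ₗ δ))
    (α₁ : (⟨δ, 𝟙 _, θ⟩ : free V A ⟶ A ⋆ ⟨A, V, q⟩) ≫ (δ ⋆₁ 𝟙 _) ≫ actAss A A _ ≅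
      freeCoact δ ≫ (𝟙 A ⋆₁ ⟨δ, 𝟙 _, θ⟩))
    (hα₁ : α₁.hom.r = (coactCoherence δ).hom) :
    (pentagonLeft α α₁).r = (pentagonRight α₁ (freeIso α :
      freeCoact δ ≫ (δ ⋆₁ 𝟙 (free V A)) ≫ actAss A A _ ≅ freeCoact δ ≫ (𝟙 A ⋆₁ freeCoact δ))).r := by
  have hβ' : ((actLComp₃ A _ _ _).inv ≫ (actLIso A α₁).hom ≫ (actLComp A _ _).hom).r = _ :=
    (congrArg (fun t => (lComp₃ A (𝟙 (A ⊠ V)) (δ ⊠ᵣ V) (ass A A V)).inv ≫ tLeft₂ A t ≫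
      (lComp A (δ ⊠ᵣ V ≫ ass A A V) (A ⊠ₗ 𝟙 (A ⊠ V))).hom) hα₁).trans (tLeft_coactCoherence δ)
  exact pentagon_eq (tId A (A ⊠ V)) (tId (A ⊠ A) (A ⊠ V))
    (lIso A (tId A (A ⊠ V)) ≪≫ tId A (A ⊠ A ⊠ V)) (lComp A (δ ⊠ᵣ V) (ass A A V))
    (assNat₂ A δ V) (pent A A A V) (assNat₁ δ A V) (Iso.refl (𝟙 (A ⊠ V)))
    (interchange_id δ (A ⊠ V))
    (assNat₃_id A A (A ⊠ V)) ((rComp₃ δ (δ ⊠ᵣ A) (ass A A A) V).inv ≫ (rIso α V).hom ≫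
          (rComp δ (A ⊠ₗ δ) V).hom) rfl (β := α₁.hom.r) (by rw [hα₁]; simp)
    (β' := ((actLComp₃ A _ _ _).inv ≫ (actLIso A α₁).hom ≫ (actLComp A _ _).hom).r) hβ'
    ((freeIso_r δ α).trans (by simp))

end Free

end VArr
end MonBicat

/-! ### Assembling the pseudocomonoid. -/

namespace MonBicat

open Sq MonoidalBicategory VArr


section

open MonoidalCategory

theorem coact_sq_aux {C : Type*} [Category C] [MonoidalCategory C] {A : C} {d : A ⟶ A ⊗ A}
    {e : A ⟶ 𝟙_ C} (h : d ≫ A ◁ e ≫ (ρ_ A).hom = 𝟙 A) :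
    d ▷ 𝟙_ C ≫ (α_ A A (𝟙_ C)).hom ≫ A ◁ (e ▷ 𝟙_ C ≫ (λ_ (𝟙_ C)).hom) = 𝟙 _ ≫ 𝟙 _ := by
  calc _ = (d ≫ A ◁ e ≫ (ρ_ A).hom) ▷ 𝟙_ C := by simp
    _ = _ := by simp [h]

end

section

variable {B : Type u} [Bicategory.{w, v} B] [MonoidalBicategory B] {V A : B} {P Q : VArr V}
  {δ : A ⟶ A ⊠ A} {e : A ⟶ unit B} {δ₁ : P ⟶ A ⋆ Q} {δ₂ : P ⟶ A ⋆ P} {ι : P ⟶ Q}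

/-- Invertibility is what makes the right counitor solved from the triangle an isomorphism. -/
theorem isIso_triangleLeft (α₁ : δ₁ ≫ (δ ⋆₁ 𝟙 Q) ≫ actAss A A Q ≅ δ₂ ≫ (𝟙 A ⋆₁ δ₁))
    (lam₁ : δ₁ ≫ (e ⋆₁ 𝟙 Q) ≫ actLun Q ≅ ι) (κ : δ₂ ≫ (𝟙 A ⋆₁ ι) ≅ δ₁ ≫ 𝟙 (A ⋆ Q)) :
    IsIso (triangleLeft α₁ lam₁ κ) := by
  unfold triangleLeft
  simp only [bicategoricalComp]
  infer_instance

end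

section Comonoid

variable {B : Type u} [Bicategory.{w, v} B] [MonoidalBicategory B] {A : B}

theorem tRight₂_unit_injective {X X' : B} {f g : X ⟶ X'} {x y : f ⟶ g}
    (h : tRight₂ x (unit B) = tRight₂ y (unit B)) : x = y := by
  have : IsIso (Ho.cls (run X)) := by
    rw [Ho.cls_run]
    infer_instance
  have hx : _ = _ := cyl_runNat x
  have hy : _ = _ := cyl_runNat y
  rw [h, hy, cancel_epi] at hx
  exact whiskerLeft_injective_of_isIso (run X) hx.symm

theorem exists_tRight₂_unit_iso {X X' : B} {f g : X ⟶ X'} (y : f ⊠ᵣ unit B ≅ g ⊠ᵣ unit B) :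
    ∃ θ : f ≅ g, rIso θ (unit B) = y := by
  obtain ⟨a, ha⟩ := tRight₂_unit_surjective y.hom
  obtain ⟨b, hb⟩ := tRight₂_unit_surjective y.inv
  exact ⟨⟨a, b, tRight₂_unit_injective (by rw [tRight₂_comp, ha, hb]; simp),
    tRight₂_unit_injective (by rw [tRight₂_comp, ha, hb]; simp)⟩, Iso.ext ha⟩

theorem exists_coact_sq {e : A ⟶ unit B} {δ : A ⟶ A ⊠ A}
    (h : Ho.cls (δ ≫ A ⊠ₗ e ≫ run A) = Ho.cls (𝟙 A)) :
    Nonempty (Sq (δ ⊠ᵣ unit B) (𝟙 (A ⊠ unit B)) (𝟙 (A ⊠ unit B))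
      (ass A A (unit B) ≫ A ⊠ₗ (e ⊠ᵣ unit B ≫ lun (unit B)))) :=
  Ho.cls_eq.1 (coact_sq_aux (C := Ho B) (A := ⟨A⟩) (d := Ho.cls δ) (e := Ho.cls e) h)

/-- On second components the right side of the triangle is `rho` tensored with the unit object and
whiskered by an equivalence. Both operations are bijective on 2-cells, so the triangle can be solved
for `rho`. -/
theorem exists_counitor {e : A ⟶ unit B} {δ : A ⟶ A ⊠ A} {q : A ⊠ unit B ⟶ unit B}
    {P : VArr (unit B)} (δ₁ : P ⟶ A ⋆ ⟨A, unit B, q⟩) [IsIso (Ho.cls δ₁.snd)]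
    {η : (δ₁ ≫ (δ ⋆₁ 𝟙 _) ≫ ((A ⊠ₗ e) ⋆₁ 𝟙 _)) ≫ (run A ⋆₁ 𝟙 _) ⟶ δ₁ ≫ 𝟙 _} (hη : IsIso η) :
    ∃ rho : δ ≫ (A ⊠ₗ e) ≫ run A ≅ 𝟙 A, η.r = (triangleRight rho (δ₁ := δ₁)).r := by
  let ηr : (δ₁.snd ≫ (δ ⊠ᵣ unit B) ≫ ((A ⊠ₗ e) ⊠ᵣ unit B)) ≫ (run A ⊠ᵣ unit B) ≅
      δ₁.snd ≫ 𝟙 (A ⊠ unit B) :=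
    ⟨η.r, (inv η).r, congrArg Hom₂.r (IsIso.hom_inv_id η), congrArg Hom₂.r (IsIso.inv_hom_id η)⟩
  obtain ⟨x, hx⟩ := exists_iso_whiskerLeft δ₁.snd
    (whiskerLeftIso _ (α_ _ _ _).symm ≪≫ (α_ _ _ _).symm ≪≫ ηr)
  obtain ⟨rho, hrho⟩ := exists_tRight₂_unit_iso
    (rComp₃ δ (A ⊠ₗ e) (run A) (unit B) ≪≫ x ≪≫ (tId A (unit B)).symm)
  refine ⟨rho, ?_⟩
  change ηr.hom = 𝟙 _ ⊗≫ δ₁.snd ◁ ((rComp₃ δ (A ⊠ₗ e) (run A) (unit B)).inv ≫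
    (rIso rho (unit B)).hom ≫ (tId A (unit B)).hom) ⊗≫ 𝟙 _
  clear_value ηr
  have hx' : ηr.hom = (α_ _ _ _).hom ≫ _ ◁ (α_ _ _ _).hom ≫ δ₁.snd ◁ x.hom := by
    simp [hx]
  rw [hrho, hx']
  simp [bicategoricalComp]

/-- The comultiplication induced by a pairing underlies a pseudocomonoid. -/
theorem Pseudomonoid.exists_pseudocomonoid (M : Pseudomonoid A) {e : A ⟶ unit B}
    {c : unit B ⟶ A ⊠ A}
    (hp : IsPairing (C := Ho B) (X := ⟨A⟩) (Y := ⟨A⟩) (Ho.cls (M.mul ≫ e)) (Ho.cls c)) :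
    ∃ D : Pseudocomonoid A,
      Ho.cls D.comul = comulOf (C := Ho B) (A := ⟨A⟩) (Ho.cls M.mul) (Ho.cls c) := by
  obtain ⟨D, hD⟩ := AlgMap.exists_comul M c
  let δ : A ⟶ A ⊠ A := D.hom
  have hδ : Ho.cls (δ ≫ A ⊠ₗ e ≫ run A) = Ho.cls (𝟙 A) := by
    have h := comulOf_counit (C := Ho B) (A := ⟨A⟩) (m := Ho.cls M.mul) (e := Ho.cls e) hp =≫ (MonoidalCategory.rightUnitor (C := Ho B) ⟨A⟩).hom
    rw [← hD, Iso.inv_hom_id, Category.assoc] at h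
    exact h
  -- Any isomorphism expressing the right counit law will do; nothing is required of it.
  obtain ⟨θ⟩ := exists_coact_sq hδ
  let Q : VArr (unit B) := ⟨A, unit B, e ⊠ᵣ unit B ≫ lun (unit B)⟩
  let δ₁ : free (unit B) A ⟶ A ⋆ Q := ⟨δ, 𝟙 _, θ⟩
  let δ₂ : free (unit B) A ⟶ A ⋆ free (unit B) A := freeCoact δ
  let δA : M.arr ⟶ A ⋆ M.arr := D.arr
  -- The superfluous identity makes the second component literally that of `δ₁ ≫ (e ⋆₁ 𝟙 Q) ≫ actLun
  -- Q`, so the left counitor can lie over an identity 2-cell.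
  let ι : free (unit B) A ⟶ Q := ⟨𝟙 A, 𝟙 _ ≫ (e ⊠ᵣ unit B) ≫ lun (unit B),
    whiskerRightIso (tId _ _) _ ≪≫ (λ_ _).symm⟩
  have ht := IsTest.self hp
  -- The coassociator: the linear 2-cell that the test sends to the canonical one.
  obtain ⟨α, hα, hα'⟩ : ∃ α : δ ≫ (δ ⊠ᵣ A) ≫ ass A A A ≅ δ ≫ (A ⊠ₗ δ),
      Cyl (δA ≫ (δ ⋆₁ 𝟙 M.arr) ≫ actAss A A M.arr).sq (δA ≫ (𝟙 A ⋆₁ δA)).sq (tRight₂ α.hom A)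
        α.hom ∧
      Cyl (δ₁ ≫ (δ ⋆₁ 𝟙 Q) ≫ actAss A A Q).sq (δ₂ ≫ (𝟙 A ⋆₁ δ₁)).sq (tRight₂ α.hom (unit B))
        (coactCoherence δ).hom :=
    ((ht.tensor A).tensor A).exists_iso hp
      (D.comp ((AlgMap.tensorMap D.hom (AlgMap.id _)).comp (AlgMap.assMap A A _)))
      (D.comp (AlgMap.tensorMap (𝟙 A) D)) _ _ _
  obtain ⟨lam, hlam, hlam'⟩ : ∃ lam : δ ≫ (e ⊠ᵣ A) ≫ lun A ≅ 𝟙 A,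
      Cyl (δA ≫ (e ⋆₁ 𝟙 M.arr) ≫ actLun M.arr).sq (𝟙 M.arr : M.arr ⟶ M.arr).sq
        (tRight₂ lam.hom A) lam.hom ∧
      Cyl (δ₁ ≫ (e ⋆₁ 𝟙 Q) ≫ actLun Q).sq ι.sq (tRight₂ lam.hom (unit B)) (Iso.refl _).hom :=
    ht.exists_iso hp (D.comp ((AlgMap.tensorMap e (AlgMap.id _)).comp (AlgMap.lunMap _)))
      (AlgMap.id _) _ _ _
  let αA : δA ≫ (δ ⋆₁ 𝟙 M.arr) ≫ actAss A A M.arr ≅ δA ≫ (𝟙 A ⋆₁ δA) := isoMk α α hα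
  let α₁ : δ₁ ≫ (δ ⋆₁ 𝟙 Q) ≫ actAss A A Q ≅ δ₂ ≫ (𝟙 A ⋆₁ δ₁) := isoMk α (coactCoherence δ) hα'
  let α₂ : δ₂ ≫ (δ ⋆₁ 𝟙 _) ≫ actAss A A _ ≅ δ₂ ≫ (𝟙 A ⋆₁ δ₂) := freeIso α
  let lamA : δA ≫ (e ⋆₁ 𝟙 M.arr) ≫ actLun M.arr ≅ 𝟙 M.arr := isoMk lam lam hlam
  let lam₁ : δ₁ ≫ (e ⋆₁ 𝟙 Q) ≫ actLun Q ≅ ι := isoMk lam (Iso.refl _) hlam'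
  let κA : δA ≫ (𝟙 A ⋆₁ 𝟙 M.arr) ≅ δA ≫ 𝟙 _ := whiskerLeftIso δA (actId A M.arr)
  let κ : δ₂ ≫ (𝟙 A ⋆₁ ι) ≅ δ₁ ≫ 𝟙 (A ⋆ Q) := freeIso (whiskerLeftIso δ (tId A A))
  have : IsIso (Ho.cls δ₁.snd) := by
    change IsIso (Ho.cls (𝟙 (A ⊠ unit B)))
    rw [Ho.cls_id]
    infer_instance
  -- The right counitor is not found by the linearity argument; it is chosen so that the tested
  -- triangle holds.
  obtain ⟨rho, hrho⟩ := exists_counitor δ₁ (isIso_triangleLeft α₁ lam₁ κ)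
  -- The diagrams in `VArr A` show that both sides are linear, those in `VArr (unit B)` that they
  -- have the same test; their first components are the two sides of the axiom.
  have hpent := ((((ht.tensor A).tensor A).tensor A).unique hp (pentagonLeft α αA).comm
    (pentagonRight αA αA).comm (pentagonLeft α α₁).comm
    ((pentagonRight α₁ α₂).comm.congr rfl (pentagon_r δ θ α α₁ rfl)))
  have htri := ((ht.tensor A).unique hp (triangleLeft αA lamA κA).comm
    (triangleRight rho (δ₁ := δA)).comm (triangleLeft α₁ lam₁ κ).comm
    ((triangleRight rho (δ₁ := δ₁)).comm.congr rfl hrho))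
  refine ⟨⟨δ, e, α, lam, rho, hpent, ?_⟩, hD⟩
  -- In `triangleLeft` the last constraint is the separate factor `κ`, whereas the axiom has it
  -- inside the whiskering by the comultiplication.
  rw [← Category.assoc (lComp₃ A δ (e ⊠ᵣ A) (lun A)).inv (lIso A lam).hom (tId A A).hom,
    whiskerLeft_comp δ (_ ≫ (lIso A lam).hom)]
  exact htri

end Comonoid

end MonBicat

/-! ### The equivalence of the three conditions. -/

theorem mainTheorem11 {B : Type u} [Bicategory.{w, v} B] [MonoidalBicategory B] (A : B)
    (M : Pseudomonoid A) :
    List.TFAE [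
      ∃ e : A ⟶ unit B, IsBiexactEvaluation (M.mul ≫ e),
      ∃ σ : A ⊠ A ⟶ unit B, IsBiexactEvaluation σ ∧
        Nonempty ((M.mul ⊠ᵣ A) ≫ σ ≅ ass A A A ≫ (A ⊠ₗ M.mul) ≫ σ),
      ∃ D : Pseudocomonoid A,
        Nonempty ((A ⊠ₗ D.comul) ≫ assInv A A A ≫ (M.mul ⊠ᵣ A) ≅ M.mul ≫ D.comul) ∧
        Nonempty (M.mul ≫ D.comul ≅ (D.comul ⊠ᵣ A) ≫ ass A A A ≫ (A ⊠ₗ M.mul))] := by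
  tfae_have 1 → 2 := by
    rintro ⟨e, he⟩
    exact ⟨M.mul ≫ e, he, ⟨(α_ _ _ _).symm ≪≫ whiskerRightIso M.α e ≪≫ α_ _ _ _ ≪≫
      whiskerLeftIso _ (α_ _ _ _)⟩⟩
  tfae_have 2 → 1 := by
    rintro ⟨σ, hσ, ⟨θ⟩⟩
    -- The form ε is σ with the unit of the pseudomonoid inserted in its first variable.
    have h : Ho.cls (M.mul ≫ lunInv A ≫ M.one ⊠ᵣ A ≫ σ) = Ho.cls σ :=
      mul_comp_of_invariant (C := Ho B) (A := ⟨A⟩) (s := Ho.cls σ)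
        (Ho.cls_one_mul M) (Ho.cls_eq.2 ⟨θ⟩)
    exact ⟨_, Ho.IsBiexactEvaluation.of_iso (Ho.cls_eq.1 h.symm).some hσ⟩
  tfae_have 3 → 1 := by
    rintro ⟨D, ⟨θ₁⟩, ⟨θ₂⟩⟩
    -- The coevaluation is the comultiplication of the unit.
    exact ⟨D.counit, (Ho.isBiexactEvaluation_iff _).2 ⟨M.one ≫ D.comul,
      isPairing_of_frobenius (C := Ho B) (A := ⟨A⟩) (d := Ho.cls D.comul) (e := Ho.cls D.counit)
        (Ho.cls_one_mul M) (Ho.cls_mul_one M)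
        (Ho.cls_eq.2 ⟨D.lam⟩) (Ho.cls_eq.2 ⟨D.rho⟩) (Ho.cls_eq.2 ⟨θ₁⟩) (Ho.cls_eq.2 ⟨θ₂⟩)⟩⟩
  tfae_have 1 → 3 := by
    rintro ⟨e, he⟩
    obtain ⟨c, hc⟩ := (Ho.isBiexactEvaluation_iff _).1 he
    -- The comultiplication is only known up to isomorphism, as `comulOf`; for the two Frobenius
    -- isomorphisms this is enough.
    obtain ⟨D, hD⟩ := M.exists_pseudocomonoid hc
    have ha := Ho.cls_mul_assoc M
    have h₁ := frobenius_left (C := Ho B) (A := ⟨A⟩) ha (e := Ho.cls e) hc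
    have h₂ := mul_comulOf (C := Ho B) (A := ⟨A⟩) ha (Ho.cls c)
    rw [← hD] at h₁ h₂
    exact ⟨D, Ho.cls_eq.1 h₁, Ho.cls_eq.1 h₂⟩
  tfae_finish
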